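/- Let $\mathbb F_q$ be a finite field, $k=\mathbb F_q(T)$, and let $K/k$ be a cyclic extension of degree $n$ with $n\mid q-1$, with Galois group $G=\operatorname{Gal}(K/k)$. Let $\mathcal O_K$ be the integral closure of $\mathbb F_q[T]$ in $K$, let $I_K$ be the group of non-zero fractional ideals of $\mathcal O_K$, and let $k_\infty$ be the completion of $k$ at the infinite prime (the pole of $T$). Put $K^+=\{x\in K^*\mid \operatorname{N}_{K/k}(x)\in k_\infty^{*n}\}$, let $P_K^+$ be the group of principal fractional ideals $(\beta)$ of $\mathcal O_K$ with $\beta\in K^+$, and let $Cl^+(\mathcal O_K)=I_K/P_K^+$, on which $G$ acts. Then only finitely many monic irreducible polynomials $P\in\mathbb F_q[T]$ ramify in $K$. If these are $P_1,\ldots,P_r$, with ramification indices $e_1,\ldots,e_r$ in $K/k$, then the number of ambiguous classes is $$\big|Cl^+(\mathcal O_K)^G\big|=e_1\cdots e_r .$$ -/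

import Mathlib

open scoped Polynomial RatFunc nonZeroDivisors

namespace AmbiguousClasses

noncomputable section

section Infinity

variable (Fq : Type*) [Field Fq]

open scoped Classical in
/-- The completion `k_∞` of the rational function field `k = Fq(T)` at the infinite prime, that is,
at the pole of `T`. -/
abbrev KInfty : Type _ := RatFunc.CompletionAtInfty Fq

end Infinity

section Field

variable (Fq K : Type*) [Field Fq] [Field K] [Algebra Fq⟮X⟯ K]

/-- The subgroup `K⁺ = {x ∈ Kˣ | N_{K/k}(x) ∈ (k_∞ˣ)ⁿ}` of `Kˣ`, where `k = Fq(T)` and `n = [K : k]`.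
(For `x ≠ 0` and `n ≥ 1` an `n`-th root of `N_{K/k}(x)` in `k_∞` is automatically non-zero.) -/
def plusElements : Subgroup Kˣ :=
  (powMonoidHom (Module.finrank Fq⟮X⟯ K) : (KInfty Fq)ˣ →* (KInfty Fq)ˣ).range.comap
    ((Units.map (algebraMap Fq⟮X⟯ (KInfty Fq)).toMonoidHom).comp
      (Units.map (Algebra.norm Fq⟮X⟯ : K →* Fq⟮X⟯)))

theorem mem_plusElements_iff (x : Kˣ) :
    x ∈ plusElements Fq K ↔ ∃ y : (KInfty Fq)ˣ,
      (y : KInfty Fq) ^ Module.finrank Fq⟮X⟯ K =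
        algebraMap Fq⟮X⟯ (KInfty Fq) (Algebra.norm Fq⟮X⟯ (x : K)) := by
  simp [plusElements, Subgroup.mem_comap, MonoidHom.mem_range, Units.ext_iff]

variable {Fq K} in
theorem map_mem_plusElements (σ : K ≃ₐ[Fq⟮X⟯] K) {x : Kˣ} (hx : x ∈ plusElements Fq K) :
    Units.map (σ : K →* K) x ∈ plusElements Fq K := by
  rw [mem_plusElements_iff] at hx ⊢
  obtain ⟨y, hy⟩ := hx
  refine ⟨y, hy.trans ?_⟩
  congr 1
  exact (Algebra.norm_eq_of_algEquiv σ (x : K)).symm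

end Field

section Ideals

variable (Fq K : Type*) [Field Fq] [Field K] [Algebra Fq[X] K] [Algebra Fq⟮X⟯ K]
  [IsScalarTower Fq[X] Fq⟮X⟯ K] [FunctionField Fq K]

/-- `O_K`, the integral closure of `Fq[T]` in `K`. -/
local notation "OK" => FunctionField.ringOfIntegers Fq K

/-- The group `I_K` of fractional ideals of `O_K`. (`O_K` is a Dedekind domain when `K/k` is
separable, so that invertible and non-zero fractional ideals are the same.) -/
abbrev FracIdeals : Type _ := (FractionalIdeal OK⁰ K)ˣ

/-- The group `P_K⁺` of principal fractional ideals with a generator in `K⁺`. -/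
def plusPrincipal : Subgroup (FracIdeals Fq K) :=
  (plusElements Fq K).map (toPrincipalIdeal OK K)

/-- The extended ideal class group `Cl⁺(O_K) = I_K / P_K⁺`. -/
abbrev ExtendedClassGroup : Type _ := FracIdeals Fq K ⧸ plusPrincipal Fq K

variable {K} in
/-- The restriction of `σ ∈ Gal(K/k)` to `O_K`. -/
def galInteger (σ : K ≃ₐ[Fq⟮X⟯] K) : OK ≃+* OK :=
  ((σ.restrictScalars Fq[X]).mapIntegralClosure : integralClosure Fq[X] K ≃ₐ[Fq[X]] _).toRingEquiv

variable {K} in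
/-- The action of `σ ∈ Gal(K/k)` on `I_K`, sending `𝔞` to `σ(𝔞)`. -/
def galIdeal (σ : K ≃ₐ[Fq⟮X⟯] K) : FracIdeals Fq K ≃* FracIdeals Fq K :=
  Units.mapEquiv (FractionalIdeal.ringEquivOfRingEquiv K K (galInteger Fq σ)).toMulEquiv

variable {K} in
theorem ringEquivOfRingEquiv_galInteger (σ : K ≃ₐ[Fq⟮X⟯] K) (x : K) :
    IsFractionRing.ringEquivOfRingEquiv (K := K) (L := K) (galInteger Fq σ) x = σ x := by
  obtain ⟨a, b, -, rfl⟩ := IsFractionRing.div_surjective OK x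
  rw [map_div₀, map_div₀, IsFractionRing.ringEquivOfRingEquiv_algebraMap,
    IsFractionRing.ringEquivOfRingEquiv_algebraMap]
  rfl

variable {K} in
/-- `galIdeal` is the elementwise image. -/
theorem mem_galIdeal_iff (σ : K ≃ₐ[Fq⟮X⟯] K) (I : FracIdeals Fq K) (x : K) :
    x ∈ (galIdeal Fq σ I : FractionalIdeal OK⁰ K) ↔
      ∃ y ∈ (I : FractionalIdeal OK⁰ K), σ y = x := by
  have key : x ∈ (galIdeal Fq σ I : FractionalIdeal OK⁰ K) ↔
      ∃ y ∈ (I : FractionalIdeal OK⁰ K),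
        IsFractionRing.ringEquivOfRingEquiv (K := K) (L := K) (galInteger Fq σ) y = x := Iff.rfl
  simpa only [ringEquivOfRingEquiv_galInteger] using key

variable {K} in
theorem galIdeal_toPrincipalIdeal (σ : K ≃ₐ[Fq⟮X⟯] K) (x : Kˣ) :
    galIdeal Fq σ (toPrincipalIdeal OK K x) =
      toPrincipalIdeal OK K (Units.map (σ : K →* K) x) := by
  ext z
  rw [mem_galIdeal_iff, coe_toPrincipalIdeal, coe_toPrincipalIdeal]
  simp only [FractionalIdeal.mem_spanSingleton, Algebra.smul_def]
  constructor
  · rintro ⟨_, ⟨a, rfl⟩, rfl⟩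
    exact ⟨galInteger Fq σ a, (map_mul σ _ _).symm⟩
  · rintro ⟨a, rfl⟩
    refine ⟨_, ⟨(galInteger Fq σ).symm a, rfl⟩, (map_mul σ _ _).trans ?_⟩
    congr 1
    exact congrArg (algebraMap OK K) ((galInteger Fq σ).apply_symm_apply a)

variable {K} in
theorem map_plusPrincipal (σ : K ≃ₐ[Fq⟮X⟯] K) :
    (plusPrincipal Fq K).map (galIdeal Fq σ).toMonoidHom = plusPrincipal Fq K := by
  apply le_antisymm
  · rintro _ ⟨_, ⟨x, hx, rfl⟩, rfl⟩
    exact ⟨_, map_mem_plusElements σ hx, (galIdeal_toPrincipalIdeal Fq σ x).symm⟩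
  · rintro _ ⟨x, hx, rfl⟩
    refine ⟨_, ⟨_, map_mem_plusElements σ.symm hx, rfl⟩, ?_⟩
    refine (galIdeal_toPrincipalIdeal Fq σ _).trans (congrArg _ (Units.ext ?_))
    exact σ.apply_symm_apply (x : K)

variable {K} in
/-- The action of `σ ∈ Gal(K/k)` on `Cl⁺(O_K)`, sending the class of `𝔞` to the class of `σ(𝔞)`. -/
def galClass (σ : K ≃ₐ[Fq⟮X⟯] K) : ExtendedClassGroup Fq K ≃* ExtendedClassGroup Fq K :=
  QuotientGroup.congr _ _ (galIdeal Fq σ) (map_plusPrincipal Fq σ)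

/-- The group `Cl⁺(O_K)^G` of ambiguous classes, `G = Gal(K/k)`. -/
def ambiguousClasses : Subgroup (ExtendedClassGroup Fq K) where
  carrier := {c | ∀ σ : K ≃ₐ[Fq⟮X⟯] K, galClass Fq σ c = c}
  one_mem' σ := map_one _
  mul_mem' ha hb σ := by rw [map_mul, ha σ, hb σ]
  inv_mem' ha σ := by rw [map_inv, ha σ]

/-- The ramification index `e_P` in `K/k` of the finite prime generated by `P ∈ Fq[T]`. (For `K/k`
Galois it does not depend on the prime above `P`.) -/
def ramIndex (P : Fq[X]) : ℕ :=
  (Ideal.span {P}).ramificationIdxIn OK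

end Ideals

end

end AmbiguousClasses

/-! Fix a generator g of G. Let φ : K^* → I_K be the principal ideal map, D = g - 1 (written
multiplicatively), N the product over G, and E = O_K^* ∩ K^+. Put h₁ = |E ∩ ker N / DE| and h₀ =
|E^G / NE|. A class is ambiguous exactly when D carries a representative into P_K^+, so the number
sought is the index of P_K^+ in its preimage under D. Hilbert 90 holds for K^*, and also for I_K,
which is a permutation module on the primes. Splitting the index along D, φ and N then gives
`ambiguous_relIndex_formula`: |Cl^+(O_K)^G| · h₁ · [F_q^* : N(K^+) ∩ F_q^*] = [I_K^G : φ(k^*)] ·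
[K^* : K^+] · h₀.

Write d = e_∞ f_∞ for the order of a decomposition group at infinity. Four evaluations finish the
proof. [I_K^G : φ(k^*)] is the product of the e_P, because F_q[T] is principal
(`relIndex_map_toPrincipalIdeal_baseUnits`). [F_q^* : N(K^+) ∩ F_q^*] = n, because a constant is an
n-th power in k_∞ only if it is one in F_q (`relIndex_map_actionNorm_inf_ker`). [K^* : K^+] · d = n²
(`index_comap_completionPowers`). Since n divides q - 1, being an n-th power in k_∞ is decided for a
unit by its residue, while norms have order divisible by f_∞ and norms of units have e_∞-th powers
as residues. h₁ · d = n · h₀ (`tateIndex_plusUnits`). The group E · T^ℤ maps to the divisors above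
infinity with finite kernel and cokernel, which leaves the Herbrand quotient unchanged. The target
has orders 1 and d, and the factor T^ℤ multiplies h₀ by n and leaves h₁ alone. Multiplying the
formula by d and substituting cancels everything except the product of the e_P.

The finite cokernel is a weak unit theorem, obtained from a pigeonhole form of Riemann's inequality
(`exists_isIntegral_of_le_normDegree`). Above infinity K is not completed: the work takes place in
the integral closure of the valuation ring at infinity, a semi-local principal ideal domain.
Cohomology groups enter only through their orders, as relative indices of subgroups, where 0 stands
for an infinite index. -/

set_option linter.unusedSectionVars false

namespace AmbiguousClasses

/-! ### Tate cohomology orders as subgroup indices, and the Herbrand quotient. -/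

section GroupIndex

variable {L I : Type*} [CommGroup L] [CommGroup I]

/-- The index `[B : A]` splits along a homomorphism into the index of the images and that of the
kernels. -/
theorem relIndex_map_mul_relIndex_inf_ker (f : L →* I) {A B : Subgroup L} (h : A ≤ B) :
    (A.map f).relIndex (B.map f) * (A ⊓ f.ker).relIndex (B ⊓ f.ker) = A.relIndex B := by
  have h1 : (A.map f).relIndex (B.map f) = (A ⊔ f.ker ⊓ B).relIndex B := by
    rw [Subgroup.relIndex_map_map, show B ⊔ f.ker = B ⊔ (A ⊔ f.ker) by
      rw [← sup_assoc, sup_eq_left.2 h], Subgroup.relIndex_sup_right, ← sup_inf_assoc_of_le _ h,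
      Subgroup.inf_relIndex_right]
  have h2 : (A ⊓ f.ker).relIndex (B ⊓ f.ker) = A.relIndex (A ⊔ f.ker ⊓ B) := by
    rw [Subgroup.relIndex_sup_left, ← Subgroup.inf_relIndex_right A, inf_comm f.ker B,
      ← inf_assoc, inf_eq_left.2 h]
  rw [h1, h2, mul_comm, Subgroup.relIndex_mul_relIndex _ _ _ le_sup_left
    (sup_le h inf_le_right)]

/-- The order of the Tate cohomology group `(M ∩ ker N) / D M` of a subgroup `M` stable under the
two endomorphisms `D` and `N`. -/
noncomputable def tateIndex (D N : L →* L) (M : Subgroup L) : ℕ :=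
  (M.map D).relIndex (M ⊓ N.ker)

/-- The order of the Tate cohomology group of the quotient `M / M'`. -/
noncomputable def tateIndexQuot (D N : L →* L) (M M' : Subgroup L) : ℕ :=
  (M.map D ⊔ M').relIndex (M ⊓ M'.comap N)

/-- This replaces the exact hexagon. The correction factor is a product of two indices that is
symmetric in `D` and `N`, so it cancels when the identity is divided by the one with `D` and `N`
exchanged. -/
theorem tateIndexQuot_mul_tateIndex {D N : L →* L} (hND : ∀ x, N (D x) = 1) {M M' : Subgroup L}
    (hle : M' ≤ M) (hDM : M.map D ≤ M) (hDM' : M'.map D ≤ M') (hNM' : M'.map N ≤ M') :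
    tateIndexQuot D N M M' * tateIndex D N M' =
      (M'.map N).relIndex (M' ⊓ M.map N) * (M'.map D).relIndex (M' ⊓ M.map D) *
        tateIndex D N M := by
  have hker : M.map D ≤ N.ker := by
    rintro _ ⟨x, -, rfl⟩
    exact hND x
  have hmap : (M.map D ⊔ M').map N = M'.map N := by
    rw [Subgroup.map_sup, (Subgroup.map_eq_bot_iff (M.map D) (f := N)).2 hker, bot_sup_eq]
  have hle1 : M.map D ⊔ M' ≤ M ⊓ M'.comap N :=
    sup_le (le_inf hDM fun x hx ↦ by
      rw [Subgroup.mem_comap, hker hx]; exact one_mem _)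
      (le_inf hle (Subgroup.map_le_iff_le_comap.1 hNM'))
  have h1 := relIndex_map_mul_relIndex_inf_ker N hle1
  have e1 : (M ⊓ M'.comap N).map N = M' ⊓ M.map N := by
    ext y
    constructor
    · rintro ⟨x, ⟨hx, hx'⟩, rfl⟩
      exact ⟨hx', x, hx, rfl⟩
    · rintro ⟨hy, x, hx, rfl⟩
      exact ⟨x, ⟨hx, hy⟩, rfl⟩
  have e2 : (M ⊓ M'.comap N) ⊓ N.ker = M ⊓ N.ker := by
    refine le_antisymm (inf_le_inf_right _ inf_le_left) (le_inf (le_inf inf_le_left ?_) inf_le_right)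
    rintro x ⟨-, hx⟩
    rw [Subgroup.mem_comap, hx]
    exact one_mem _
  have e3 : (M.map D ⊔ M') ⊓ N.ker = M.map D ⊔ M' ⊓ N.ker := sup_inf_assoc_of_le _ hker
  rw [hmap, e1, e2, e3] at h1
  have h2 : (M'.map D).relIndex (M' ⊓ M.map D) * (M' ⊓ M.map D).relIndex (M' ⊓ N.ker) =
      tateIndex D N M' :=
    Subgroup.relIndex_mul_relIndex _ _ _ (le_inf hDM' (Subgroup.map_mono hle))
      (inf_le_inf_left _ hker)
  have h3 : (M' ⊓ M.map D).relIndex (M' ⊓ N.ker) * (M.map D ⊔ M' ⊓ N.ker).relIndex (M ⊓ N.ker) =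
      tateIndex D N M := by
    rw [tateIndex, ← Subgroup.relIndex_mul_relIndex (M.map D) (M.map D ⊔ M' ⊓ N.ker) (M ⊓ N.ker)
      le_sup_left (sup_le (le_inf hDM hker) (inf_le_inf_right _ hle)), Subgroup.relIndex_sup_left,
      ← Subgroup.inf_relIndex_right (M.map D)]
    congr 2
    rw [← inf_assoc, inf_comm _ M', inf_assoc, inf_eq_left.2 hker]
  rw [tateIndexQuot, ← h1, ← h2, ← h3]
  ring

/-- A finite module has Herbrand quotient 1: |DM| · h · |NM| = |M| holds for either order of `D` and
`N`. -/
theorem tateIndex_comm_of_finite {D N : L →* L} (hND : ∀ x, N (D x) = 1) (hDN : ∀ x, D (N x) = 1)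
    {M : Subgroup L} (hDM : M.map D ≤ M) (hNM : M.map N ≤ M) [Finite M] :
    tateIndex D N M ≠ 0 ∧ tateIndex D N M = tateIndex N D M := by
  have key : ∀ {D N : L →* L}, (∀ x, N (D x) = 1) → M.map D ≤ M →
      Nat.card (M.map D) * tateIndex D N M * Nat.card (M.map N) = Nat.card M := by
    intro D N hND hDM
    have h1 := relIndex_map_mul_relIndex_inf_ker N (bot_le (a := M))
    rw [Subgroup.map_bot, bot_inf_eq, Subgroup.relIndex_bot_left, Subgroup.relIndex_bot_left,
      Subgroup.relIndex_bot_left] at h1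
    have h2 := Subgroup.relIndex_mul_relIndex ⊥ (M.map D) (M ⊓ N.ker) bot_le
      (le_inf hDM (by rintro _ ⟨x, -, rfl⟩; exact hND x))
    rw [Subgroup.relIndex_bot_left, Subgroup.relIndex_bot_left] at h2
    rw [← h1, ← h2, tateIndex, mul_comm]
  have h1 := key hND hDM
  have h2 := key hDN hNM
  have h0 : Nat.card M ≠ 0 := Nat.card_pos.ne'
  refine ⟨fun h ↦ h0 (by rw [← h1, h]; simp), ?_⟩
  have hD : Nat.card (M.map D) ≠ 0 := fun h ↦ h0 (by rw [← h1, h]; simp)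
  have hN : Nat.card (M.map N) ≠ 0 := fun h ↦ h0 (by rw [← h1, h]; simp)
  rw [← h2] at h1
  refine mul_left_cancel₀ (mul_ne_zero hD hN) ?_
  linarith

/-- The same count for the finite quotient `M / M'`, carried out on subgroups of the ambient group.
-/
theorem tateIndexQuot_comm_of_finite {D N : L →* L} (hND : ∀ x, N (D x) = 1)
    (hDN : ∀ x, D (N x) = 1) {M M' : Subgroup L} (hle : M' ≤ M)
    (hDM : M.map D ≤ M) (hNM : M.map N ≤ M) (hDM' : M'.map D ≤ M') (hNM' : M'.map N ≤ M')
    (hfin : M'.relIndex M ≠ 0) :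
    tateIndexQuot D N M M' ≠ 0 ∧ tateIndexQuot D N M M' = tateIndexQuot N D M M' := by
  have key : ∀ {D N : L →* L}, (∀ x, N (D x) = 1) → M.map D ≤ M → M'.map N ≤ M' →
      M'.relIndex (M.map D) * tateIndexQuot D N M M' * M'.relIndex (M.map N) = M'.relIndex M := by
    intro D N hND hDM hNM'
    have h1 : (M ⊓ M'.comap N).relIndex M = M'.relIndex (M.map N) := by
      rw [inf_comm, Subgroup.inf_relIndex_right, Subgroup.relIndex_comap]
    have hle1 : M.map D ⊔ M' ≤ M ⊓ M'.comap N :=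
      sup_le (le_inf hDM (by
        rintro _ ⟨x, -, rfl⟩
        rw [Subgroup.mem_comap, hND x]; exact one_mem _))
        (le_inf hle (Subgroup.map_le_iff_le_comap.1 hNM'))
    rw [← h1, tateIndexQuot, ← Subgroup.relIndex_sup_right (M.map D) M',
      Subgroup.relIndex_mul_relIndex _ _ _ le_sup_right hle1,
      Subgroup.relIndex_mul_relIndex _ _ _ (le_sup_right.trans hle1) inf_le_left]
  have h1 := key hND hDM hNM'
  have h2 := key hDN hNM hDM'
  refine ⟨fun h ↦ hfin (by rw [← h1, h]; simp), ?_⟩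
  have hD : M'.relIndex (M.map D) ≠ 0 := fun h ↦ hfin (by rw [← h1, h]; simp)
  have hN : M'.relIndex (M.map N) ≠ 0 := fun h ↦ hfin (by rw [← h1, h]; simp)
  rw [← h2] at h1
  refine mul_left_cancel₀ (mul_ne_zero hD hN) ?_
  linarith

theorem map_mem_map_comm {φ : L →* I} {D : L →* L} {D' : I →* I} (hD : ∀ x, φ (D x) = D' (φ x))
    (M : Subgroup L) : (M.map D).map φ = (M.map φ).map D' := by
  rw [Subgroup.map_map, Subgroup.map_map]
  congr 1
  ext x
  exact hD x

/-- The isomorphism M / (M ∩ ker φ) ≅ φ(M) is equivariant, hence preserves Tate indices. -/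
theorem tateIndexQuot_inf_ker {φ : L →* I} {D N : L →* L} {D' N' : I →* I}
    (hD : ∀ x, φ (D x) = D' (φ x)) (hN : ∀ x, φ (N x) = N' (φ x)) (hND : ∀ x, N (D x) = 1)
    {M : Subgroup L} (hDM : M.map D ≤ M) (hNM : M.map N ≤ M) :
    tateIndexQuot D N M (M ⊓ φ.ker) = tateIndex D' N' (M.map φ) := by
  have hle : M.map D ⊔ M ⊓ φ.ker ≤ M ⊓ (M ⊓ φ.ker).comap N := by
    refine sup_le (le_inf hDM ?_) (le_inf inf_le_left ?_)
    · rintro _ ⟨x, -, rfl⟩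
      rw [Subgroup.mem_comap, hND x]
      exact one_mem _
    · rintro x ⟨hx, hx'⟩
      refine ⟨hNM ⟨x, hx, rfl⟩, ?_⟩
      change φ (N x) = 1
      rw [hN, show φ x = 1 from hx', map_one]
  rw [tateIndexQuot, ← relIndex_map_mul_relIndex_inf_ker φ hle]
  have e1 : (M.map D ⊔ M ⊓ φ.ker).map φ = (M.map φ).map D' := by
    rw [Subgroup.map_sup, (Subgroup.map_eq_bot_iff (M ⊓ φ.ker) (f := φ)).2 inf_le_right, sup_bot_eq,
      map_mem_map_comm hD]
  have e2 : (M ⊓ (M ⊓ φ.ker).comap N).map φ = M.map φ ⊓ N'.ker := by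
    ext y
    constructor
    · rintro ⟨x, ⟨hx, -, hx'⟩, rfl⟩
      exact ⟨⟨x, hx, rfl⟩, by change N' (φ x) = 1; rw [← hN]; exact hx'⟩
    · rintro ⟨⟨x, hx, rfl⟩, hx'⟩
      exact ⟨x, ⟨hx, hNM ⟨x, hx, rfl⟩, by change φ (N x) = 1; rw [hN]; exact hx'⟩, rfl⟩
  have e3 : (M ⊓ (M ⊓ φ.ker).comap N) ⊓ φ.ker ≤ (M.map D ⊔ M ⊓ φ.ker) ⊓ φ.ker :=
    le_inf ((inf_le_inf_right _ inf_le_left).trans le_sup_right) inf_le_right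
  rw [e1, e2, Subgroup.relIndex_eq_one.2 e3, mul_one, tateIndex]

/-- Invariance of the Herbrand quotient under homomorphisms with finite kernel and cokernel. -/
theorem tateIndex_mul_tateIndex_of_finite {φ : L →* I} {D N : L →* L} {D' N' : I →* I}
    (hD : ∀ x, φ (D x) = D' (φ x)) (hN : ∀ x, φ (N x) = N' (φ x))
    (hND : ∀ x, N (D x) = 1) (hDN : ∀ x, D (N x) = 1)
    (hND' : ∀ x, N' (D' x) = 1) (hDN' : ∀ x, D' (N' x) = 1)
    {M : Subgroup L} (hDM : M.map D ≤ M) (hNM : M.map N ≤ M)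
    (hker : Finite ↥(M ⊓ φ.ker)) (hindex : (M.map φ).index ≠ 0)
    (h1 : tateIndex D' N' ⊤ ≠ 0) (h0 : tateIndex N' D' ⊤ ≠ 0) :
    tateIndex D N M ≠ 0 ∧ tateIndex N D M ≠ 0 ∧
      tateIndex D N M * tateIndex N' D' ⊤ = tateIndex N D M * tateIndex D' N' ⊤ := by
  set P := M.map φ
  have hDP : P.map D' ≤ P := by rw [← map_mem_map_comm hD]; exact Subgroup.map_mono hDM
  have hNP : P.map N' ≤ P := by rw [← map_mem_map_comm hN]; exact Subgroup.map_mono hNM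
  have hfin : P.relIndex ⊤ ≠ 0 := by rwa [Subgroup.relIndex_top_right]
  -- This index is finite because [f(I) : f(P)] is at most [I : P].
  have hmap : ∀ f : I →* I, (P.map f).relIndex (P ⊓ (⊤ : Subgroup I).map f) ≠ 0 := by
    intro f
    refine fun h ↦ ?_
    have := Subgroup.relIndex_eq_zero_of_le_right (inf_le_right (a := P)) h
    rw [Subgroup.relIndex_map_map] at this
    refine hfin (Subgroup.relIndex_eq_zero_of_le_left (le_sup_left (b := f.ker)) ?_)
    simpa using this
  obtain ⟨q1, q2⟩ := tateIndexQuot_comm_of_finite hND' hDN' (le_top (a := P)) le_top le_top hDP hNP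
    hfin
  have k1 := tateIndexQuot_mul_tateIndex hND' (le_top (a := P)) le_top hDP hNP
  have k0 := tateIndexQuot_mul_tateIndex hDN' (le_top (a := P)) le_top hNP hDP
  rw [← q2] at k0
  have hP1 : tateIndex D' N' P ≠ 0 := fun h ↦ by
    rw [h, mul_zero] at k1
    exact mul_ne_zero (mul_ne_zero (hmap N') (hmap D')) h1 k1.symm
  have hP0 : tateIndex N' D' P ≠ 0 := fun h ↦ by
    rw [h, mul_zero] at k0
    exact mul_ne_zero (mul_ne_zero (hmap D') (hmap N')) h0 k0.symm
  set F := M ⊓ φ.ker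
  have hstab : ∀ {f : L →* L} {f' : I →* I}, (∀ x, φ (f x) = f' (φ x)) → M.map f ≤ M →
      F.map f ≤ F := by
    rintro f f' hf hM _ ⟨x, ⟨hx, hx'⟩, rfl⟩
    refine ⟨hM ⟨x, hx, rfl⟩, ?_⟩
    change φ (f x) = 1
    rw [hf, show φ x = 1 from hx', map_one]
  have hDF := hstab hD hDM
  have hNF := hstab hN hNM
  obtain ⟨f1, f2⟩ := tateIndex_comm_of_finite hND hDN hDF hNF
  have l1 := tateIndexQuot_mul_tateIndex hND (inf_le_left (b := φ.ker)) hDM hDF hNF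
  have l0 := tateIndexQuot_mul_tateIndex hDN (inf_le_left (b := φ.ker)) hNM hNF hDF
  rw [tateIndexQuot_inf_ker hD hN hND hDM hNM] at l1
  rw [tateIndexQuot_inf_ker hN hD hDN hNM hDM, ← f2] at l0
  have hl1 := l1 ▸ mul_ne_zero hP1 f1
  have hl0 := l0 ▸ mul_ne_zero hP0 f1
  refine ⟨right_ne_zero_of_mul hl1, right_ne_zero_of_mul hl0, ?_⟩
  have hr := left_ne_zero_of_mul hl1
  rw [mul_comm (Subgroup.relIndex (Subgroup.map N F) _)] at hr l1
  have hs := mul_ne_zero (hmap D') (hmap N')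
  rw [mul_comm (Subgroup.relIndex (Subgroup.map N' P) _)] at k1
  -- The factors cancelled are the common Tate index of the finite cokernel, that of the finite
  -- kernel, and the two symmetric correction terms.
  refine mul_left_cancel₀ (mul_ne_zero (mul_ne_zero q1 f1) (mul_ne_zero hr hs)) ?_
  generalize tateIndexQuot D' N' ⊤ P = Q at *
  generalize tateIndex D N F = TF at *
  generalize tateIndex D' N' P = P1 at *
  generalize tateIndex N' D' P = P0 at *
  generalize tateIndex D' N' ⊤ = T1 at *
  generalize tateIndex N' D' ⊤ = T0 at *
  generalize tateIndex D N M = M1 at *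
  generalize tateIndex N D M = M0 at *
  generalize (Subgroup.map D F).relIndex (M ⊓ φ.ker ⊓ Subgroup.map D M) *
    (Subgroup.map N F).relIndex (M ⊓ φ.ker ⊓ Subgroup.map N M) = r at *
  generalize (Subgroup.map D' P).relIndex (P ⊓ Subgroup.map D' ⊤) *
    (Subgroup.map N' P).relIndex (P ⊓ Subgroup.map N' ⊤) = s at *
  calc Q * TF * (r * s) * (M1 * T0) = Q * TF * (r * M1) * (s * T0) := by ring
    _ = Q * TF * (P1 * TF) * (Q * P0) := by rw [l1, k0]
    _ = Q * TF * (P0 * TF) * (Q * P1) := by ring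
    _ = Q * TF * (r * M0) * (s * T1) := by rw [l0, k1]
    _ = _ := by ring

end GroupIndex

/-! ### The abstract ambiguous class number formula. -/

section AmbiguousIndex

variable {L I : Type*} [CommGroup L] [CommGroup I]

/-- The ambiguous class number formula for `I / φ(Lp)`, in terms of the Herbrand quotient of
`ker φ ⊓ Lp`. -/
theorem ambiguous_relIndex_formula {φ : L →* I} {D N : L →* L} {D' N' : I →* I}
    (hD : ∀ x, φ (D x) = D' (φ x)) (hN : ∀ x, φ (N x) = N' (φ x))
    (hND : ∀ x, N (D x) = 1) (hDN : ∀ x, D (N x) = 1) (hND' : ∀ x, N' (D' x) = 1)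
    (hL : ∀ x, N x = 1 → ∃ y, D y = x) (hI : ∀ x, N' x = 1 → ∃ y, D' y = x)
    {Lp : Subgroup L} (hker : D.ker ≤ Lp) (hrange : ∀ x, D x ∈ Lp) :
    (Lp.map φ).relIndex ((Lp.map φ).comap D') * tateIndex D N (φ.ker ⊓ Lp) *
        (Lp.map N ⊓ φ.ker).relIndex (D.ker ⊓ φ.ker) =
      (D.ker.map φ).relIndex D'.ker * Lp.index * tateIndex N D (φ.ker ⊓ Lp) := by
  set E := φ.ker ⊓ Lp
  set P := Lp.map φ
  have hDLp : Lp.map D ≤ Lp := by rintro _ ⟨x, -, rfl⟩; exact hrange x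
  have hDker : Lp.map D ≤ N.ker := by rintro _ ⟨x, -, rfl⟩; exact hND x
  have hNLp : Lp.map N ≤ D.ker := by rintro _ ⟨x, -, rfl⟩; exact hDN x
  have hφker : ∀ {f : L →* L} {f' : I →* I}, (∀ x, φ (f x) = f' (φ x)) → ∀ x, φ x = 1 →
      φ (f x) = 1 := fun hf x hx ↦ by rw [hf, hx, map_one]
  have hPD : P.map D' = (Lp.map D).map φ := (map_mem_map_comm hD Lp).symm
  have hPZ : P ≤ P.comap D' := by
    rintro _ ⟨x, -, rfl⟩
    exact ⟨D x, hrange x, hD x⟩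
  have s1 := relIndex_map_mul_relIndex_inf_ker D' hPZ
  have e1 : P.comap D' ⊓ D'.ker = D'.ker := inf_eq_right.2 fun x hx ↦ by
    rw [Subgroup.mem_comap, show D' x = 1 from hx]; exact one_mem _
  -- Hilbert 90 for `I` enters here.
  have e2 : (P.comap D').map D' = P ⊓ N'.ker := by
    ext y
    constructor
    · rintro ⟨x, hx, rfl⟩
      exact ⟨hx, hND' x⟩
    · rintro ⟨hy, hy'⟩
      obtain ⟨x, rfl⟩ := hI y hy'
      exact ⟨x, hy, rfl⟩
  rw [e1, e2, hPD] at s1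
  have hkerP : D.ker.map φ ≤ P ⊓ D'.ker := by
    rintro _ ⟨x, hx, rfl⟩
    exact ⟨⟨x, hker hx, rfl⟩, by change D' (φ x) = 1; rw [← hD, show D x = 1 from hx, map_one]⟩
  have s2 := Subgroup.relIndex_mul_relIndex _ _ _ hkerP inf_le_right
  -- Both sides are the index of `ker D · E` in W = {x ∈ Lp : φ(Dx) = 1}, computed once through `φ`
  -- and once through `D`.
  have s3 : (D.ker.map φ).relIndex (P ⊓ D'.ker) = (E.map D).relIndex (Lp.map D ⊓ φ.ker) := by
    set W := Lp ⊓ φ.ker.comap D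
    have hEW : D.ker ⊔ E ≤ W := by
      refine sup_le (le_inf hker fun x hx ↦ ?_) (le_inf inf_le_right fun x hx ↦ hφker hD x hx.1)
      rw [Subgroup.mem_comap, show D x = 1 from hx]
      exact one_mem _
    have a1 := relIndex_map_mul_relIndex_inf_ker φ hEW
    have a2 := relIndex_map_mul_relIndex_inf_ker D hEW
    rw [Subgroup.relIndex_eq_one.2 (le_inf ((le_inf inf_le_right
      (inf_le_left.trans inf_le_left)).trans le_sup_right) inf_le_right), mul_one, Subgroup.map_sup,
      (Subgroup.map_eq_bot_iff E (f := φ)).2 inf_le_left, sup_bot_eq] at a1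
    rw [Subgroup.relIndex_eq_one.2 (le_inf (inf_le_right.trans le_sup_left) inf_le_right), mul_one,
      Subgroup.map_sup, (Subgroup.map_eq_bot_iff D.ker (f := D)).2 le_rfl, bot_sup_eq] at a2
    have b1 : W.map φ = P ⊓ D'.ker := by
      ext y
      constructor
      · rintro ⟨x, ⟨hx, hx'⟩, rfl⟩
        exact ⟨⟨x, hx, rfl⟩, by change D' (φ x) = 1; rw [← hD]; exact hx'⟩
      · rintro ⟨⟨x, hx, rfl⟩, hx'⟩
        exact ⟨x, ⟨hx, by change φ (D x) = 1; rw [hD]; exact hx'⟩, rfl⟩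
    have b2 : W.map D = Lp.map D ⊓ φ.ker := by
      ext y
      constructor
      · rintro ⟨x, ⟨hx, hx'⟩, rfl⟩
        exact ⟨⟨x, hx, rfl⟩, hx'⟩
      · rintro ⟨⟨x, hx, rfl⟩, hx'⟩
        exact ⟨x, ⟨hx, hx'⟩, rfl⟩
    rw [b1] at a1
    rw [b2] at a2
    rw [a1, a2]
  -- The index of `D(Lp) · E` in Y = {x ∈ Lp : φ(Nx) = 1}, computed through `φ` and through `N`.
  -- Hilbert 90 for `L` puts all of `ker N` inside Y.
  have s4 : ((Lp.map D).map φ).relIndex (P ⊓ N'.ker) =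
      (E.map N).relIndex (Lp.map N ⊓ φ.ker) * (Lp.map D ⊔ E ⊓ N.ker).relIndex N.ker := by
    set Y := Lp ⊓ φ.ker.comap N
    have hEY : Lp.map D ⊔ E ≤ Y := by
      refine sup_le (le_inf hDLp fun x hx ↦ ?_) (le_inf inf_le_right fun x hx ↦ hφker hN x hx.1)
      rw [Subgroup.mem_comap, show N x = 1 from hDker hx]
      exact one_mem _
    have a1 := relIndex_map_mul_relIndex_inf_ker φ hEY
    have a2 := relIndex_map_mul_relIndex_inf_ker N hEY
    rw [Subgroup.relIndex_eq_one.2 (le_inf ((le_inf inf_le_right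
      (inf_le_left.trans inf_le_left)).trans le_sup_right) inf_le_right), mul_one, Subgroup.map_sup,
      (Subgroup.map_eq_bot_iff E (f := φ)).2 inf_le_left, sup_bot_eq] at a1
    rw [Subgroup.map_sup, (Subgroup.map_eq_bot_iff (Lp.map D) (f := N)).2 hDker, bot_sup_eq,
      sup_inf_assoc_of_le _ hDker] at a2
    have b1 : Y.map φ = P ⊓ N'.ker := by
      ext y
      constructor
      · rintro ⟨x, ⟨hx, hx'⟩, rfl⟩
        exact ⟨⟨x, hx, rfl⟩, by change N' (φ x) = 1; rw [← hN]; exact hx'⟩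
      · rintro ⟨⟨x, hx, rfl⟩, hx'⟩
        exact ⟨x, ⟨hx, by change φ (N x) = 1; rw [hN]; exact hx'⟩, rfl⟩
    have b2 : Y.map N = Lp.map N ⊓ φ.ker := by
      ext y
      constructor
      · rintro ⟨x, ⟨hx, hx'⟩, rfl⟩
        exact ⟨⟨x, hx, rfl⟩, hx'⟩
      · rintro ⟨⟨x, hx, rfl⟩, hx'⟩
        exact ⟨x, ⟨hx, hx'⟩, rfl⟩
    have b3 : Y ⊓ N.ker = N.ker := inf_eq_right.2 fun x hx ↦ by
      obtain ⟨y, rfl⟩ := hL x hx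
      refine ⟨hrange y, ?_⟩
      change φ (N (D y)) = 1
      rw [hND, map_one]
    rw [b1] at a1
    rw [b2, b3] at a2
    rw [a1, a2]
  -- By Hilbert 90, `D` maps `L` onto `ker N`, and its kernel lies in `Lp`; hence [ker N : D(Lp)] =
  -- [L : Lp].
  have s5 : (Lp.map D ⊔ E ⊓ N.ker).relIndex N.ker * (Lp.map D).relIndex (E ⊓ N.ker) =
      Lp.index := by
    rw [← Subgroup.relIndex_sup_left (E ⊓ N.ker) (Lp.map D), mul_comm,
      Subgroup.relIndex_mul_relIndex _ _ _ le_sup_left (sup_le hDker inf_le_right),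
      ← Subgroup.relIndex_top_right, ← relIndex_map_mul_relIndex_inf_ker D (le_top (a := Lp)),
      top_inf_eq, Subgroup.relIndex_eq_one.2 (le_inf hker le_rfl), mul_one]
    congr 1
    ext x
    constructor
    · intro hx
      obtain ⟨y, rfl⟩ := hL x hx
      exact ⟨y, trivial, rfl⟩
    · rintro ⟨y, -, rfl⟩
      exact hND y
  have s6 : (E.map D).relIndex (Lp.map D ⊓ φ.ker) * (Lp.map D).relIndex (E ⊓ N.ker) =
      tateIndex D N E := by
    have : Lp.map D ⊓ φ.ker = Lp.map D ⊓ (E ⊓ N.ker) := by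
      refine le_antisymm (le_inf inf_le_left (le_inf (le_inf inf_le_right
        (inf_le_left.trans hDLp)) (inf_le_left.trans hDker))) (le_inf inf_le_left
        (inf_le_right.trans (inf_le_left.trans inf_le_left)))
    rw [this, ← Subgroup.inf_relIndex_right (Lp.map D), Subgroup.relIndex_mul_relIndex, tateIndex]
    · refine le_inf (Subgroup.map_mono inf_le_right) (le_inf ?_
        ((Subgroup.map_mono inf_le_right).trans hDker))
      rintro _ ⟨x, hx, rfl⟩
      exact ⟨hφker hD x hx.1, hrange x⟩
    · exact inf_le_right
  have s7 : (E.map N).relIndex (Lp.map N ⊓ φ.ker) *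
      (Lp.map N ⊓ φ.ker).relIndex (D.ker ⊓ φ.ker) = tateIndex N D E := by
    have : E ⊓ D.ker = D.ker ⊓ φ.ker := by
      refine le_antisymm (le_inf inf_le_right (inf_le_left.trans inf_le_left))
        (le_inf (le_inf inf_le_right (inf_le_left.trans hker)) inf_le_left)
    rw [tateIndex, this, Subgroup.relIndex_mul_relIndex]
    · refine le_inf (Subgroup.map_mono inf_le_right) ?_
      rintro _ ⟨x, hx, rfl⟩
      exact hφker hN x hx.1
    · exact inf_le_inf_right _ hNLp
  rw [← s1, ← s2, s3, s4, ← s5, ← s6, ← s7]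
  ring

end AmbiguousIndex

noncomputable section

/-! ### The operators g - 1 and norm for a group action. -/

section Action

variable {G M : Type*} [Group G] [CommGroup M]

/-- The endomorphism `m ↦ g m / m`. -/
def actionDiff (ρ : G →* MulAut M) (g : G) : M →* M := (ρ g).toMonoidHom / MonoidHom.id M

theorem actionDiff_apply (ρ : G →* MulAut M) (g : G) (m : M) :
    actionDiff ρ g m = ρ g m / m := rfl

/-- The cocycle identity στ - 1 = (σ - 1)τ + (τ - 1) makes the set of good σ a subgroup, and it
contains the generator. -/
theorem actionDiff_mem_range {ρ : G →* MulAut M} {g : G} (hg : ∀ σ, σ ∈ Subgroup.zpowers g)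
    (σ : G) (m : M) : ρ σ m / m ∈ (actionDiff ρ g).range := by
  let H : Subgroup G :=
    { carrier := {σ | ∀ m, ρ σ m / m ∈ (actionDiff ρ g).range}
      one_mem' := fun m ↦ by simp
      mul_mem' := fun {σ τ} hσ hτ m ↦ by
        rw [map_mul, MulAut.mul_apply, ← div_mul_div_cancel _ (ρ τ m)]
        exact mul_mem (hσ _) (hτ m)
      inv_mem' := fun {σ} hσ m ↦ by
        have := inv_mem (hσ (ρ σ⁻¹ m))
        rwa [← MulAut.mul_apply, ← map_mul, mul_inv_cancel, map_one, MulAut.one_apply,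
          inv_div] at this }
  have hH : Subgroup.zpowers g ≤ H := (Subgroup.zpowers_le).2 fun m ↦ ⟨m, rfl⟩
  exact hH (hg σ) m

theorem mem_ker_actionDiff {ρ : G →* MulAut M} {g : G} (hg : ∀ σ, σ ∈ Subgroup.zpowers g) {m : M} :
    m ∈ (actionDiff ρ g).ker ↔ ∀ σ, ρ σ m = m := by
  rw [MonoidHom.mem_ker, actionDiff_apply, div_eq_one]
  refine ⟨fun h σ ↦ ?_, fun h ↦ h g⟩
  have : Subgroup.zpowers g ≤ (MulAction.stabilizer (MulAut M) m).comap ρ := by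
    rw [Subgroup.zpowers_le]
    exact h
  exact this (hg σ)

variable [Fintype G]

/-- The norm endomorphism `m ↦ ∏ σ, σ m`. -/
def actionNorm (ρ : G →* MulAut M) : M →* M := ∏ σ, (ρ σ).toMonoidHom

theorem actionNorm_apply (ρ : G →* MulAut M) (m : M) : actionNorm ρ m = ∏ σ, ρ σ m := by
  simp [actionNorm, MonoidHom.finsetProd_apply]

theorem actionNorm_apply_action (ρ : G →* MulAut M) (τ : G) (m : M) :
    actionNorm ρ (ρ τ m) = actionNorm ρ m := by
  rw [actionNorm_apply, actionNorm_apply]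
  exact Fintype.prod_equiv (Equiv.mulRight τ) _ _ fun σ ↦ by simp

theorem action_actionNorm (ρ : G →* MulAut M) (τ : G) (m : M) :
    ρ τ (actionNorm ρ m) = actionNorm ρ m := by
  rw [actionNorm_apply, map_prod]
  exact Fintype.prod_equiv (Equiv.mulLeft τ) _ _ fun σ ↦ by simp

theorem actionNorm_actionDiff (ρ : G →* MulAut M) (g : G) (m : M) :
    actionNorm ρ (actionDiff ρ g m) = 1 := by
  rw [actionDiff_apply, map_div, actionNorm_apply_action, div_self']

theorem actionDiff_actionNorm (ρ : G →* MulAut M) (g : G) (m : M) :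
    actionDiff ρ g (actionNorm ρ m) = 1 := by
  rw [actionDiff_apply, action_actionNorm, div_self']

theorem actionNorm_of_forall_eq {ρ : G →* MulAut M} {m : M} (h : ∀ σ, ρ σ m = m) :
    actionNorm ρ m = m ^ Nat.card G := by
  simp [actionNorm_apply, h]

end Action

/-! ### Fractional ideals as a permutation module on the primes. -/

section Ideals

open IsDedekindDomain Pointwise

variable {R K : Type*} [CommRing R] [IsDedekindDomain R] [Field K] [Algebra R K]
  [IsFractionRing R K]

/-- A non-zero prime ideal as an element of the group of fractional ideals. -/
def primeUnit (K : Type*) [Field K] [Algebra R K] [IsFractionRing R K] (v : HeightOneSpectrum R) :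
    (FractionalIdeal R⁰ K)ˣ :=
  Units.mk0 (v.asIdeal : FractionalIdeal R⁰ K) (FractionalIdeal.coeIdeal_ne_zero.2 v.ne_bot)

/-- The order of a fractional ideal at a prime. -/
def ordHom (K : Type*) [Field K] [Algebra R K] [IsFractionRing R K] (v : HeightOneSpectrum R) :
    (FractionalIdeal R⁰ K)ˣ →* Multiplicative ℤ where
  toFun I := Multiplicative.ofAdd (FractionalIdeal.count K v (I : FractionalIdeal R⁰ K))
  map_one' := by rw [Units.val_one, FractionalIdeal.count_one]; rfl
  map_mul' I J := by
    rw [Units.val_mul, FractionalIdeal.count_mul K v I.ne_zero J.ne_zero]; rfl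

/-- The order of a fractional ideal at a prime, as an integer. -/
def ordAt (v : HeightOneSpectrum R) (I : (FractionalIdeal R⁰ K)ˣ) : ℤ :=
  (ordHom K v I).toAdd

theorem ordAt_eq_count (v : HeightOneSpectrum R) (I : (FractionalIdeal R⁰ K)ˣ) :
    ordAt v I = FractionalIdeal.count K v (I : FractionalIdeal R⁰ K) := rfl

@[simp]
theorem ordAt_one (v : HeightOneSpectrum R) : ordAt v (1 : (FractionalIdeal R⁰ K)ˣ) = 0 := by
  simp [ordAt]

@[simp]
theorem ordAt_mul (v : HeightOneSpectrum R) (I J : (FractionalIdeal R⁰ K)ˣ) :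
    ordAt v (I * J) = ordAt v I + ordAt v J := by
  simp [ordAt]

@[simp]
theorem ordAt_inv (v : HeightOneSpectrum R) (I : (FractionalIdeal R⁰ K)ˣ) :
    ordAt v I⁻¹ = -ordAt v I := by
  simp [ordAt]

@[simp]
theorem ordAt_zpow (v : HeightOneSpectrum R) (I : (FractionalIdeal R⁰ K)ˣ) (m : ℤ) :
    ordAt v (I ^ m) = m * ordAt v I := by
  simp [ordAt]

theorem ordAt_prod {ι : Type*} (v : HeightOneSpectrum R) (s : Finset ι)
    (f : ι → (FractionalIdeal R⁰ K)ˣ) : ordAt v (∏ i ∈ s, f i) = ∑ i ∈ s, ordAt v (f i) := by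
  simp [ordAt, map_prod]

theorem ordAt_primeUnit [DecidableEq (HeightOneSpectrum R)] (v w : HeightOneSpectrum R) :
    ordAt v (primeUnit K w) = if w = v then 1 else 0 :=
  FractionalIdeal.count_maximal K v w

/-- The exponents in the factorization of a fractional ideal. -/
def ordFinsupp (I : (FractionalIdeal R⁰ K)ˣ) : HeightOneSpectrum R →₀ ℤ :=
  Finsupp.ofSupportFinite (fun v ↦ ordAt v I)
    (FractionalIdeal.finite_factors (I : FractionalIdeal R⁰ K))

theorem ordFinsupp_apply (I : (FractionalIdeal R⁰ K)ˣ) (v : HeightOneSpectrum R) :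
    ordFinsupp I v = ordAt v I := rfl

theorem prod_primeUnit_eq (I : (FractionalIdeal R⁰ K)ˣ) :
    (ordFinsupp I).prod (fun v m ↦ primeUnit K v ^ m) = I := by
  ext1
  rw [Finsupp.prod, Units.coe_prod]
  conv_rhs => rw [← FractionalIdeal.finprod_heightOneSpectrum_factorization' K I.ne_zero]
  rw [finprod_eq_finsetProd_of_mulSupport_subset]
  · refine Finset.prod_congr rfl fun v _ ↦ ?_
    simp [primeUnit, ordFinsupp_apply, ordAt_eq_count]
  · intro v hv
    rw [Finset.mem_coe, Finsupp.mem_support_iff]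
    intro h
    refine hv ?_
    have : FractionalIdeal.count K v (I : FractionalIdeal R⁰ K) = 0 := h
    simp [this]

theorem fracIdeal_eq_of_ordAt_eq {I J : (FractionalIdeal R⁰ K)ˣ} (h : ∀ v, ordAt v I = ordAt v J) :
    I = J := by
  rw [← prod_primeUnit_eq I, ← prod_primeUnit_eq J]
  congr 1
  ext v
  exact h v

theorem fracIdeal_hom_ext {H : Type*} [CommGroup H] {f f' : (FractionalIdeal R⁰ K)ˣ →* H}
    (h : ∀ v, f (primeUnit K v) = f' (primeUnit K v)) : f = f' := by
  ext I
  rw [← prod_primeUnit_eq I, Finsupp.prod, map_prod, map_prod]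
  simp [h]

theorem ordAt_finsupp_prod (e : HeightOneSpectrum R →₀ ℤ) (v : HeightOneSpectrum R) :
    ordAt v (e.prod fun w m ↦ primeUnit K w ^ m) = e v := by
  classical
  rw [Finsupp.prod, ordAt_prod]
  simp only [ordAt_zpow, ordAt_primeUnit, mul_ite, mul_one, mul_zero, Finset.sum_ite_eq',
    e.mem_support_iff, ne_eq, ite_not, ite_eq_right_iff]
  exact fun h ↦ h.symm

open scoped WithZero in
-- This bridge allows the behaviour of valuations under extension of primes to be read as a
-- statement about orders of ideals.
theorem valuation_eq_exp_neg_ordAt (v : HeightOneSpectrum R) (x : Kˣ) :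
    v.valuation K (x : K) = WithZero.exp (-ordAt v (toPrincipalIdeal R K x)) := by
  have key : ∀ a : R, a ≠ 0 → v.valuation K (algebraMap R K a) =
      WithZero.exp (-FractionalIdeal.count K v (FractionalIdeal.spanSingleton R⁰
        (algebraMap R K a))) := by
    intro a ha
    classical
    rw [HeightOneSpectrum.valuation_of_algebraMap, HeightOneSpectrum.intValuation_if_neg v ha,
      ← FractionalIdeal.coeIdeal_span_singleton, FractionalIdeal.count_coe]
    simpa using ha
  obtain ⟨a, b, hb, hx⟩ := IsFractionRing.div_surjective R (x : K)
  have hb0 : b ≠ 0 := nonZeroDivisors.ne_zero hb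
  have hbK : algebraMap R K b ≠ 0 := by simpa using hb0
  have ha0 : a ≠ 0 := by
    rintro rfl
    exact x.ne_zero (by rw [← hx]; simp)
  have haK : algebraMap R K a ≠ 0 := by simpa using ha0
  have hx' : x = Units.mk0 _ haK * (Units.mk0 _ hbK)⁻¹ := by
    ext
    simp [← hx, div_eq_mul_inv]
  rw [hx', map_mul, map_inv, ordAt_mul, ordAt_inv]
  simp only [Units.val_mul, Units.val_inv_eq_inv_val, Units.val_mk0, map_mul, map_inv₀, key a ha0,
    key b hb0, ordAt_eq_count, coe_toPrincipalIdeal]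
  rw [← WithZero.exp_neg, ← WithZero.exp_add]
  congr 1
  ring

theorem toPrincipalIdeal_eq_one_iff (x : Kˣ) :
    toPrincipalIdeal R K x = 1 ↔ ∃ u : Rˣ, algebraMap R K u = x := by
  have key : ∀ y : Kˣ, toPrincipalIdeal R K y = 1 → ∃ a : R, algebraMap R K a = y := by
    intro y hy
    rw [toPrincipalIdeal_eq_iff, Units.val_one] at hy
    rw [← FractionalIdeal.mem_one_iff R⁰, ← hy]
    exact FractionalIdeal.mem_spanSingleton_self _ _
  constructor
  · intro h
    obtain ⟨a, ha⟩ := key x h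
    obtain ⟨b, hb⟩ := key x⁻¹ (by rw [map_inv, h, inv_one])
    have hab : a * b = 1 := IsFractionRing.injective R K (by rw [map_mul, ha, hb, map_one]; simp)
    exact ⟨Units.mkOfMulEqOne a b hab, ha⟩
  · rintro ⟨u, hu⟩
    rw [toPrincipalIdeal_eq_iff, Units.val_one]
    refine le_antisymm ?_ ?_
    · rw [FractionalIdeal.spanSingleton_le_iff_mem, FractionalIdeal.mem_one_iff]
      exact ⟨u, hu⟩
    · rw [← FractionalIdeal.spanSingleton_one, FractionalIdeal.spanSingleton_le_iff_mem,
        FractionalIdeal.mem_spanSingleton]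
      refine ⟨(u⁻¹ : Rˣ), ?_⟩
      rw [← hu, Algebra.smul_def, ← map_mul, Units.inv_mul, map_one]

variable {G : Type*} [Group G] [MulSemiringAction G R] [MulSemiringAction G K]
  [SMulDistribClass G R K]

variable (G R) in
/-- The action of `G` on non-zero prime ideals. -/
instance primeAction : MulAction G (HeightOneSpectrum R) where
  smul σ v := ⟨σ • v.asIdeal, inferInstance, by
    intro h
    exact v.ne_bot (by simpa using congrArg (σ⁻¹ • ·) h)⟩
  one_smul v := HeightOneSpectrum.ext (one_smul G v.asIdeal)
  mul_smul σ τ v := HeightOneSpectrum.ext (mul_smul σ τ v.asIdeal)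

theorem asIdeal_smul (σ : G) (v : HeightOneSpectrum R) : (σ • v).asIdeal = σ • v.asIdeal := rfl

theorem ringEquivOfRingEquiv_toRingEquiv (σ : G) (x : K) :
    IsFractionRing.ringEquivOfRingEquiv (K := K) (L := K)
      (MulSemiringAction.toRingEquiv G R σ) x = σ • x := by
  obtain ⟨a, b, -, rfl⟩ := IsFractionRing.div_surjective R x
  rw [map_div₀, IsFractionRing.ringEquivOfRingEquiv_algebraMap,
    IsFractionRing.ringEquivOfRingEquiv_algebraMap, div_eq_mul_inv, div_eq_mul_inv, smul_mul',
    smul_inv'', ← algebraMap.smul', ← algebraMap.smul']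
  rfl

variable (G R K) in
/-- The action of `G` on the group of fractional ideals. -/
def idealAction : G →* MulAut (FractionalIdeal R⁰ K)ˣ where
  toFun σ := Units.mapEquiv (FractionalIdeal.ringEquivOfRingEquiv K K
    (MulSemiringAction.toRingEquiv G R σ)).toMulEquiv
  map_one' := by
    ext I x
    change (∃ y ∈ (I : FractionalIdeal R⁰ K), IsFractionRing.ringEquivOfRingEquiv
      (K := K) (L := K) (MulSemiringAction.toRingEquiv G R 1) y = x) ↔ _
    simp only [ringEquivOfRingEquiv_toRingEquiv, one_smul, exists_eq_right]
    rfl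
  map_mul' σ τ := by
    ext I x
    change (∃ y ∈ (I : FractionalIdeal R⁰ K), IsFractionRing.ringEquivOfRingEquiv
      (K := K) (L := K) (MulSemiringAction.toRingEquiv G R (σ * τ)) y = x) ↔
      ∃ z, (∃ y ∈ (I : FractionalIdeal R⁰ K), IsFractionRing.ringEquivOfRingEquiv
      (K := K) (L := K) (MulSemiringAction.toRingEquiv G R τ) y = z) ∧
      IsFractionRing.ringEquivOfRingEquiv
      (K := K) (L := K) (MulSemiringAction.toRingEquiv G R σ) z = x
    simp only [ringEquivOfRingEquiv_toRingEquiv, mul_smul]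
    constructor
    · rintro ⟨y, hy, rfl⟩
      exact ⟨_, ⟨y, hy, rfl⟩, rfl⟩
    · rintro ⟨_, ⟨y, hy, rfl⟩, rfl⟩
      exact ⟨y, hy, rfl⟩

theorem mem_idealAction_iff (σ : G) (I : (FractionalIdeal R⁰ K)ˣ) (x : K) :
    x ∈ (idealAction R K G σ I : FractionalIdeal R⁰ K) ↔
      ∃ y ∈ (I : FractionalIdeal R⁰ K), σ • y = x := by
  have key : x ∈ (idealAction R K G σ I : FractionalIdeal R⁰ K) ↔
      ∃ y ∈ (I : FractionalIdeal R⁰ K), IsFractionRing.ringEquivOfRingEquiv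
      (K := K) (L := K) (MulSemiringAction.toRingEquiv G R σ) y = x := Iff.rfl
  simpa only [ringEquivOfRingEquiv_toRingEquiv] using key

theorem idealAction_primeUnit (σ : G) (v : HeightOneSpectrum R) :
    idealAction R K G σ (primeUnit K v) = primeUnit K (σ • v) := by
  ext x
  rw [mem_idealAction_iff]
  simp only [primeUnit, Units.val_mk0, FractionalIdeal.mem_coeIdeal, asIdeal_smul]
  constructor
  · rintro ⟨_, ⟨a, ha, rfl⟩, rfl⟩
    exact ⟨σ • a, Ideal.smul_mem_pointwise_smul _ _ _ ha, algebraMap.smul' _ _ _⟩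
  · rintro ⟨a, ha, rfl⟩
    refine ⟨_, ⟨σ⁻¹ • a, Ideal.mem_pointwise_smul_iff_inv_smul_mem.1 ha, rfl⟩, ?_⟩
    rw [algebraMap.smul', smul_inv_smul]

theorem ordAt_idealAction (σ : G) (v : HeightOneSpectrum R) (I : (FractionalIdeal R⁰ K)ˣ) :
    ordAt v (idealAction R K G σ I) = ordAt (σ⁻¹ • v) I := by
  classical
  have : (ordHom K v).comp (idealAction R K G σ).toMonoidHom = ordHom K (σ⁻¹ • v) := by
    refine fracIdeal_hom_ext fun w ↦ Multiplicative.toAdd.injective ?_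
    change ordAt v (idealAction R K G σ (primeUnit K w)) = ordAt (σ⁻¹ • v) (primeUnit K w)
    simp only [idealAction_primeUnit, ordAt_primeUnit, eq_inv_smul_iff]
  exact congrArg Multiplicative.toAdd (DFunLike.congr_fun this I)

theorem ordAt_actionNorm [Fintype G] (v : HeightOneSpectrum R) (I : (FractionalIdeal R⁰ K)ˣ) :
    ordAt v (actionNorm (idealAction R K G) I) = ∑ σ : G, ordAt (σ • v) I := by
  rw [actionNorm_apply, ordAt_prod]
  exact Fintype.sum_equiv (Equiv.inv G) _ _ fun σ ↦ ordAt_idealAction σ v I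

/-- The first cohomology of a finite cyclic group with values in the ideal group vanishes. -/
theorem exists_actionDiff_eq_of_actionNorm_eq_one [Fintype G] {g : G}
    (hg : ∀ σ, σ ∈ Subgroup.zpowers g) {I : (FractionalIdeal R⁰ K)ˣ}
    (hI : actionNorm (idealAction R K G) I = 1) :
    ∃ J, actionDiff (idealAction R K G) g J = I := by
  classical
  set ρ := idealAction R K G
  -- `r` selects one prime in each orbit. Moving every exponent of `I` onto the chosen prime changes
  -- `I` only by elements of the form σJ/J, so the result `I₀` still has norm 1.
  let r : HeightOneSpectrum R → HeightOneSpectrum R := fun v ↦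
    (Quotient.mk (MulAction.orbitRel G (HeightOneSpectrum R)) v).out
  have hr : ∀ v, ∃ σ : G, σ • r v = v := fun v ↦
    MulAction.orbitRel_apply.1 ((MulAction.orbitRel G _).symm
      (Quotient.mk_out (s := MulAction.orbitRel G _) v))
  have hrσ : ∀ (σ : G) v, r (σ • v) = r v := fun σ v ↦
    congrArg Quotient.out (Quotient.sound (MulAction.orbitRel_apply.2 ⟨σ, rfl⟩))
  have hrr : ∀ v, r (r v) = r v := fun v ↦ by
    obtain ⟨σ, hσ⟩ := hr v
    conv_rhs => rw [← hσ, hrσ]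
  choose j hj using hr
  let I₀ := ∏ v ∈ (ordFinsupp I).support, primeUnit K (r v) ^ ordAt v I
  have hII₀ : I / I₀ ∈ (actionDiff ρ g).range := by
    have h : I / I₀ = ∏ v ∈ (ordFinsupp I).support,
        (primeUnit K v ^ ordAt v I / primeUnit K (r v) ^ ordAt v I) := by
      rw [Finset.prod_div_distrib]
      exact congrArg (· / I₀) (prod_primeUnit_eq I).symm
    rw [h]
    refine Subgroup.prod_mem _ fun v _ ↦ ?_
    rw [← div_zpow]
    refine Subgroup.zpow_mem _ ?_ _
    have := actionDiff_mem_range (ρ := ρ) hg (j v) (primeUnit K (r v))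
    rwa [idealAction_primeUnit, hj] at this
  have hNI₀ : actionNorm ρ I₀ = 1 := by
    obtain ⟨J, hJ⟩ := hII₀
    have h := actionNorm_actionDiff ρ g J
    rwa [hJ, map_div, show actionNorm ρ I = 1 from hI, one_div, inv_eq_one] at h
  have hsupp : ∀ v, r v ≠ v → ordAt v I₀ = 0 := by
    intro v hv
    simp only [I₀, ordAt_prod, ordAt_zpow, ordAt_primeUnit]
    refine Finset.sum_eq_zero fun w _ ↦ ?_
    rw [if_neg, mul_zero]
    rintro rfl
    exact hv (hrr w)
  -- At a chosen prime the order of the norm of `I₀` is the order of `I₀` times the size of the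
  -- stabilizer, so norm 1 forces order 0.
  have hI₀ : I₀ = 1 := by
    refine fracIdeal_eq_of_ordAt_eq fun v ↦ ?_
    rw [ordAt_one]
    by_cases hv : r v = v
    · have h1 := ordAt_actionNorm (G := G) v I₀
      rw [show actionNorm (idealAction R K G) I₀ = 1 from hNI₀, ordAt_one] at h1
      have h2 : ∀ σ : G, ordAt (σ • v) I₀ = if σ • v = v then ordAt v I₀ else 0 := by
        intro σ
        split_ifs with h
        · rw [h]
        · refine hsupp _ fun h' ↦ h ?_
          rw [← h', hrσ, hv]
      simp only [h2] at h1
      rw [← Finset.sum_filter, Finset.sum_const, eq_comm, smul_eq_zero] at h1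
      refine h1.resolve_left fun h ↦ ?_
      rw [Finset.card_eq_zero] at h
      exact Finset.notMem_empty (1 : G) (h ▸ by simp)
    · exact hsupp v hv
  rw [hI₀, div_one] at hII₀
  exact hII₀

variable (G K) in
/-- The action of `G` on the multiplicative group of `K`. -/
def unitsAction : G →* MulAut Kˣ where
  toFun σ := Units.mapEquiv (MulSemiringAction.toRingEquiv G K σ).toMulEquiv
  map_one' := by ext; simp
  map_mul' σ τ := by ext; simp

@[simp]
theorem val_unitsAction (σ : G) (x : Kˣ) : (unitsAction K G σ x : K) = σ • (x : K) := rfl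

theorem toPrincipalIdeal_unitsAction (σ : G) (x : Kˣ) :
    toPrincipalIdeal R K (unitsAction K G σ x) =
      idealAction R K G σ (toPrincipalIdeal R K x) := by
  ext z
  rw [mem_idealAction_iff, coe_toPrincipalIdeal, coe_toPrincipalIdeal]
  simp only [FractionalIdeal.mem_spanSingleton, Algebra.smul_def]
  constructor
  · rintro ⟨a, rfl⟩
    refine ⟨_, ⟨σ⁻¹ • a, rfl⟩, ?_⟩
    rw [smul_mul', algebraMap.smul', smul_inv_smul, val_unitsAction]
  · rintro ⟨_, ⟨a, rfl⟩, rfl⟩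
    exact ⟨σ • a, by rw [smul_mul', algebraMap.smul', val_unitsAction]⟩

theorem toPrincipalIdeal_actionDiff (g : G) (x : Kˣ) :
    toPrincipalIdeal R K (actionDiff (unitsAction K G) g x) =
      actionDiff (idealAction R K G) g (toPrincipalIdeal R K x) := by
  rw [actionDiff_apply, actionDiff_apply, map_div, toPrincipalIdeal_unitsAction]

theorem toPrincipalIdeal_actionNorm [Fintype G] (x : Kˣ) :
    toPrincipalIdeal R K (actionNorm (unitsAction K G) x) =
      actionNorm (idealAction R K G) (toPrincipalIdeal R K x) := by
  simp only [actionNorm_apply, map_prod, toPrincipalIdeal_unitsAction]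

end Ideals

/-! ### Orders in a Galois extension and the index of ambiguous ideals. -/

section Extension

open IsDedekindDomain Pointwise

theorem exists_toPrincipalIdeal_eq {R K : Type*} [CommRing R] [IsDomain R]
    [IsPrincipalIdealRing R] [Field K] [Algebra R K] [IsFractionRing R K]
    (I : (FractionalIdeal R⁰ K)ˣ) : ∃ x, toPrincipalIdeal R K x = I := by
  have h := FractionalIdeal.isPrincipal (K := K) (I : FractionalIdeal R⁰ K)
  obtain ⟨x, hx⟩ := (FractionalIdeal.isPrincipal_iff (I : FractionalIdeal R⁰ K)).1 h
  exact mem_principal_ideals_iff.2 ⟨x, hx.symm⟩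

variable {A k R K G : Type*} [CommRing A] [IsDedekindDomain A] [Field k] [Algebra A k]
  [IsFractionRing A k] [CommRing R] [IsDedekindDomain R] [Field K] [Algebra R K]
  [IsFractionRing R K] [Algebra A R] [Algebra A K] [Algebra k K] [IsScalarTower A k K]
  [IsScalarTower A R K] [Module.Finite A R] [Module.IsTorsionFree A R] [Group G] [Finite G]
  [MulSemiringAction G R] [IsGaloisGroup G A R]

/-- The embedding of the multiplicative group of the base field. -/
abbrev baseUnits (k K : Type*) [Field k] [Field K] [Algebra k K] : kˣ →* Kˣ :=
  Units.map (algebraMap k K).toMonoidHom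

variable (R) in
/-- The common ramification index of the primes above `v`. -/
def ramIn (v : HeightOneSpectrum A) : ℕ := v.asIdeal.ramificationIdxIn R

variable (G) in
include G in
theorem ramIn_ne_zero (v : HeightOneSpectrum A) : ramIn R v ≠ 0 := by
  have : FaithfulSMul A R := (faithfulSMul_iff_algebraMap_injective A R).2
    (FaithfulSMul.algebraMap_injective A R)
  exact Ideal.ramificationIdxIn_ne_zero G

variable (G) in
include G in
theorem ordAt_baseUnits (w : HeightOneSpectrum R) (x : kˣ) :
    ordAt w (toPrincipalIdeal R K (baseUnits k K x)) =
      ramIn R (w.under A) * ordAt (w.under A) (toPrincipalIdeal A k x) := by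
  have : w.asIdeal.LiesOver (w.under A).asIdeal := ⟨rfl⟩
  have h := HeightOneSpectrum.valuation_liesOver K (w.under A) w (x : k)
  have h1 := valuation_eq_exp_neg_ordAt (w.under A) x
  have h2 := valuation_eq_exp_neg_ordAt w (baseUnits k K x)
  rw [h1, show algebraMap k K (x : k) = (baseUnits k K x : K) from rfl, h2,
    Ideal.ramificationIdx'_eq_ramificationIdx _ _ (w.under A).ne_bot,
    ← Ideal.ramificationIdxIn_eq_ramificationIdx (w.under A).asIdeal w.asIdeal G,
    ← WithZero.exp_nsmul, WithZero.exp_inj] at h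
  rw [ramIn]
  simp only [nsmul_eq_mul] at h
  linarith

variable (G) in
include G in
theorem exists_smul_eq_of_under_eq {w w' : HeightOneSpectrum R} (h : w.under A = w'.under A) :
    ∃ σ : G, σ • w = w' := by
  have h1 : w.asIdeal.LiesOver (w.under A).asIdeal := ⟨rfl⟩
  have h2 : w'.asIdeal.LiesOver (w.under A).asIdeal := by rw [h]; exact ⟨rfl⟩
  obtain ⟨σ, hσ⟩ := Ideal.exists_smul_eq_of_isGaloisGroup (w.under A).asIdeal w.asIdeal w'.asIdeal G
  exact ⟨σ, HeightOneSpectrum.ext hσ⟩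

theorem under_smul (σ : G) (w : HeightOneSpectrum R) : (σ • w).under A = w.under A := by
  ext x
  simp only [HeightOneSpectrum.under_asIdeal, Ideal.mem_comap, asIdeal_smul, Ideal.under_def]
  rw [Ideal.mem_pointwise_smul_iff_inv_smul_mem, smul_algebraMap]

variable (R) in
theorem exists_under_eq (v : HeightOneSpectrum A) : ∃ w : HeightOneSpectrum R, w.under A = v := by
  obtain ⟨P, hP, hP'⟩ := Ideal.exists_maximal_ideal_liesOver_of_isIntegral (S := R) v.asIdeal
  refine ⟨⟨P, hP.isPrime, ?_⟩, HeightOneSpectrum.ext hP'.over.symm⟩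
  rintro rfl
  exact v.ne_bot (by rw [hP'.over, Ideal.under_bot])

variable [MulSemiringAction G K] [SMulDistribClass G R K]

theorem ordAt_eq_of_forall_idealAction_eq {I : (FractionalIdeal R⁰ K)ˣ}
    (hI : ∀ σ : G, idealAction R K G σ I = I) {w w' : HeightOneSpectrum R}
    (h : w.under A = w'.under A) : ordAt w I = ordAt w' I := by
  obtain ⟨σ, rfl⟩ := exists_smul_eq_of_under_eq G h
  conv_rhs => rw [← hI σ, ordAt_idealAction, inv_smul_smul]

/-- The index of the ideals of the base in the group of ambiguous ideals is the product of the
ramification indices. -/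
theorem relIndex_map_toPrincipalIdeal_baseUnits [IsPrincipalIdealRing A] {F : Subgroup
    (FractionalIdeal R⁰ K)ˣ} (hF : ∀ I, I ∈ F ↔ ∀ σ : G, idealAction R K G σ I = I)
    (S : Finset (HeightOneSpectrum A)) (hS : ∀ v, v ∉ S → ramIn R v = 1) :
    ((baseUnits k K).range.map (toPrincipalIdeal R K)).relIndex F = ∏ v ∈ S, ramIn R v := by
  classical
  choose w hw using exists_under_eq (A := A) R
  -- `Ψ` records, for each v in S, the exponent at one prime above v modulo the ramification index.
  -- One prime suffices, since an invariant ideal has equal exponents above v.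
  let Ψ : (FractionalIdeal R⁰ K)ˣ →* ((v : S) → Multiplicative (ZMod (ramIn R v.1))) :=
    MonoidHom.pi fun v ↦ (AddMonoidHom.toMultiplicative
      (Int.castAddHom (ZMod (ramIn R v.1)))).comp (ordHom K (w v.1))
  have hΨ : ∀ I, Ψ I = 1 ↔ ∀ v ∈ S, (ramIn R v : ℤ) ∣ ordAt (w v) I := by
    intro I
    rw [funext_iff]
    simp only [Subtype.forall]
    refine forall₂_congr fun v hv ↦ ?_
    rw [← ZMod.intCast_zmod_eq_zero_iff_dvd]
    rfl
  have hdvd : ∀ I, Ψ I = 1 → ∀ v, (ramIn R v : ℤ) ∣ ordAt (w v) I := by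
    intro I hI v
    by_cases hv : v ∈ S
    · exact (hΨ I).1 hI v hv
    · rw [hS v hv, Nat.cast_one]
      exact one_dvd _
  -- An invariant ideal whose exponents are divisible by the ramification indices comes from an
  -- ideal of `A`, and that ideal is principal.
  have e1 : (baseUnits k K).range.map (toPrincipalIdeal R K) = Ψ.ker ⊓ F := by
    ext I
    constructor
    · rintro ⟨_, ⟨x, rfl⟩, rfl⟩
      refine ⟨(hΨ _).2 fun v _ ↦ ?_, (hF _).2 fun σ ↦ fracIdeal_eq_of_ordAt_eq fun v ↦ ?_⟩
      · rw [ordAt_baseUnits (A := A) G, hw]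
        exact dvd_mul_right _ _
      · rw [ordAt_idealAction, ordAt_baseUnits (A := A) G, ordAt_baseUnits (A := A) G, under_smul]
    · rintro ⟨hI1, hI2⟩
      have hI2' := (hF I).1 hI2
      have hinj : Function.Injective w := fun a b h ↦ by rw [← hw a, h, hw]
      let e : HeightOneSpectrum A →₀ ℤ := Finsupp.ofSupportFinite
        (fun v ↦ ordAt (w v) I / ramIn R v) (by
          refine Set.Finite.subset (Set.Finite.preimage hinj.injOn
            (ordFinsupp I).support.finite_toSet) fun v hv ↦ ?_
          rw [Set.mem_preimage, Finset.mem_coe, Finsupp.mem_support_iff, ordFinsupp_apply]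
          intro h
          exact hv (by simp [h]))
      obtain ⟨x, hx⟩ := exists_toPrincipalIdeal_eq (R := A) (K := k)
        (e.prod fun v m ↦ primeUnit k v ^ m)
      refine ⟨_, ⟨x, rfl⟩, fracIdeal_eq_of_ordAt_eq fun v ↦ ?_⟩
      rw [ordAt_baseUnits (A := A) G, hx, ordAt_finsupp_prod]
      change _ * (ordAt (w (v.under A)) I / _) = _
      rw [Int.mul_ediv_cancel' (hdvd I hI1 _)]
      exact ordAt_eq_of_forall_idealAction_eq (A := A) (G := G) hI2' (hw _)
  rw [e1, Subgroup.inf_relIndex_right, Subgroup.relIndex_ker]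
  -- Any prescribed residues are realized by an ideal whose exponents depend only on the prime
  -- below.
  have e2 : F.map Ψ = ⊤ := by
    rw [eq_top_iff]
    intro y _
    have : Fintype G := Fintype.ofFinite G
    choose a ha using fun v : S ↦ ZMod.intCast_surjective (y v).toAdd
    let b : HeightOneSpectrum A → ℤ := fun v ↦ if h : v ∈ S then a ⟨v, h⟩ else 0
    let c : HeightOneSpectrum R →₀ ℤ := Finsupp.ofSupportFinite (fun v ↦ b (v.under A)) (by
      have hfin : (⋃ v ∈ S, Set.range fun σ : G ↦ σ • w v).Finite :=
        S.finite_toSet.biUnion fun v _ ↦ Set.finite_range _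
      refine hfin.subset fun v hv ↦ ?_
      have hvS : v.under A ∈ S := by
        by_contra h
        exact hv (by simp [b, h])
      obtain ⟨σ, hσ⟩ := exists_smul_eq_of_under_eq (A := A) G (hw (v.under A))
      simp only [Set.mem_iUnion, Set.mem_range]
      exact ⟨_, hvS, σ, hσ⟩)
    refine ⟨c.prod fun v m ↦ primeUnit K v ^ m, (hF _).2 fun σ ↦
      fracIdeal_eq_of_ordAt_eq fun v ↦ ?_, ?_⟩
    · rw [ordAt_idealAction, ordAt_finsupp_prod, ordAt_finsupp_prod]
      exact congrArg b (under_smul _ _)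
    · funext v
      have h1 : ordAt (w v.1) (c.prod fun v m ↦ primeUnit K v ^ m) = a v := by
        rw [ordAt_finsupp_prod]
        change b ((w v.1).under A) = a v
        rw [hw]
        simp [b]
      change Multiplicative.ofAdd ((ordAt (w v.1) (c.prod fun v m ↦ primeUnit K v ^ m) : ℤ) :
        ZMod (ramIn R v.1)) = y v
      rw [h1, ha]
      rfl
  rw [e2, Subgroup.card_top, Nat.card_pi]
  simp only [Nat.card_congr Multiplicative.toAdd, Nat.card_zmod]
  exact Finset.prod_coe_sort S fun v ↦ ramIn R v

end Extension

theorem prod_comp_eq_pow_card_ker {D H M : Type*} [Group D] [Fintype D] [Group H] [Fintype H]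
    [CommMonoid M] (h : D →* H) (hh : Function.Surjective h) (F : H → M) :
    ∏ d, F (h d) = (∏ δ, F δ) ^ Nat.card h.ker := by
  classical
  rw [← Finset.prod_fiberwise (s := Finset.univ) (g := h) (f := fun d ↦ F (h d)),
    ← Finset.prod_pow]
  refine Finset.prod_congr rfl fun δ _ ↦ ?_
  rw [Finset.prod_congr rfl (g := fun _ ↦ F δ) fun d hd ↦ by rw [(Finset.mem_filter.1 hd).2],
    Finset.prod_const]
  congr 1
  rw [MonoidHom.card_fiber_eq_of_mem_range h (x := δ) (y := 1) (hh δ) (hh 1),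
    ← Fintype.card_subtype, ← Nat.card_eq_fintype_card]
  rfl

/-! ### Residues of norms of units. -/

section Residue

open IsDedekindDomain Pointwise

attribute [local instance] Ideal.Quotient.field

variable {A R G : Type*} [CommRing A] [IsDedekindDomain A] [CommRing R] [IsDedekindDomain R]
  [Algebra A R] [Module.Finite A R] [Module.IsTorsionFree A R] [Group G] [Fintype G]
  [MulSemiringAction G R] [IsGaloisGroup G A R]

variable (p : Ideal A) [p.IsMaximal] (P : Ideal R) [P.IsMaximal] [P.LiesOver p] [Finite (A ⧸ p)]

include p in
theorem finite_quotient_of_liesOver : Finite (R ⧸ P) := by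
  have : Module.Finite (A ⧸ p) (R ⧸ P) := inferInstance
  exact Module.finite_of_finite (A ⧸ p)

theorem perfectField_residueField : PerfectField p.ResidueField := by
  have : Finite p.ResidueField := Finite.of_surjective _
    (Ideal.bijective_algebraMap_quotient_residueField p).2
  infer_instance

/-- The norm of an element along the decomposition group, modulo the prime. -/
theorem mk_prod_stabilizer (v : R) [Fintype (MulAction.stabilizer G P)] :
    Ideal.Quotient.mk P (∏ d : MulAction.stabilizer G P, (d : G) • v) =
      algebraMap (A ⧸ p) (R ⧸ P) (Algebra.norm (A ⧸ p) (Ideal.Quotient.mk P v)) ^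
        p.ramificationIdxIn R := by
  have := finite_quotient_of_liesOver p P
  have := perfectField_residueField p
  have : Module.Finite (A ⧸ p) (R ⧸ P) := inferInstance
  rw [Algebra.norm_eq_prod_automorphisms, map_prod]
  -- The decomposition group maps onto the Galois group of the residue field with kernel the inertia
  -- group, of order e; each conjugate therefore occurs e times.
  have h := prod_comp_eq_pow_card_ker (Ideal.Quotient.stabilizerHom P p G)
    (Ideal.Quotient.stabilizerHom_surjective G p P) (fun δ ↦ δ (Ideal.Quotient.mk P v))
  have hcard : Nat.card (Ideal.Quotient.stabilizerHom P p G).ker = p.ramificationIdxIn R := by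
    rw [← Ideal.card_inertia_eq_ramificationIdxIn (G := G) p P,
      ← Ideal.Quotient.map_ker_stabilizer_subtype P p G]
    exact (Subgroup.card_map_of_injective (Subgroup.subtype_injective _)).symm
  rw [hcard] at h
  convert h using 2 with d
  rfl

include P in
-- Grouping the norm by cosets of the decomposition group turns it into a norm along that group, to
-- which `mk_prod_stabilizer` applies. Commutativity is needed to interchange the coset
-- representatives with the decomposition group.
theorem exists_pow_ramificationIdxIn_eq (hcomm : ∀ σ τ : G, σ * τ = τ * σ) {u : R} {a : A}
    (ha : algebraMap A R a = ∏ σ : G, σ • u) :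
    ∃ c : A ⧸ p, Ideal.Quotient.mk p a = c ^ p.ramificationIdxIn R := by
  classical
  have : Fintype (MulAction.stabilizer G P) := Fintype.ofFinite _
  have : Fintype (G ⧸ MulAction.stabilizer G P) := Fintype.ofFinite _
  let v := ∏ q : G ⧸ MulAction.stabilizer G P, q.out • u
  have hv : ∏ σ : G, σ • u = ∏ d : MulAction.stabilizer G P, (d : G) • v := by
    simp only [v, Finset.smul_prod']
    rw [Finset.prod_comm, ← Fintype.prod_prod_type']
    symm
    refine Fintype.prod_bijective
      (fun x : (G ⧸ MulAction.stabilizer G P) × MulAction.stabilizer G P ↦ x.1.out * (x.2 : G))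
      ⟨?_, fun σ ↦ ?_⟩ _ _ fun ⟨q, d⟩ ↦ ?_
    · rintro ⟨q, d⟩ ⟨q', d'⟩ h
      have hq : ∀ (q : G ⧸ MulAction.stabilizer G P) (d : MulAction.stabilizer G P),
          (QuotientGroup.mk (q.out * (d : G)) : G ⧸ MulAction.stabilizer G P) = q := fun q d ↦ by
        rw [QuotientGroup.mk_mul_of_mem _ d.2, QuotientGroup.out_eq']
      have h1 : q = q' := by rw [← hq q d, ← hq q' d']; exact congrArg _ h
      subst h1
      exact Prod.ext rfl (Subtype.ext (mul_left_cancel h))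
    · refine ⟨⟨QuotientGroup.mk σ, (QuotientGroup.mk σ : G ⧸ MulAction.stabilizer G P).out⁻¹ * σ,
        QuotientGroup.eq.1 (QuotientGroup.out_eq' _)⟩, mul_inv_cancel_left _ _⟩
    · rw [← mul_smul, hcomm]
  refine ⟨Algebra.norm (A ⧸ p) (Ideal.Quotient.mk P v), (algebraMap (A ⧸ p) (R ⧸ P)).injective ?_⟩
  rw [map_pow, ← mk_prod_stabilizer p P (G := G), ← hv, ← ha]
  rfl

/-- The residue norm between finite fields is surjective. The Chinese remainder theorem then
supplies u with the desired residue at `P` and residue 1 at the other conjugates, and u is a unit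
because no other maximal ideals exist. -/
theorem exists_unit_norm_eq_pow (hp : ∀ Q : Ideal R, Q.IsMaximal → Q.under A = p) (hP0 : P ≠ ⊥)
    {c : A ⧸ p} (hc : c ≠ 0) :
    ∃ u : Rˣ, ∀ a : A, algebraMap A R a = ∏ σ : G, σ • (u : R) →
      Ideal.Quotient.mk p a = c ^ p.ramificationIdxIn R := by
  classical
  have : Fintype (MulAction.stabilizer G P) := Fintype.ofFinite _
  have := finite_quotient_of_liesOver p P
  obtain ⟨y, hy⟩ := FiniteField.norm_surjective (A ⧸ p) (R ⧸ P) c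
  obtain ⟨x, rfl⟩ := Ideal.Quotient.mk_surjective y
  have hprime : ∀ Q ∈ Finset.univ.image (fun σ : G ↦ σ • P), Prime Q := by
    intro Q hQ
    obtain ⟨σ, -, rfl⟩ := Finset.mem_image.1 hQ
    exact Ideal.prime_of_isPrime (fun h ↦ hP0 (by simpa using congrArg (σ⁻¹ • ·) h)) inferInstance
  obtain ⟨u, hu⟩ := IsDedekindDomain.exists_forall_sub_mem_ideal
    (s := Finset.univ.image (fun σ : G ↦ σ • P)) id (fun _ ↦ 1) hprime
    (fun _ _ _ _ h ↦ h) (fun Q ↦ if Q.1 = P then x else 1)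
  have hmemP : P ∈ Finset.univ.image (fun σ : G ↦ σ • P) :=
    Finset.mem_image.2 ⟨1, Finset.mem_univ _, one_smul _ _⟩
  have hu1 : Ideal.Quotient.mk P u = Ideal.Quotient.mk P x := by
    rw [Ideal.Quotient.eq]
    simpa using hu P hmemP
  have hu2 : ∀ σ : G, σ • P ≠ P → u - 1 ∈ σ • P := by
    intro σ hσ
    simpa [hσ] using hu (σ • P) (Finset.mem_image_of_mem _ (Finset.mem_univ σ))
  have hunit : IsUnit u := by
    by_contra h
    obtain ⟨Q, hQ, huQ⟩ := exists_max_ideal_of_mem_nonunits h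
    have : Q.IsPrime := hQ.isPrime
    have : Q.LiesOver p := ⟨(hp Q hQ).symm⟩
    obtain ⟨σ, rfl⟩ := Ideal.exists_smul_eq_of_isGaloisGroup p P Q G
    by_cases hσ : σ • P = P
    · rw [hσ, ← Ideal.Quotient.eq_zero_iff_mem, hu1] at huQ
      rw [huQ, Algebra.norm_zero] at hy
      exact hc hy.symm
    · refine hQ.ne_top ((Ideal.eq_top_iff_one _).2 ?_)
      simpa using sub_mem huQ (hu2 σ hσ)
  refine ⟨hunit.unit, fun a ha ↦ (algebraMap (A ⧸ p) (R ⧸ P)).injective ?_⟩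
  have h1 : algebraMap (A ⧸ p) (R ⧸ P) (Ideal.Quotient.mk p a) =
      Ideal.Quotient.mk P (∏ σ : G, σ • u) := by
    rw [← show algebraMap A R a = ∏ σ : G, σ • u from ha]
    rfl
  rw [h1, map_pow, ← hy, ← hu1, ← mk_prod_stabilizer p P (G := G), map_prod, map_prod,
    ← Finset.prod_filter_mul_prod_filter_not Finset.univ (fun σ : G ↦ σ • P = P)]
  -- If σ moves `P`, then u ≡ 1 modulo σ⁻¹P, hence σu ≡ 1 modulo P: only the decomposition group
  -- contributes.
  have h2 : ∏ σ ∈ Finset.univ.filter (fun σ : G ↦ ¬ σ • P = P), Ideal.Quotient.mk P (σ • u) = 1 := by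
    refine Finset.prod_eq_one fun σ hσ ↦ ?_
    have hσ' : σ⁻¹ • P ≠ P := fun h ↦ (Finset.mem_filter.1 hσ).2 (by rw [← h, smul_inv_smul, h])
    rw [← map_one (Ideal.Quotient.mk P), Ideal.Quotient.eq]
    have := Ideal.smul_mem_pointwise_smul σ _ _ (hu2 _ hσ')
    rwa [smul_inv_smul, smul_sub, smul_one] at this
  rw [h2, mul_one]
  exact Finset.prod_subtype _ (fun σ ↦ by simp [MulAction.mem_stabilizer_iff]) _

end Residue

/-! ### Cohomology of the ideal group above a single prime. -/

section LocalIndex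

open IsDedekindDomain Pointwise

attribute [local instance] Ideal.Quotient.field

variable {A k R K G : Type*} [CommRing A] [IsDedekindDomain A] [Field k] [Algebra A k]
  [IsFractionRing A k] [CommRing R] [IsDedekindDomain R] [Field K] [Algebra R K]
  [IsFractionRing R K] [Algebra A R] [Algebra A K] [Algebra k K] [IsScalarTower A k K]
  [IsScalarTower A R K] [Module.Finite A R] [Module.IsTorsionFree A R] [Group G] [Fintype G]
  [MulSemiringAction G R] [IsGaloisGroup G A R]

variable (R) in
/-- The common residue degree of the primes above `v`. -/
def inertIn (v : HeightOneSpectrum A) : ℕ := v.asIdeal.inertiaDegIn R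

variable (G) in
include G in
theorem inertIn_ne_zero (v : HeightOneSpectrum A) : inertIn R v ≠ 0 := by
  have : FaithfulSMul A R := (faithfulSMul_iff_algebraMap_injective A R).2
    (FaithfulSMul.algebraMap_injective A R)
  exact Ideal.inertiaDegIn_ne_zero G

variable (G) in
include G in
theorem ramIn_mul_inertIn_dvd (v : HeightOneSpectrum A) :
    ramIn R v * inertIn R v ∣ Nat.card G :=
  ⟨_, by
    rw [mul_comm]
    exact (Ideal.ncard_primesOver_mul_ramificationIdxIn_mul_inertiaDegIn v.asIdeal R G).symm⟩

theorem card_stabilizer_prime (w : HeightOneSpectrum R)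
    [Finite (A ⧸ (w.under A).asIdeal)] :
    Nat.card (MulAction.stabilizer G w) = ramIn R (w.under A) * inertIn R (w.under A) := by
  have : w.asIdeal.LiesOver (w.under A).asIdeal := ⟨rfl⟩
  have := perfectField_residueField (w.under A).asIdeal
  rw [ramIn, inertIn, ← Ideal.card_stabilizer_eq (G := G) (w.under A).asIdeal w.asIdeal]
  congr 2
  ext σ
  simp [MulAction.mem_stabilizer_iff, HeightOneSpectrum.ext_iff, asIdeal_smul]

theorem tateIndex_actionDiff_actionNorm [MulSemiringAction G K] [SMulDistribClass G R K]
    {g : G} (hg : ∀ σ, σ ∈ Subgroup.zpowers g) :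
    tateIndex (actionDiff (idealAction R K G) g) (actionNorm (idealAction R K G)) ⊤ = 1 := by
  rw [tateIndex, Subgroup.relIndex_eq_one]
  rintro I ⟨-, hI⟩
  obtain ⟨J, rfl⟩ := exists_actionDiff_eq_of_actionNorm_eq_one hg hI
  exact ⟨J, trivial, rfl⟩

variable {v₀ : HeightOneSpectrum A} (hv₀ : ∀ v : HeightOneSpectrum A, v = v₀)

include hv₀

variable (G) in
include G in
theorem exists_smul_eq_of_unique (w w' : HeightOneSpectrum R) : ∃ σ : G, σ • w = w' :=
  exists_smul_eq_of_under_eq (A := A) G (by rw [hv₀ (w.under A), hv₀ (w'.under A)])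

variable (G R) in
include G in
theorem finite_heightOneSpectrum_of_unique : Finite (HeightOneSpectrum R) := by
  obtain ⟨w, -⟩ := exists_under_eq R v₀
  exact Finite.of_surjective (fun σ : G ↦ σ • w) fun w' ↦ exists_smul_eq_of_unique G hv₀ w w'

variable (G R) in
include G in
theorem isPrincipalIdealRing_of_unique : IsPrincipalIdealRing R := by
  have := finite_heightOneSpectrum_of_unique R G hv₀
  refine IsPrincipalIdealRing.of_finite_primes (((Set.finite_range
    (HeightOneSpectrum.asIdeal (R := R))).union (Set.finite_singleton ⊥)).subset fun I hI ↦ ?_)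
  by_cases h : I = ⊥
  · exact Or.inr h
  · exact Or.inl ⟨⟨I, hI, h⟩, rfl⟩

variable [MulSemiringAction G K] [SMulDistribClass G R K] [Finite (A ⧸ v₀.asIdeal)]

/-- The elements of `G` that carry w to a given w' form a coset of the stabilizer, whose order is
ef. -/
theorem ordAt_actionNorm_of_unique [Fintype (HeightOneSpectrum R)] (w : HeightOneSpectrum R)
    (I : (FractionalIdeal R⁰ K)ˣ) :
    ordAt w (actionNorm (idealAction R K G) I) =
      (ramIn R v₀ * inertIn R v₀ : ℕ) * ∑ w' : HeightOneSpectrum R, ordAt w' I := by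
  classical
  rw [ordAt_actionNorm, ← Finset.sum_fiberwise (s := Finset.univ) (g := fun σ : G ↦ σ • w),
    Finset.mul_sum]
  refine Finset.sum_congr rfl fun w' _ ↦ ?_
  rw [Finset.sum_congr rfl (g := fun _ ↦ ordAt w' I) fun σ hσ ↦ by
    rw [(Finset.mem_filter.1 hσ).2], Finset.sum_const, nsmul_eq_mul]
  congr 2
  obtain ⟨τ, rfl⟩ := exists_smul_eq_of_unique G hv₀ w w'
  have : Finite (A ⧸ (w.under A).asIdeal) := by rwa [hv₀ (w.under A)]
  rw [← hv₀ (w.under A), ← card_stabilizer_prime (G := G) w, Nat.card_eq_fintype_card,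
    Fintype.card_subtype]
  refine Finset.card_bij (fun σ _ ↦ τ⁻¹ * σ) (fun σ hσ ↦ ?_) (fun _ _ _ _ h ↦ mul_left_cancel h)
    fun σ hσ ↦ ⟨τ * σ, ?_, by simp⟩
  · simp only [Finset.mem_filter, Finset.mem_univ, true_and] at hσ ⊢
    rw [MulAction.mem_stabilizer_iff, mul_smul, hσ, inv_smul_smul]
  · simp only [Finset.mem_filter, Finset.mem_univ, true_and] at hσ ⊢
    rw [mul_smul, MulAction.mem_stabilizer_iff.1 hσ]

theorem tateIndex_actionNorm_actionDiff {g : G} (hg : ∀ σ, σ ∈ Subgroup.zpowers g) :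
    tateIndex (actionNorm (idealAction R K G)) (actionDiff (idealAction R K G) g) ⊤ =
      ramIn R v₀ * inertIn R v₀ := by
  classical
  have := finite_heightOneSpectrum_of_unique R G hv₀
  have := Fintype.ofFinite (HeightOneSpectrum R)
  set d := ramIn R v₀ * inertIn R v₀ with hd
  obtain ⟨w, -⟩ := exists_under_eq R v₀
  -- Invariant ideals have one constant exponent, so they form a copy of ℤ; the norms are those
  -- whose exponent is a multiple of d = ef.
  let Ψ : (FractionalIdeal R⁰ K)ˣ →* Multiplicative (ZMod d) :=
    (AddMonoidHom.toMultiplicative (Int.castAddHom (ZMod d))).comp (ordHom K w)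
  have hΨ : ∀ I, Ψ I = 1 ↔ (d : ℤ) ∣ ordAt w I := fun I ↦ by
    rw [← ZMod.intCast_zmod_eq_zero_iff_dvd]
    rfl
  have e1 : (⊤ : Subgroup (FractionalIdeal R⁰ K)ˣ).map (actionNorm (idealAction R K G)) =
      Ψ.ker ⊓ (actionDiff (idealAction R K G) g).ker := by
    ext I
    constructor
    · rintro ⟨J, -, rfl⟩
      refine ⟨(hΨ _).2 ?_, actionDiff_actionNorm _ _ _⟩
      rw [ordAt_actionNorm_of_unique hv₀]
      exact dvd_mul_right _ _
    · rintro ⟨hI1, hI2⟩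
      obtain ⟨m, hm⟩ := (hΨ I).1 hI1
      refine ⟨primeUnit K w ^ m, trivial, fracIdeal_eq_of_ordAt_eq fun w' ↦ ?_⟩
      rw [ordAt_actionNorm_of_unique hv₀, ordAt_eq_of_forall_idealAction_eq (A := A)
        ((mem_ker_actionDiff hg).1 hI2) ((hv₀ (w'.under A)).trans (hv₀ (w.under A)).symm), hm]
      simp only [ordAt_zpow, ordAt_primeUnit, mul_ite, mul_one, mul_zero, Finset.sum_ite_eq,
        Finset.mem_univ, if_true]
      rw [hd]
  rw [tateIndex, top_inf_eq, e1, Subgroup.inf_relIndex_right, Subgroup.relIndex_ker]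
  have e2 : (actionDiff (idealAction R K G) g).ker.map Ψ = ⊤ := by
    rw [eq_top_iff]
    intro y _
    obtain ⟨a, ha⟩ := ZMod.intCast_surjective y.toAdd
    let c : HeightOneSpectrum R →₀ ℤ := Finsupp.equivFunOnFinite.symm fun _ ↦ a
    refine ⟨c.prod fun v m ↦ primeUnit K v ^ m, (mem_ker_actionDiff hg).2 fun σ ↦
      fracIdeal_eq_of_ordAt_eq fun v ↦ ?_, ?_⟩
    · rw [ordAt_idealAction, ordAt_finsupp_prod, ordAt_finsupp_prod]
      rfl
    · change Multiplicative.ofAdd ((ordAt w (c.prod fun v m ↦ primeUnit K v ^ m) : ℤ) :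
        ZMod d) = y
      rw [ordAt_finsupp_prod]
      change Multiplicative.ofAdd ((a : ℤ) : ZMod d) = y
      rw [ha]
      rfl
  rw [e2, Subgroup.card_top, Nat.card_congr Multiplicative.toAdd, Nat.card_zmod]

/-- The norm on multiplicative groups. -/
abbrev normUnits (k K : Type*) [Field k] [Field K] [Algebra k K] : Kˣ →* kˣ :=
  Units.map (Algebra.norm k)

/-- Lifting the norm back to `K` multiplies its order by e, and the order upstairs is ef times the
sum; cancelling e leaves f. -/
theorem ordAt_normUnits [Fintype (HeightOneSpectrum R)]
    (hnm : ∀ x, baseUnits k K (normUnits k K x) = actionNorm (unitsAction K G) x) (x : Kˣ) :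
    ordAt v₀ (toPrincipalIdeal A k (normUnits k K x)) =
      inertIn R v₀ * ∑ w : HeightOneSpectrum R, ordAt w (toPrincipalIdeal R K x) := by
  obtain ⟨w, hw⟩ := exists_under_eq R v₀
  have h1 := ordAt_baseUnits (A := A) (K := K) G w (normUnits k K x)
  rw [hnm, toPrincipalIdeal_actionNorm, ordAt_actionNorm_of_unique hv₀, hw] at h1
  have he : (ramIn R v₀ : ℤ) ≠ 0 := by exact_mod_cast ramIn_ne_zero G v₀
  refine mul_left_cancel₀ he ?_
  rw [← h1]
  push_cast
  ring

end LocalIndex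

/-! ### The index of the elements whose norm is a local n-th power. -/

section NormIndex

open IsDedekindDomain Pointwise

attribute [local instance] Ideal.Quotient.field

variable {A k R K G : Type*} [CommRing A] [IsDedekindDomain A] [Field k] [Algebra A k]
  [IsFractionRing A k] [CommRing R] [IsDedekindDomain R] [Field K] [Algebra R K]
  [IsFractionRing R K] [Algebra A R] [Algebra A K] [Algebra k K] [IsScalarTower A k K]
  [IsScalarTower A R K] [Module.Finite A R] [Module.IsTorsionFree A R] [Group G] [Fintype G]
  [MulSemiringAction G R] [IsGaloisGroup G A R] [MulSemiringAction G K] [SMulDistribClass G R K]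

theorem baseUnits_injective (k K : Type*) [Field k] [Field K] [Algebra k K] :
    Function.Injective (baseUnits k K) :=
  Units.map_injective (algebraMap k K).injective

theorem relIndex_powMonoidHom_range {H : Type*} [CommGroup H] [IsCyclic H] [Finite H] {e n : ℕ}
    (hen : e ∣ n) (hn : n ∣ Nat.card H) :
    (powMonoidHom n : H →* H).range.relIndex (powMonoidHom e : H →* H).range * e = n := by
  have hle : (powMonoidHom n : H →* H).range ≤ (powMonoidHom e : H →* H).range := by
    obtain ⟨m, rfl⟩ := hen
    rintro _ ⟨x, rfl⟩
    exact ⟨x ^ m, by simp only [powMonoidHom_apply]; rw [← pow_mul, mul_comm]⟩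
  have h := Subgroup.relIndex_mul_index hle
  rwa [IsCyclic.index_powMonoidHom_range, IsCyclic.index_powMonoidHom_range,
    Nat.gcd_eq_right (hen.trans hn), Nat.gcd_eq_right hn] at h

variable {v₀ : HeightOneSpectrum A} (hv₀ : ∀ v : HeightOneSpectrum A, v = v₀)
  [Finite (A ⧸ v₀.asIdeal)]
  (hnm : ∀ x, baseUnits k K (normUnits k K x) = actionNorm (unitsAction K G) x)

include hv₀

theorem algebraMap_intNorm_eq_prod_smul [FiniteDimensional k K]
    (hnm : ∀ x, baseUnits k K (normUnits k K x) = actionNorm (unitsAction K G) x) (u : Rˣ) :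
    algebraMap A R (Algebra.intNorm A R u) = ∏ σ : G, σ • (u : R) := by
  refine IsFractionRing.injective R K ?_
  rw [← IsScalarTower.algebraMap_apply, IsScalarTower.algebraMap_apply A k K,
    Algebra.algebraMap_intNorm (K := k) (L := K), map_prod]
  have h := congrArg Units.val (hnm (Units.map (algebraMap R K).toMonoidHom u))
  rw [actionNorm_apply, Units.coe_prod] at h
  simpa [algebraMap.smul'] using h

/-- The norms of units reduce to the `e`-th powers in the residue field. -/
theorem range_residue_intNorm [FiniteDimensional k K] (hcomm : ∀ σ τ : G, σ * τ = τ * σ)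
    (hnm : ∀ x, baseUnits k K (normUnits k K x) = actionNorm (unitsAction K G) x) :
    ((Units.map (Ideal.Quotient.mk v₀.asIdeal).toMonoidHom).comp
      (Units.map (Algebra.intNorm A R))).range =
      (powMonoidHom (ramIn R v₀) : (A ⧸ v₀.asIdeal)ˣ →* (A ⧸ v₀.asIdeal)ˣ).range := by
  obtain ⟨w, hw⟩ := exists_under_eq R v₀
  have : w.asIdeal.LiesOver v₀.asIdeal := ⟨by rw [← hw]; rfl⟩
  ext c
  constructor
  · rintro ⟨u, rfl⟩
    obtain ⟨c, hc⟩ := exists_pow_ramificationIdxIn_eq v₀.asIdeal w.asIdeal hcomm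
      (algebraMap_intNorm_eq_prod_smul hv₀ hnm u)
    have hc0 : c ≠ 0 := by
      rintro rfl
      have hu : Ideal.Quotient.mk v₀.asIdeal (Algebra.intNorm A R (u : R)) ≠ 0 :=
        (((Units.map (Ideal.Quotient.mk v₀.asIdeal).toMonoidHom).comp
          (Units.map (Algebra.intNorm A R))) u).ne_zero
      rw [hc, zero_pow (show v₀.asIdeal.ramificationIdxIn R ≠ 0 from ramIn_ne_zero (R := R) G v₀)] at hu
      exact hu rfl
    exact ⟨Units.mk0 c hc0, Units.ext hc.symm⟩
  · rintro ⟨c, rfl⟩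
    obtain ⟨u, hu⟩ := exists_unit_norm_eq_pow (G := G) v₀.asIdeal w.asIdeal (fun Q hQ ↦ by
      have hQ0 : Q ≠ ⊥ := by
        rintro rfl
        refine w.ne_bot (eq_bot_iff.2 ?_)
        exact (hQ.eq_of_le w.isPrime.ne_top bot_le).ge
      exact congrArg HeightOneSpectrum.asIdeal (hv₀ ((⟨Q, hQ.isPrime, hQ0⟩ :
        HeightOneSpectrum R).under A))) w.ne_bot c.ne_zero
    exact ⟨u, Units.ext (hu _ (algebraMap_intNorm_eq_prod_smul hv₀ hnm u))⟩

/-- The index of the group of elements whose norms lie in `V`, where `V` is cut out by a condition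
modulo `n` on the order and the residue. -/
theorem index_comap_normUnits [SMulCommClass G k K] [FiniteDimensional k K] [IsPrincipalIdealRing A]
    {g : G} (hg : ∀ σ, σ ∈ Subgroup.zpowers g) (hcard : Nat.card G ∣ Nat.card (A ⧸ v₀.asIdeal) - 1)
    (hnm : ∀ x, baseUnits k K (normUnits k K x) = actionNorm (unitsAction K G) x)
    {V : Subgroup kˣ} (hV1 : ∀ x, x ^ Nat.card G ∈ V)
    (hV2 : ∀ x ∈ V, (Nat.card G : ℤ) ∣ ordAt v₀ (toPrincipalIdeal A k x))
    (hV3 : ∀ a : Aˣ, Units.map (algebraMap A k).toMonoidHom a ∈ V ↔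
      ∃ c : A ⧸ v₀.asIdeal, Ideal.Quotient.mk v₀.asIdeal a = c ^ Nat.card G) :
    (V.comap (normUnits k K)).index * (ramIn R v₀ * inertIn R v₀) = Nat.card G * Nat.card G := by
  classical
  have := finite_heightOneSpectrum_of_unique R G hv₀
  have := Fintype.ofFinite (HeightOneSpectrum R)
  have := isPrincipalIdealRing_of_unique R G hv₀
  set n := Nat.card G
  set Lp := V.comap (normUnits k K)
  set φ := toPrincipalIdeal R K
  let s : (FractionalIdeal R⁰ K)ˣ → ℤ := fun I ↦ ∑ w : HeightOneSpectrum R, ordAt w I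
  have hord := ordAt_normUnits (R := R) (G := G) hv₀ hnm
  have hf0 : inertIn R v₀ ≠ 0 := inertIn_ne_zero G v₀
  have hef := ramIn_mul_inertIn_dvd (R := R) G v₀
  obtain ⟨n', hn'⟩ : ∃ n', n = inertIn R v₀ * n' :=
    (Dvd.intro_left _ rfl : inertIn R v₀ ∣ _).trans hef
  have hen : ramIn R v₀ ∣ n := (Dvd.intro _ rfl).trans hef
  -- The norm has order f times the total order, so with n = f · n' the condition that n divides the
  -- order of the norm becomes a condition modulo n'.
  let Ψ : Kˣ →* Multiplicative (ZMod n') :=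
    (AddMonoidHom.toMultiplicative (Int.castAddHom (ZMod n'))).comp
      ((∏ w : HeightOneSpectrum R, ordHom K w).comp φ)
  have hs : ∀ I, (∏ w : HeightOneSpectrum R, ordHom K w) I = Multiplicative.ofAdd (s I) := by
    intro I
    rw [MonoidHom.finsetProd_apply]
    exact (ofAdd_sum _ _).symm
  have hΨ : ∀ x, Ψ x = Multiplicative.ofAdd ((s (φ x) : ℤ) : ZMod n') := by
    intro x
    simp only [Ψ, MonoidHom.comp_apply, hs]
    rfl
  have hL' : ∀ x, x ∈ Ψ.ker ↔ (n : ℤ) ∣ ordAt v₀ (toPrincipalIdeal A k (normUnits k K x)) := by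
    intro x
    rw [MonoidHom.mem_ker, hΨ, hord, hn', ofAdd_eq_one, ZMod.intCast_zmod_eq_zero_iff_dvd]
    push_cast
    exact (mul_dvd_mul_iff_left (by exact_mod_cast hf0)).symm
  have hΨsurj : Function.Surjective Ψ := by
    intro y
    obtain ⟨a, ha⟩ := ZMod.intCast_surjective y.toAdd
    obtain ⟨w, -⟩ := exists_under_eq R v₀
    obtain ⟨x, hx⟩ := exists_toPrincipalIdeal_eq (primeUnit K w ^ a)
    refine ⟨x, ?_⟩
    have : s (φ x) = a := by
      simp only [s, φ, hx, ordAt_zpow, ordAt_primeUnit, mul_ite, mul_one, mul_zero,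
        Finset.sum_ite_eq, Finset.mem_univ, if_true]
    rw [hΨ, this, ha]
    rfl
  have hLp : Lp ≤ Ψ.ker := fun x hx ↦ (hL' x).2 (hV2 _ hx)
  have hnorm_base : ∀ y : kˣ, normUnits k K (baseUnits k K y) = y ^ n := by
    intro y
    refine baseUnits_injective k K ?_
    rw [hnm, actionNorm_of_forall_eq, map_pow]
    exact fun σ ↦ Units.ext (smul_algebraMap σ (y : k))
  -- Dividing x by a power of a uniformizer of the base makes the total order 0, so its ideal has
  -- norm 1. Hilbert 90 for ideals and principality of `R` then write the quotient as a unit times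
  -- some `D y`. Both `D y` and the power of the uniformizer lie in `Lp`.
  have hU : φ.ker ⊔ Lp = Ψ.ker := by
    refine le_antisymm (sup_le (fun x hx ↦ ?_) hLp) fun x hx ↦ ?_
    · rw [MonoidHom.mem_ker, hΨ, show φ x = 1 from hx]
      simp [s]
    · obtain ⟨j, hj⟩ := (hL' x).1 hx
      obtain ⟨π, hπ⟩ := exists_toPrincipalIdeal_eq (primeUnit k v₀)
      set x' := x * (baseUnits k K π ^ j)⁻¹
      have h1 : s (φ x') = 0 := by
        have h2 := hord x'
        have h3 : ordAt v₀ (toPrincipalIdeal A k (normUnits k K x')) = 0 := by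
          simp only [x', map_mul, map_inv, map_zpow, hnorm_base, ordAt_mul, ordAt_inv, ordAt_zpow,
            map_pow, hπ, hj]
          rw [← zpow_natCast, ordAt_zpow, ordAt_primeUnit, if_pos rfl]
          ring
        rw [h3, eq_comm, mul_eq_zero] at h2
        exact h2.resolve_left (by exact_mod_cast hf0)
      have h2 : actionNorm (idealAction R K G) (φ x') = 1 := by
        refine fracIdeal_eq_of_ordAt_eq fun w ↦ ?_
        rw [ordAt_actionNorm_of_unique hv₀, ordAt_one]
        exact mul_eq_zero_of_right _ h1
      obtain ⟨J, hJ⟩ := exists_actionDiff_eq_of_actionNorm_eq_one hg h2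
      obtain ⟨y, rfl⟩ := exists_toPrincipalIdeal_eq J
      have h3 : x' / actionDiff (unitsAction K G) g y ∈ φ.ker := by
        rw [MonoidHom.mem_ker, map_div, toPrincipalIdeal_actionDiff, hJ, div_self']
      have h4 : actionDiff (unitsAction K G) g y ∈ Lp := by
        have : normUnits k K (actionDiff (unitsAction K G) g y) = 1 := by
          refine baseUnits_injective k K ?_
          rw [hnm, actionNorm_actionDiff, map_one]
        rw [Subgroup.mem_comap, this]
        exact one_mem _
      have h5 : baseUnits k K π ^ j ∈ Lp := by
        refine zpow_mem ?_ _
        rw [Subgroup.mem_comap, hnorm_base]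
        exact hV1 π
      have h6 : x = x' / actionDiff (unitsAction K G) g y *
          (actionDiff (unitsAction K G) g y * baseUnits k K π ^ j) := by
        simp only [x']
        rw [← mul_assoc, div_mul_cancel, inv_mul_cancel_right]
      rw [h6]
      exact mul_mem (Subgroup.mem_sup_left h3) (Subgroup.mem_sup_right (mul_mem h4 h5))
  let ι : Rˣ →* Kˣ := Units.map (algebraMap R K).toMonoidHom
  have hι : φ.ker = (⊤ : Subgroup Rˣ).map ι := by
    ext x
    rw [MonoidHom.mem_ker, toPrincipalIdeal_eq_one_iff]
    exact ⟨fun ⟨u, hu⟩ ↦ ⟨u, trivial, Units.ext hu⟩, fun ⟨u, _, hu⟩ ↦ ⟨u, congrArg Units.val hu⟩⟩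
  have hcyc := range_residue_intNorm (R := R) (K := K) hv₀
    (fun σ τ ↦ by
      obtain ⟨a, rfl⟩ := hg σ
      obtain ⟨b, rfl⟩ := hg τ
      exact zpow_mul_comm g a b) hnm
  have hcomap : Lp.comap ι = (powMonoidHom n : (A ⧸ v₀.asIdeal)ˣ →* (A ⧸ v₀.asIdeal)ˣ).range.comap
      ((Units.map (Ideal.Quotient.mk v₀.asIdeal).toMonoidHom).comp
      (Units.map (Algebra.intNorm A R))) := by
    ext u
    have h1 : normUnits k K (ι u) = Units.map (algebraMap A k).toMonoidHom
        (Units.map (Algebra.intNorm A R) u) :=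
      Units.ext (Algebra.algebraMap_intNorm (K := k) (L := K) (u : R)).symm
    rw [Subgroup.mem_comap, Subgroup.mem_comap, h1, hV3, Subgroup.mem_comap]
    constructor
    · rintro ⟨c, hc⟩
      have hc0 : c ≠ 0 := by
        rintro rfl
        rw [zero_pow Nat.card_pos.ne'] at hc
        exact (((Units.map (Ideal.Quotient.mk v₀.asIdeal).toMonoidHom).comp
          (Units.map (Algebra.intNorm A R))) u).ne_zero hc
      exact ⟨Units.mk0 c hc0, Units.ext hc.symm⟩
    · rintro ⟨c, hc⟩
      exact ⟨c, (congrArg Units.val hc).symm⟩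
  -- On units the condition compares e-th powers with n-th powers in the cyclic residue group, which
  -- gives index n/e; the order condition contributes n/f.
  have hrel : Lp.relIndex Ψ.ker * ramIn R v₀ = n := by
    rw [← hU, Subgroup.relIndex_sup_right, hι, ← Subgroup.relIndex_comap, hcomap,
      Subgroup.relIndex_top_right, Subgroup.index_comap, hcyc]
    refine relIndex_powMonoidHom_range hen ?_
    have : Fintype (A ⧸ v₀.asIdeal) := Fintype.ofFinite _
    rwa [Nat.card_units]
  have hidx : Ψ.ker.index * inertIn R v₀ = n := by
    rw [Subgroup.index_ker, MonoidHom.range_eq_top.2 hΨsurj, Subgroup.card_top,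
      Nat.card_congr Multiplicative.toAdd, Nat.card_zmod, hn', mul_comm]
  rw [← Subgroup.relIndex_mul_index hLp]
  calc _ = (Lp.relIndex Ψ.ker * ramIn R v₀) * (Ψ.ker.index * inertIn R v₀) := by ring
    _ = _ := by rw [hrel, hidx]

end NormIndex

/-! ### Roots of one-units in characteristic p. -/

section OneUnits

open Filter Topology WithZero

/-- A one-unit of a complete discretely valued field of characteristic `p` has `n`-th roots for
every `n` dividing `pᵐ - 1`. -/
theorem exists_pow_eq_of_valuation_sub_one_lt {L : Type*} [Field L] [Valued L ℤᵐ⁰] [CompleteSpace L]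
    (p : ℕ) [hp : Fact p.Prime] [CharP L p] {m n : ℕ} (hm : m ≠ 0) (hn : n ∣ p ^ m - 1) {u : L}
    (hu : Valued.v (u - 1) < (1 : ℤᵐ⁰)) : ∃ s : L, s ^ n = u := by
  set q := p ^ m with hq
  have hq2 : 2 ≤ q := hp.out.two_le.trans (Nat.le_self_pow hm p)
  -- Frobenius gives w^(q^j) - 1 = (w - 1)^(q^j), which tends to 0.
  have hlim : ∀ w : L, Valued.v (w - 1) < (1 : ℤᵐ⁰) → Tendsto (fun j ↦ w ^ q ^ j) atTop (𝓝 1) := by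
    intro w hw
    have h1 : Tendsto (fun j ↦ (w - 1) ^ q ^ j) atTop (𝓝 0) :=
      (Valued.tendsto_zero_pow_of_v_lt_one hw).comp (tendsto_pow_atTop_atTop_of_one_lt hq2)
    have h2 : ∀ j, (w - 1) ^ q ^ j = w ^ q ^ j - 1 := fun j ↦ by
      rw [hq, ← pow_mul, sub_pow_char_pow, one_pow]
    simp_rw [h2] at h1
    simpa using h1.add_const 1
  have hone : ∀ w : L, Valued.v (w - 1) < (1 : ℤᵐ⁰) → Valued.v w = (1 : ℤᵐ⁰) := by
    intro w hw
    have := Valuation.map_add_eq_of_lt_right (v := (Valued.v : Valuation L ℤᵐ⁰)) (x := w - 1) (y := 1)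
      (by rwa [map_one])
    rwa [sub_add_cancel, map_one] at this
  have hu1 := hone u hu
  have hu0 : u ≠ 0 := by
    rintro rfl
    simp at hu1
  have hpow : ∀ w : L, Valued.v (w - 1) < (1 : ℤᵐ⁰) → ∀ i : ℕ,
      Valued.v (w ^ i - 1) < (1 : ℤᵐ⁰) := by
    intro w hw i
    rw [← geom_sum_mul, map_mul]
    refine lt_of_le_of_lt (mul_le_of_le_one_left' ?_) hw
    refine Valuation.map_sum_le _ fun i _ ↦ ?_
    rw [map_pow, hone w hw, one_pow]
  have hinv : Valued.v (u⁻¹ - 1) < (1 : ℤᵐ⁰) := by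
    have : u⁻¹ - 1 = -(u⁻¹ * (u - 1)) := by
      rw [mul_sub, inv_mul_cancel₀ hu0]
      ring
    rw [this, Valuation.map_neg, map_mul, map_inv₀, hu1, inv_one, one_mul]
    exact hu
  obtain ⟨d, hd⟩ := hn
  have hdvd : ∀ j, n ∣ q ^ j - 1 := fun j ↦
    (Dvd.intro _ hd.symm).trans (by simpa using Nat.sub_dvd_pow_sub_pow q 1 j)
  have hn0 : 0 < n := Nat.pos_of_ne_zero (by rintro rfl; simp at hd; omega)
  -- The integers -(q^j - 1)/n converge p-adically to 1/n. Concretely s_j^n · u^(q^j) = u, and the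
  -- second factor tends to 1.
  let s : ℕ → L := fun j ↦ u⁻¹ ^ ((q ^ j - 1) / n)
  have hs : ∀ j, s (j + 1) - s j = s j * ((u⁻¹ ^ d) ^ q ^ j - 1) := by
    intro j
    have : (q ^ (j + 1) - 1) / n = (q ^ j - 1) / n + d * q ^ j := by
      have h1 : q ^ (j + 1) - 1 = (q ^ j - 1) + n * (d * q ^ j) := by
        have h2 : 1 ≤ q ^ j := Nat.one_le_pow _ _ (by omega)
        rw [← mul_assoc, ← hd, pow_succ, Nat.sub_mul, mul_comm q, one_mul]
        have : q ^ j ≤ q ^ j * q := Nat.le_mul_of_pos_right _ (by omega)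
        omega
      rw [h1, Nat.add_mul_div_left _ _ hn0]
    change u⁻¹ ^ ((q ^ (j + 1) - 1) / n) - _ = _
    rw [this, pow_add, pow_mul]
    ring
  have : NonarchimedeanAddGroup L := ⟨fun U hU ↦ by
    obtain ⟨γ, hγ⟩ := Valued.mem_nhds_zero.1 hU
    exact ⟨⟨Valued.v.restrict.ltAddSubgroup γ, Valued.isOpen_ball L γ.1⟩, hγ⟩⟩
  have hcauchy : CauchySeq s := by
    refine NonarchimedeanAddGroup.cauchySeq_of_tendsto_sub_nhds_zero ?_
    have h1 := (hlim _ (hpow _ hinv d)).sub_const 1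
    rw [sub_self] at h1
    intro U hU
    obtain ⟨γ, hγ⟩ := Valued.mem_nhds_zero.1 hU
    have h2 := h1 (Valued.mem_nhds_zero.2 ⟨γ, subset_rfl⟩)
    rw [Filter.mem_map] at h2 ⊢
    filter_upwards [h2] with j hj
    change s (j + 1) - s j ∈ U
    rw [hs]
    refine hγ ?_
    have h2 : Valued.v.restrict (s j) ≤ 1 := by
      rw [Valuation.restrict_le_one_iff, map_pow, map_inv₀, hu1, inv_one, one_pow]
    change (Valued.v : Valuation L ℤᵐ⁰).restrict _ < _ at hj ⊢
    rw [map_mul]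
    exact (mul_le_of_le_one_left' h2).trans_lt hj
  obtain ⟨t, ht⟩ := cauchySeq_tendsto_of_complete hcauchy
  refine ⟨t, ?_⟩
  have h1 := (ht.pow n).mul (hlim u hu)
  have h2 : ∀ j, s j ^ n * u ^ q ^ j = u := by
    intro j
    simp only [s]
    rw [← pow_mul, Nat.div_mul_cancel (hdvd j), inv_pow]
    have h2 : u ^ q ^ j = u ^ (q ^ j - 1) * u := by
      rw [← pow_succ, Nat.sub_add_cancel (Nat.one_le_pow _ _ (by omega))]
    rw [h2, inv_mul_cancel_left₀ (pow_ne_zero _ hu0)]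
  simp_rw [h2, mul_one] at h1
  exact tendsto_nhds_unique h1 tendsto_const_nhds |>.symm ▸ rfl

end OneUnits

/-! ### The completion at infinity. -/

section Completion

open WithZero Topology RatFunc.CompletionAtInfty

variable {F : Type*} [Field F] [DecidableEq F⟮X⟯]

theorem valuation_algebraMap_completion (x : F⟮X⟯) :
    Valued.v (algebraMap F⟮X⟯ (RatFunc.CompletionAtInfty F) x) = RatFunc.inftyValuation F x := by
  let := RatFunc.inftyValued F
  exact Valued.extensionValuation_apply_coe x

theorem exists_valuation_sub_lt (y : RatFunc.CompletionAtInfty F) :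
    ∃ z : F⟮X⟯, Valued.v (y - algebraMap F⟮X⟯ (RatFunc.CompletionAtInfty F) z) < (1 : ℤᵐ⁰) := by
  let := RatFunc.inftyValued F
  have h1 : {z : RatFunc.CompletionAtInfty F | Valued.v (y - z) < (1 : ℤᵐ⁰)} ∈ 𝓝 y := by
    refine Valued.mem_nhds.2 ⟨1, fun z hz ↦ ?_⟩
    change Valued.v.restrict (z - y) < 1 at hz
    rw [Valuation.restrict_lt_one_iff] at hz
    change Valued.v (y - z) < (1 : ℤᵐ⁰)
    rwa [Valuation.map_sub_swap]
  obtain ⟨z, hz⟩ := (UniformSpace.Completion.denseRange_coe (α := F⟮X⟯)).mem_nhds h1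
  exact ⟨z, hz⟩

instance : CompleteSpace (RatFunc.CompletionAtInfty F) :=
  inferInstanceAs (CompleteSpace (UniformSpace.Completion F⟮X⟯))

end Completion

/-! ### The valuation ring at infinity and n-th powers in the completion. -/

section InftyRing

open WithZero IsDedekindDomain

variable (F : Type*) [Field F] [DecidableEq F⟮X⟯]

/-- The valuation ring of the infinite place of `F(T)`. -/
abbrev inftyRing : ValuationSubring F⟮X⟯ := (RatFunc.inftyValuation F).valuationSubring

/-- The maximal ideal of the valuation ring of the infinite place. -/
def inftyPrime : HeightOneSpectrum (inftyRing F) := IsDiscreteValuationRing.maximalIdeal _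

variable {F}

theorem eq_inftyPrime (v : HeightOneSpectrum (inftyRing F)) : v = inftyPrime F :=
  HeightOneSpectrum.ext ((IsLocalRing.isMaximal_iff _).1 v.isMaximal)

theorem isUnit_inftyRing_iff {a : inftyRing F} :
    IsUnit a ↔ RatFunc.inftyValuation F a = 1 :=
  Valuation.Integers.isUnit_iff_valuation_eq_one (Valuation.integer.integers
    (RatFunc.inftyValuation F))

theorem mem_inftyPrime_iff {a : inftyRing F} :
    a ∈ (inftyPrime F).asIdeal ↔ RatFunc.inftyValuation F a < 1 := by
  change a ∈ IsLocalRing.maximalIdeal _ ↔ _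
  rw [IsLocalRing.mem_maximalIdeal, mem_nonunits_iff, isUnit_inftyRing_iff]
  exact ⟨fun h ↦ lt_of_le_of_ne a.2 h, fun h ↦ h.ne⟩

theorem mk_inftyPrime_eq_iff {a b : inftyRing F} :
    Ideal.Quotient.mk (inftyPrime F).asIdeal a = Ideal.Quotient.mk (inftyPrime F).asIdeal b ↔
      RatFunc.inftyValuation F ((a : F⟮X⟯) - b) < 1 := by
  rw [Ideal.Quotient.eq, mem_inftyPrime_iff]
  rfl

theorem inftyValuation_eq_exp {x : F⟮X⟯} (hx : x ≠ 0) :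
    RatFunc.inftyValuation F x = exp x.intDegree :=
  RatFunc.inftyValuation_of_nonzero F hx

theorem inftyValuation_C_le (c : F) : RatFunc.inftyValuation F (RatFunc.C c) ≤ 1 := by
  rcases eq_or_ne c 0 with rfl | hc
  · simp
  · exact (RatFunc.inftyValuation.C F hc).le

/-- The constants in the valuation ring of the infinite place. -/
def inftyConst : F →+* inftyRing F :=
  (RatFunc.C).codRestrict (inftyRing F) inftyValuation_C_le

theorem exists_inftyValuation_sub_C_lt (x : inftyRing F) :
    ∃ c : F, RatFunc.inftyValuation F ((x : F⟮X⟯) - RatFunc.C c) < 1 := by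
  by_cases hx1 : RatFunc.inftyValuation F x < 1
  · exact ⟨0, by simpa using hx1⟩
  have hx : RatFunc.inftyValuation F x = 1 := le_antisymm x.2 (not_lt.1 hx1)
  have hx0 : (x : F⟮X⟯) ≠ 0 := by
    intro h
    rw [h, map_zero] at hx
    exact zero_ne_one hx
  rw [inftyValuation_eq_exp hx0, ← exp_zero, exp_inj] at hx
  set p := RatFunc.num (x : F⟮X⟯)
  set q := RatFunc.denom (x : F⟮X⟯)
  have hq0 : q ≠ 0 := RatFunc.denom_ne_zero _
  have hp0 : p ≠ 0 := RatFunc.num_ne_zero hx0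
  have hpq : p.natDegree = q.natDegree := by
    rw [RatFunc.intDegree, sub_eq_zero] at hx
    exact_mod_cast hx
  have hq1 : q.leadingCoeff = 1 := RatFunc.monic_denom _
  -- Numerator and denominator have equal degree and the denominator is monic, so the value at
  -- infinity is the leading coefficient of the numerator.
  refine ⟨p.leadingCoeff, ?_⟩
  have hdeg : (p - Polynomial.C p.leadingCoeff * q).degree < p.degree := by
    refine Polynomial.degree_sub_lt_left ?_ hp0 ?_
    · rw [Polynomial.degree_C_mul (Polynomial.leadingCoeff_ne_zero.2 hp0),
        Polynomial.degree_eq_natDegree hp0, Polynomial.degree_eq_natDegree hq0, hpq]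
    · rw [Polynomial.leadingCoeff_mul, Polynomial.leadingCoeff_C, hq1, mul_one]
  set r := p - Polynomial.C p.leadingCoeff * q
  have hq0' : algebraMap F[X] F⟮X⟯ q ≠ 0 := RatFunc.algebraMap_ne_zero hq0
  have hxr : (x : F⟮X⟯) - RatFunc.C p.leadingCoeff =
      algebraMap F[X] F⟮X⟯ r / algebraMap F[X] F⟮X⟯ q := by
    rw [eq_div_iff hq0', sub_mul, map_sub, map_mul, RatFunc.algebraMap_C]
    congr 1
    conv_lhs => rw [← RatFunc.num_div_denom (x : F⟮X⟯)]
    exact div_mul_cancel₀ _ hq0'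
  rw [hxr]
  rcases eq_or_ne r 0 with hr | hr
  · simp [hr]
  · rw [map_div₀, RatFunc.inftyValuation_apply, RatFunc.inftyValuation_apply,
      RatFunc.inftyValuation.polynomial F hr, RatFunc.inftyValuation.polynomial F hq0, ← exp_sub,
      ← exp_zero, exp_lt_exp, sub_neg, ← hpq]
    exact_mod_cast Polynomial.natDegree_lt_natDegree hr hdeg

theorem bijective_mk_inftyConst :
    Function.Bijective ((Ideal.Quotient.mk (inftyPrime F).asIdeal).comp inftyConst) := by
  refine ⟨?_, fun y ↦ ?_⟩
  · have : Nontrivial (inftyRing F ⧸ (inftyPrime F).asIdeal) :=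
      Ideal.Quotient.nontrivial_iff.2 (inftyPrime F).isPrime.ne_top
    exact RingHom.injective _
  · obtain ⟨x, rfl⟩ := Ideal.Quotient.mk_surjective y
    obtain ⟨c, hc⟩ := exists_inftyValuation_sub_C_lt x
    refine ⟨c, ?_⟩
    rw [RingHom.comp_apply, mk_inftyPrime_eq_iff, Valuation.map_sub_swap]
    exact hc

theorem card_inftyRing_quotient : Nat.card (inftyRing F ⧸ (inftyPrime F).asIdeal) = Nat.card F :=
  (Nat.card_congr (Equiv.ofBijective _ bijective_mk_inftyConst)).symm

instance [Finite F] : Finite (inftyRing F ⧸ (inftyPrime F).asIdeal) :=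
  Finite.of_surjective _ bijective_mk_inftyConst.2

/-- The variable `T`, as a unit of `F(T)`. -/
def varUnit (F : Type*) [Field F] : F⟮X⟯ˣ := Units.mk0 RatFunc.X RatFunc.X_ne_zero

theorem toPrincipalIdeal_varUnit_inv :
    toPrincipalIdeal (inftyRing F) F⟮X⟯ (varUnit F)⁻¹ = primeUnit F⟮X⟯ (inftyPrime F) := by
  have hX : RatFunc.inftyValuation F (RatFunc.X)⁻¹ = exp (-1) := by
    rw [map_inv₀, RatFunc.inftyValuation.X, exp_neg]
  have hX' : exp (-1) < (1 : ℤᵐ⁰) := by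
    rw [← exp_zero, exp_lt_exp]
    norm_num
  let π : inftyRing F := ⟨(RatFunc.X)⁻¹, by
    rw [Valuation.mem_valuationSubring_iff, hX]
    exact hX'.le⟩
  have hπ : (inftyPrime F).asIdeal = Ideal.span {π} := by
    ext a
    rw [mem_inftyPrime_iff, Ideal.mem_span_singleton]
    constructor
    · intro ha
      refine ⟨⟨(a : F⟮X⟯) * RatFunc.X, ?_⟩, Subtype.ext ?_⟩
      · rw [Valuation.mem_valuationSubring_iff, map_mul, RatFunc.inftyValuation.X]
        rcases eq_or_ne (a : F⟮X⟯) 0 with h | h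
        · simp [h]
        · rw [inftyValuation_eq_exp h, ← exp_zero, exp_lt_exp] at ha
          rw [inftyValuation_eq_exp h, ← exp_add, ← exp_zero, exp_le_exp]
          omega
      · change (a : F⟮X⟯) = RatFunc.X⁻¹ * ((a : F⟮X⟯) * RatFunc.X)
        rw [mul_left_comm, inv_mul_cancel₀ RatFunc.X_ne_zero, mul_one]
    · rintro ⟨b, rfl⟩
      change RatFunc.inftyValuation F (RatFunc.X⁻¹ * (b : F⟮X⟯)) < 1
      rw [map_mul, hX]
      exact (mul_le_of_le_one_right' b.2).trans_lt hX'
  rw [toPrincipalIdeal_eq_iff]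
  change _ = (((inftyPrime F).asIdeal : Ideal (inftyRing F)) :
    FractionalIdeal (inftyRing F)⁰ F⟮X⟯)
  rw [hπ, FractionalIdeal.coeIdeal_span_singleton]
  rfl

/-- 1/T is a uniformizer, and x · T^(-deg x) is a unit at infinity. -/
theorem ordAt_inftyPrime (x : F⟮X⟯ˣ) :
    ordAt (inftyPrime F) (toPrincipalIdeal (inftyRing F) F⟮X⟯ x) = -(x : F⟮X⟯).intDegree := by
  classical
  have h1 : toPrincipalIdeal (inftyRing F) F⟮X⟯ (x * (varUnit F)⁻¹ ^ (x : F⟮X⟯).intDegree) = 1 := by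
    rw [toPrincipalIdeal_eq_one_iff]
    have h2 : RatFunc.inftyValuation F
        ((x * (varUnit F)⁻¹ ^ (x : F⟮X⟯).intDegree : F⟮X⟯ˣ) : F⟮X⟯) = 1 := by
      rw [Units.val_mul, map_mul, inftyValuation_eq_exp x.ne_zero, inv_zpow', Units.val_zpow_eq_zpow_val]
      change _ * RatFunc.inftyValuation F (RatFunc.X ^ _) = 1
      rw [RatFunc.inftyValuation.X_zpow, ← exp_add, add_neg_cancel, exp_zero]
    exact ⟨(isUnit_inftyRing_iff (a := ⟨_, h2.le⟩).2 h2).unit, rfl⟩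
  rw [map_mul, map_zpow, toPrincipalIdeal_varUnit_inv] at h1
  rw [eq_inv_of_mul_eq_one_left h1, ordAt_inv, ordAt_zpow, ordAt_primeUnit, if_pos rfl, mul_one]

variable (F) in
/-- The elements of `F(T)ˣ` that are `n`-th powers in the completion at infinity. -/
def completionPowers (n : ℕ) : Subgroup F⟮X⟯ˣ :=
  (powMonoidHom n : (RatFunc.CompletionAtInfty F)ˣ →* (RatFunc.CompletionAtInfty F)ˣ).range.comap
    (Units.map (algebraMap F⟮X⟯ (RatFunc.CompletionAtInfty F)).toMonoidHom)

theorem mem_completionPowers_iff {n : ℕ} {x : F⟮X⟯ˣ} :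
    x ∈ completionPowers F n ↔ ∃ y : (RatFunc.CompletionAtInfty F)ˣ,
      (y : RatFunc.CompletionAtInfty F) ^ n = algebraMap F⟮X⟯ (RatFunc.CompletionAtInfty F) x := by
  simp [completionPowers, Subgroup.mem_comap, MonoidHom.mem_range, Units.ext_iff]

theorem pow_mem_completionPowers {n : ℕ} (x : F⟮X⟯ˣ) : x ^ n ∈ completionPowers F n :=
  mem_completionPowers_iff.2 ⟨Units.map (algebraMap F⟮X⟯ _).toMonoidHom x, by simp⟩

theorem dvd_intDegree_of_mem_completionPowers {n : ℕ} {x : F⟮X⟯ˣ} (hx : x ∈ completionPowers F n) :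
    (n : ℤ) ∣ (x : F⟮X⟯).intDegree := by
  obtain ⟨y, hy⟩ := mem_completionPowers_iff.1 hx
  have h := congrArg (Valued.v : Valuation _ ℤᵐ⁰) hy
  rw [valuation_algebraMap_completion, inftyValuation_eq_exp x.ne_zero, map_pow] at h
  have hy0 : (Valued.v : Valuation _ ℤᵐ⁰) (y : RatFunc.CompletionAtInfty F) ≠ 0 :=
    (Valuation.ne_zero_iff _).2 y.ne_zero
  rw [← exp_log hy0, ← exp_nsmul, exp_inj] at h
  exact ⟨_, by rw [← h, nsmul_eq_mul]⟩

/-- A root in the completion is approximated by an element of F(T), which gives the residue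
condition. Conversely, dividing by the n-th power of a constant leaves a one-unit, which has an n-th
root because n divides q - 1. -/
theorem unit_mem_completionPowers_iff [Finite F] {n : ℕ} (hn : n ∣ Nat.card F - 1)
    (a : (inftyRing F)ˣ) :
    Units.map (algebraMap (inftyRing F) F⟮X⟯).toMonoidHom a ∈ completionPowers F n ↔
      ∃ c : inftyRing F ⧸ (inftyPrime F).asIdeal,
        Ideal.Quotient.mk (inftyPrime F).asIdeal a = c ^ n := by
  have ha : RatFunc.inftyValuation F ((a : inftyRing F) : F⟮X⟯) = 1 :=
    isUnit_inftyRing_iff.1 a.isUnit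
  have hn0 : n ≠ 0 := by
    rintro rfl
    have := Finite.one_lt_card (α := F)
    rw [zero_dvd_iff] at hn
    omega
  rw [mem_completionPowers_iff]
  constructor
  · rintro ⟨y, hy⟩
    change _ = algebraMap F⟮X⟯ _ ((a : inftyRing F) : F⟮X⟯) at hy
    have h := congrArg (Valued.v : Valuation _ ℤᵐ⁰) hy
    rw [valuation_algebraMap_completion, ha, map_pow, pow_eq_one_iff_of_nonneg zero_le hn0] at h
    obtain ⟨z, hz⟩ := exists_valuation_sub_lt (y : RatFunc.CompletionAtInfty F)
    have hz1 : RatFunc.inftyValuation F z ≤ 1 := by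
      rw [← valuation_algebraMap_completion]
      have := Valuation.map_sub (Valued.v : Valuation _ ℤᵐ⁰) (y : RatFunc.CompletionAtInfty F)
        (y - algebraMap F⟮X⟯ _ z)
      rw [sub_sub_cancel] at this
      exact this.trans (max_le h.le hz.le)
    refine ⟨Ideal.Quotient.mk _ ⟨z, hz1⟩, ?_⟩
    rw [← map_pow, mk_inftyPrime_eq_iff]
    change RatFunc.inftyValuation F (((a : inftyRing F) : F⟮X⟯) - z ^ n) < 1
    rw [← valuation_algebraMap_completion, map_sub, ← hy, map_pow, ← geom_sum₂_mul, map_mul]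
    refine (mul_le_of_le_one_left' (Valuation.map_sum_le _ fun i _ ↦ ?_)).trans_lt hz
    rw [map_mul, map_pow, map_pow, h, one_pow, one_mul, valuation_algebraMap_completion]
    exact pow_le_one' hz1 _
  · rintro ⟨c, hc⟩
    obtain ⟨c, rfl⟩ := bijective_mk_inftyConst.2 c
    rw [RingHom.comp_apply, ← map_pow, mk_inftyPrime_eq_iff] at hc
    have hc0 : c ≠ 0 := by
      rintro rfl
      rw [map_zero, zero_pow hn0] at hc
      simp [ha] at hc
    have hCc : RatFunc.C c ≠ 0 := by simpa using hc0
    obtain ⟨p, hp⟩ := CharP.exists F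
    have hprime : p.Prime := (CharP.char_is_prime_or_zero F p).resolve_right
      (CharP.char_ne_zero_of_finite F p)
    have : Fact p.Prime := ⟨hprime⟩
    have := Fintype.ofFinite F
    obtain ⟨m, -, hm⟩ := FiniteField.card F p
    have : CharP F⟮X⟯ p := charP_of_injective_ringHom (RatFunc.C (K := F)).injective p
    have : CharP (RatFunc.CompletionAtInfty F) p :=
      charP_of_injective_ringHom (algebraMap F⟮X⟯ (RatFunc.CompletionAtInfty F)).injective p
    obtain ⟨s, hs⟩ := exists_pow_eq_of_valuation_sub_one_lt p (m := m) (n := n) m.ne_zero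
      (by rwa [← hm, ← Nat.card_eq_fintype_card])
      (u := algebraMap F⟮X⟯ (RatFunc.CompletionAtInfty F)
        ((a : inftyRing F) * (RatFunc.C c ^ n)⁻¹)) (by
        rw [← map_one (algebraMap F⟮X⟯ (RatFunc.CompletionAtInfty F)), ← map_sub,
          valuation_algebraMap_completion]
        have : ((a : inftyRing F) : F⟮X⟯) * (RatFunc.C c ^ n)⁻¹ - 1 =
            ((a : inftyRing F) - RatFunc.C c ^ n) * (RatFunc.C c ^ n)⁻¹ := by
          field_simp
        rw [this, map_mul, map_inv₀, map_pow, RatFunc.inftyValuation.C F hc0, one_pow, inv_one,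
          mul_one]
        exact hc)
    have hy : (s * algebraMap F⟮X⟯ _ (RatFunc.C c)) ^ n =
        algebraMap F⟮X⟯ (RatFunc.CompletionAtInfty F) (a : inftyRing F) := by
      rw [mul_pow, hs, ← map_pow (algebraMap F⟮X⟯ _) (RatFunc.C c), ← map_mul, inv_mul_cancel_right₀ (pow_ne_zero _ hCc)]
    have hy0 : s * algebraMap F⟮X⟯ (RatFunc.CompletionAtInfty F) (RatFunc.C c) ≠ 0 := by
      intro h
      rw [h, zero_pow hn0, eq_comm, map_eq_zero] at hy
      rw [hy, map_zero] at ha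
      exact zero_ne_one ha
    exact ⟨Units.mk0 _ hy0, hy⟩

end InftyRing

/-! ### The semi-local ring above infinity and [K^* : K^+]. -/

section InftyIntegers

open IsDedekindDomain

variable (F K : Type*) [Field F] [DecidableEq F⟮X⟯] [Field K] [Algebra F⟮X⟯ K]

/-- The integral closure in `K` of the valuation ring of the infinite place. -/
abbrev inftyIntegers : Subalgebra (inftyRing F) K := integralClosure (inftyRing F) K

variable [FiniteDimensional F⟮X⟯ K]

instance : IsFractionRing (inftyIntegers F K) K :=
  integralClosure.isFractionRing_of_finite_extension F⟮X⟯ K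

variable [IsGalois F⟮X⟯ K]

instance : IsDedekindDomain (inftyIntegers F K) := integralClosure.isDedekindDomain _ F⟮X⟯ _

instance : Module.Finite (inftyRing F) (inftyIntegers F K) :=
  IsIntegralClosure.finite _ F⟮X⟯ K _

instance : IsGaloisGroup Gal(K/F⟮X⟯) (inftyRing F) (inftyIntegers F K) :=
  IsGaloisGroup.of_isFractionRing _ _ _ F⟮X⟯ K

theorem baseUnits_normUnits_eq (k K : Type*) [Field k] [Field K] [Algebra k K]
    [FiniteDimensional k K] [IsGalois k K] (x : Kˣ) :
    baseUnits k K (normUnits k K x) = actionNorm (unitsAction K Gal(K/k)) x := by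
  ext
  rw [actionNorm_apply, Units.coe_prod]
  exact Algebra.norm_eq_prod_automorphisms k (x : K)

/-- The degree of the infinite place in `K/F(T)`: the product of the ramification index and the
residue degree. -/
def inftyDegree : ℕ :=
  ramIn (inftyIntegers F K) (inftyPrime F) * inertIn (inftyIntegers F K) (inftyPrime F)

theorem inftyDegree_ne_zero : inftyDegree F K ≠ 0 :=
  mul_ne_zero (ramIn_ne_zero Gal(K/F⟮X⟯) _) (inertIn_ne_zero Gal(K/F⟮X⟯) _)

theorem index_comap_completionPowers [Finite F] {g : Gal(K/F⟮X⟯)}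
    (hg : ∀ σ, σ ∈ Subgroup.zpowers g) {n : ℕ} (hdeg : Module.finrank F⟮X⟯ K = n)
    (hn : n ∣ Nat.card F - 1) :
    ((completionPowers F n).comap (normUnits F⟮X⟯ K)).index * inftyDegree F K = n * n := by
  have hcard : Nat.card Gal(K/F⟮X⟯) = n := by rw [IsGalois.card_aut_eq_finrank, hdeg]
  have h := index_comap_normUnits (R := inftyIntegers F K) (v₀ := inftyPrime F) eq_inftyPrime hg
    (by rwa [hcard, card_inftyRing_quotient]) (baseUnits_normUnits_eq F⟮X⟯ K)
    (V := completionPowers F n) (by rw [hcard]; exact pow_mem_completionPowers)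
    (by
      intro x hx
      rw [hcard, ordAt_inftyPrime, dvd_neg]
      exact dvd_intDegree_of_mem_completionPowers hx)
    (by rw [hcard]; exact unit_mem_completionPowers_iff hn)
  rwa [hcard] at h

end InftyIntegers

/-! ### Adjoining an invariant element of infinite order. -/

section SupZpowers

variable {L : Type*} [CommGroup L] {D N : L →* L} {δ : L →* Multiplicative ℤ} {t : L} {n : ℕ}

theorem relIndex_zpowers_pow {s : Multiplicative ℤ} (hs : s ≠ 1) :
    (Subgroup.zpowers (s ^ n)).relIndex (Subgroup.zpowers s) = n := by
  have key : ∀ a : ℤ, a ≠ 0 →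
      (AddSubgroup.zmultiples (n • a)).relIndex (AddSubgroup.zmultiples a) = n := by
    intro a ha
    have h1 : AddSubgroup.zmultiples a = (⊤ : AddSubgroup ℤ).map (AddMonoidHom.mulRight a) := by
      ext x
      simp [AddSubgroup.mem_zmultiples_iff]
    have h2 : AddSubgroup.zmultiples (n • a) =
        (AddSubgroup.zmultiples (n : ℤ)).map (AddMonoidHom.mulRight a) := by
      rw [AddMonoidHom.map_zmultiples]
      simp
    rw [h1, h2, AddSubgroup.relIndex_map_map_of_injective _ _ (mul_left_injective₀ ha),
      AddSubgroup.relIndex_top_right, Int.index_zmultiples, Int.natAbs_natCast]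
  exact key s.toAdd hs

/-- `δ` vanishes on `M` and δ(t) has infinite order, so the product of `M` and t^ℤ is direct. -/
theorem sup_zpowers_inf_ker {M : Subgroup L} (hM : M ≤ δ.ker) (ht : δ t ≠ 1) :
    (M ⊔ Subgroup.zpowers t) ⊓ δ.ker = M := by
  refine le_antisymm ?_ (le_inf le_sup_left hM)
  rintro x ⟨hx, hxδ⟩
  obtain ⟨y, hy, z, ⟨j, rfl⟩, rfl⟩ := Subgroup.mem_sup.1 hx
  have h : δ t ^ j = 1 := by
    have : δ (y * t ^ j) = 1 := hxδ
    rwa [map_mul, MonoidHom.mem_ker.1 (hM hy), one_mul, map_zpow] at this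
  have hj : j = 0 := by
    have h' := congrArg Multiplicative.toAdd h
    rw [toAdd_zpow, toAdd_one, smul_eq_zero] at h'
    exact h'.resolve_right fun h0 ↦ ht h0
  simpa [hj] using hy

variable (hDt : D t = 1) (hδt : δ t ≠ 1)
  (hn : n ≠ 0) {M : Subgroup L} (hM : M ≤ δ.ker)

include hDt hδt hn hM

/-- The element t is killed by `D`, and elements of norm 1 have trivial `δ`, so t^ℤ adds neither
coboundaries nor cocycles. -/
theorem tateIndex_sup_zpowers_left (hδN : ∀ x, δ (N x) = δ x ^ n) :
    tateIndex D N (M ⊔ Subgroup.zpowers t) = tateIndex D N M := by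
  have h1 : (M ⊔ Subgroup.zpowers t).map D = M.map D := by
    rw [Subgroup.map_sup, MonoidHom.map_zpowers, hDt, Subgroup.zpowers_one_eq_bot, sup_bot_eq]
  have h2 : (M ⊔ Subgroup.zpowers t) ⊓ N.ker = M ⊓ N.ker := by
    have h3 : N.ker ≤ δ.ker := fun x hx ↦ by
      have h := hδN x
      rw [MonoidHom.mem_ker.1 hx, map_one, eq_comm] at h
      have h' := congrArg Multiplicative.toAdd h
      rw [toAdd_pow, toAdd_one, smul_eq_zero] at h'
      exact h'.resolve_left hn
    conv_rhs => rw [← sup_zpowers_inf_ker hM hδt, inf_assoc, inf_eq_right.2 h3]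
  rw [tateIndex, tateIndex, h1, h2]

/-- All of t^ℤ is invariant and `N` acts on it as the n-th power, which contributes ℤ/n. -/
theorem tateIndex_sup_zpowers_right (hNt : N t = t ^ n) (hDN : ∀ x, D (N x) = 1) (hNM : M.map N ≤ M) :
    tateIndex N D (M ⊔ Subgroup.zpowers t) = n * tateIndex N D M := by
  have h1 : (M ⊔ Subgroup.zpowers t).map N = M.map N ⊔ Subgroup.zpowers (t ^ n) := by
    rw [Subgroup.map_sup, MonoidHom.map_zpowers, hNt]
  have h2 : (M ⊔ Subgroup.zpowers t) ⊓ D.ker = (M ⊓ D.ker) ⊔ Subgroup.zpowers t := by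
    have : Subgroup.zpowers t ≤ D.ker := by rwa [Subgroup.zpowers_le]
    rw [inf_comm, inf_comm M, inf_sup_assoc_of_le _ this]
  have hδn : δ (t ^ n) ≠ 1 := by
    rw [map_pow]
    intro h
    have h' := congrArg Multiplicative.toAdd h
    rw [toAdd_pow, toAdd_one, smul_eq_zero] at h'
    exact hδt (h'.resolve_left hn)
  have hMD : M.map N ≤ M ⊓ D.ker := le_inf hNM (by rintro _ ⟨x, -, rfl⟩; exact hDN x)
  have hle : M.map N ⊔ Subgroup.zpowers (t ^ n) ≤ (M ⊓ D.ker) ⊔ Subgroup.zpowers t :=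
    sup_le_sup hMD (by rw [Subgroup.zpowers_le]; exact Subgroup.npow_mem_zpowers t n)
  have hmap : ∀ H : Subgroup L, H ≤ δ.ker → ∀ s, (H ⊔ Subgroup.zpowers s).map δ =
      Subgroup.zpowers (δ s) := by
    intro H hH s
    rw [Subgroup.map_sup, MonoidHom.map_zpowers, (Subgroup.map_eq_bot_iff H).2 hH, bot_sup_eq]
  have hMN' : M.map N ≤ δ.ker := hNM.trans hM
  have hMD' : M ⊓ D.ker ≤ δ.ker := inf_le_left.trans hM
  have key := relIndex_map_mul_relIndex_inf_ker δ hle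
  rw [sup_zpowers_inf_ker hMN' hδn, sup_zpowers_inf_ker hMD' hδt, hmap _ hMN', hmap _ hMD'] at key
  rw [tateIndex, tateIndex, h1, h2, ← key, map_pow, relIndex_zpowers_pow hδt]

end SupZpowers

/-! ### Counting residues modulo an element above infinity. -/

section CardQuotient

open IsDedekindDomain

/-- Multiplication by x identifies R/(y) with (x)/(xy). -/
theorem card_quotient_span_mul {R : Type*} [CommRing R] [IsDomain R] {x : R} (hx : x ≠ 0) (y : R) :
    Nat.card (R ⧸ Ideal.span {x * y}) = Nat.card (R ⧸ Ideal.span {x}) *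
      Nat.card (R ⧸ Ideal.span {y}) := by
  let f : R →+ R := AddMonoidHom.mulLeft x
  have hf : Function.Injective f := fun a b h ↦ mul_left_cancel₀ hx h
  have h1 : ∀ z : R, (Ideal.span {x * z}).toAddSubgroup = (Ideal.span {z}).toAddSubgroup.map f := by
    intro z
    ext a
    simp only [Submodule.mem_toAddSubgroup, Ideal.mem_span_singleton, AddSubgroup.mem_map]
    constructor
    · rintro ⟨c, rfl⟩
      exact ⟨z * c, dvd_mul_right _ _, (mul_assoc _ _ _).symm⟩
    · rintro ⟨_, ⟨c, rfl⟩, rfl⟩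
      exact ⟨c, (mul_assoc _ _ _).symm⟩
  have h2 := h1 1
  rw [mul_one, Ideal.span_singleton_one] at h2
  change (Ideal.span {x * y}).toAddSubgroup.index = (Ideal.span {x}).toAddSubgroup.index *
    (Ideal.span {y}).toAddSubgroup.index
  have hle : (Ideal.span {x * y}).toAddSubgroup ≤ (Ideal.span {x}).toAddSubgroup :=
    fun a ha ↦ Ideal.span_singleton_le_span_singleton.2 (dvd_mul_right x y) ha
  rw [← AddSubgroup.relIndex_mul_index hle, h1 y, mul_comm]
  congr 1
  rw [h2, AddSubgroup.relIndex_map_map_of_injective _ _ hf]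
  exact AddSubgroup.relIndex_top_right _

variable {A k R K G : Type*} [CommRing A] [IsDedekindDomain A] [CommRing R] [IsDedekindDomain R]
  [Field K] [Algebra R K] [IsFractionRing R K] [Algebra A R] [Module.Finite A R]
  [Module.IsTorsionFree A R] [Group G] [Fintype G] [MulSemiringAction G R] [IsGaloisGroup G A R]
  [IsPrincipalIdealRing R] {v₀ : HeightOneSpectrum A} (hv₀ : ∀ v : HeightOneSpectrum A, v = v₀)
  [Finite (A ⧸ v₀.asIdeal)]

variable (G) in
include G in
theorem card_quotient_prime (w : HeightOneSpectrum R) (hw : w.under A = v₀) :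
    Nat.card (R ⧸ w.asIdeal) = Nat.card (A ⧸ v₀.asIdeal) ^ inertIn R v₀ := by
  have : w.asIdeal.LiesOver v₀.asIdeal := ⟨by rw [← hw]; rfl⟩
  rw [inertIn, Ideal.inertiaDegIn_eq_inertiaDeg v₀.asIdeal w.asIdeal G,
    ← Ideal.inertiaDeg'_eq_inertiaDeg v₀.asIdeal w.asIdeal, Ideal.inertiaDeg'_algebraMap]
  let := Ideal.Quotient.field v₀.asIdeal
  exact Module.natCard_eq_pow_finrank

variable (G) in
include hv₀ G in
-- By induction on prime factors: each prime multiplies the count by the size of its residue field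
-- and raises the total order by 1. The count feeds the pigeonhole argument.
theorem exists_card_quotient_span_eq [Fintype (HeightOneSpectrum R)] (x : Kˣ) (z : R)
    (hz : algebraMap R K z = x) : ∃ m : ℕ,
      Nat.card (R ⧸ Ideal.span {z}) = Nat.card (A ⧸ v₀.asIdeal) ^ m ∧
      inertIn R v₀ * ∑ w : HeightOneSpectrum R, ordAt w (toPrincipalIdeal R K x) = m := by
  classical
  induction z using UniqueFactorizationMonoid.induction_on_prime generalizing x with
  | h₁ =>
    rw [map_zero] at hz
    exact absurd hz.symm x.ne_zero
  | h₂ z hzu =>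
    have h1 : toPrincipalIdeal R K x = 1 := (toPrincipalIdeal_eq_one_iff x).2 ⟨hzu.unit, hz⟩
    refine ⟨0, ?_, ?_⟩
    · rw [Ideal.span_singleton_eq_top.2 hzu, pow_zero]
      exact Nat.card_unique
    · simp [h1]
  | h₃ a p ha hp ih =>
    have hp0 := hp.ne_zero
    let u : Kˣ := Units.mk0 (algebraMap R K p) (by simpa using hp0)
    let w : HeightOneSpectrum R := ⟨Ideal.span {p}, (Ideal.span_singleton_prime hp0).2 hp,
      by simpa using hp0⟩
    have hu : toPrincipalIdeal R K u = primeUnit K w := by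
      rw [toPrincipalIdeal_eq_iff]
      exact (FractionalIdeal.coeIdeal_span_singleton p).symm
    obtain ⟨m, hm1, hm2⟩ := ih (x * u⁻¹) (by
      rw [Units.val_mul, ← hz, map_mul, Units.val_inv_eq_inv_val]
      change _ = _ * _ * (algebraMap R K p)⁻¹
      rw [mul_comm (algebraMap R K p), mul_inv_cancel_right₀ (by simpa using hp0)])
    refine ⟨inertIn R v₀ + m, ?_, ?_⟩
    · rw [card_quotient_span_mul hp0, hm1, pow_add]
      congr 1
      exact card_quotient_prime G w (hv₀ _)
    · push_cast
      rw [← hm2, map_mul, map_inv, hu]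
      simp only [ordAt_mul, ordAt_inv, ordAt_primeUnit, Finset.sum_add_distrib, Finset.sum_neg_distrib,
        Finset.sum_ite_eq, Finset.mem_univ, if_true]
      ring

end CardQuotient

/-! ### The degree of the norm. -/

section NormDegree

variable (F K : Type*) [Field F] [Field K] [Algebra F⟮X⟯ K]

/-- The degree of the norm to `F(T)`. -/
def normDegree : Kˣ →* Multiplicative ℤ where
  toFun x := Multiplicative.ofAdd (normUnits F⟮X⟯ K x : F⟮X⟯).intDegree
  map_one' := by simp
  map_mul' x y := by
    rw [map_mul, Units.val_mul, RatFunc.intDegree_mul (Units.ne_zero _) (Units.ne_zero _), ofAdd_add]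

/-- The variable `T`, as a unit of `K`. -/
def varUnitIn : Kˣ := baseUnits F⟮X⟯ K (varUnit F)

variable {K}

theorem toAdd_normDegree (x : Kˣ) :
    (normDegree F K x).toAdd = (normUnits F⟮X⟯ K x : F⟮X⟯).intDegree := rfl

theorem normUnits_baseUnits (k K : Type*) [Field k] [Field K] [Algebra k K] (y : kˣ) :
    normUnits k K (baseUnits k K y) = y ^ Module.finrank k K :=
  Units.ext (Algebra.norm_algebraMap (y : k))

theorem intDegree_pow (x : F⟮X⟯ˣ) (m : ℕ) : ((x ^ m : F⟮X⟯ˣ) : F⟮X⟯).intDegree = m * (x : F⟮X⟯).intDegree := by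
  induction m with
  | zero => simp
  | succ m ih =>
    rw [pow_succ, Units.val_mul, RatFunc.intDegree_mul (Units.ne_zero _) (Units.ne_zero _), ih]
    push_cast
    ring

variable (K) in
theorem toAdd_normDegree_varUnitIn :
    (normDegree F K (varUnitIn F K)).toAdd = Module.finrank F⟮X⟯ K := by
  rw [toAdd_normDegree, varUnitIn, normUnits_baseUnits, intDegree_pow]
  change _ * (RatFunc.X : F⟮X⟯).intDegree = _
  rw [RatFunc.intDegree_X, mul_one]

end NormDegree

/-! ### Finiteness of divisors. -/

section FiniteIdeals

open IsDedekindDomain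

/-- The non-zero divisors of a fixed non-zero element generate finitely many ideals. -/
theorem finite_toPrincipalIdeal_of_dvd {R K : Type*} [CommRing R] [IsDedekindDomain R] [Field K]
    [Algebra R K] [IsFractionRing R K] {a : R} (ha : a ≠ 0) :
    {I : (FractionalIdeal R⁰ K)ˣ | ∃ y : Kˣ, toPrincipalIdeal R K y = I ∧
      ∃ b : R, b ∣ a ∧ algebraMap R K b = y}.Finite := by
  classical
  have := UniqueFactorizationMonoid.fintypeSubtypeDvd (Ideal.span {a}) (by simpa using ha)
  refine Set.Finite.of_finite_image (f := Units.val) ?_ Units.val_injective.injOn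
  refine (Set.finite_range fun J : {J : Ideal R // J ∣ Ideal.span {a}} ↦
    ((J : Ideal R) : FractionalIdeal R⁰ K)).subset ?_
  rintro _ ⟨_, ⟨y, rfl, b, hb, hy⟩, rfl⟩
  refine ⟨⟨Ideal.span {b}, ?_⟩, ?_⟩
  · rw [Ideal.dvd_span_singleton, Ideal.mem_span_singleton]
    exact hb
  · rw [coe_toPrincipalIdeal, ← hy]
    exact FractionalIdeal.coeIdeal_span_singleton b

end FiniteIdeals

/-! ### Galois structure of O_K. -/

section RingOfIntegers

variable (F K : Type*) [Field F] [Field K] [Algebra F⟮X⟯ K] [Algebra F[X] K]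
  [IsScalarTower F[X] F⟮X⟯ K]

instance : MulSemiringAction Gal(K/F⟮X⟯) (FunctionField.ringOfIntegers F K) :=
  inferInstanceAs (MulSemiringAction Gal(K/F⟮X⟯) (integralClosure F[X] K))

instance : SMulDistribClass Gal(K/F⟮X⟯) (FunctionField.ringOfIntegers F K) K :=
  inferInstanceAs (SMulDistribClass Gal(K/F⟮X⟯) (integralClosure F[X] K) K)

instance : Module.IsTorsionFree F[X] (FunctionField.ringOfIntegers F K) :=
  Module.isTorsionFree_iff_algebraMap_injective.2
    (FunctionField.ringOfIntegers.algebraMap_injective F K)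

variable [FunctionField F K] [IsGalois F⟮X⟯ K]

instance : Module.Finite F[X] (FunctionField.ringOfIntegers F K) :=
  IsIntegralClosure.finite _ F⟮X⟯ K _

instance : IsGaloisGroup Gal(K/F⟮X⟯) F[X] (FunctionField.ringOfIntegers F K) :=
  IsGaloisGroup.of_isFractionRing _ _ _ F⟮X⟯ K

end RingOfIntegers

/-! ### A weak Riemann inequality by pigeonhole. -/

section Pigeonhole

open IsDedekindDomain WithZero

variable (F : Type*) {K : Type*} [Field F] [DecidableEq F⟮X⟯] [Field K] [Algebra F⟮X⟯ K]

theorem isIntegral_algebraMap_of_inftyValuation_le {a : F⟮X⟯} (ha : RatFunc.inftyValuation F a ≤ 1) :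
    IsIntegral (inftyRing F) (algebraMap F⟮X⟯ K a) :=
  isIntegral_algebraMap (R := inftyRing F) (A := K) (x := ⟨a, ha⟩)

theorem inftyValuation_mul_X_zpow_le {a : F⟮X⟯} {m : ℤ} (h : a = 0 ∨ a.intDegree ≤ m) :
    RatFunc.inftyValuation F (a * RatFunc.X ^ (-m)) ≤ 1 := by
  rcases eq_or_ne a 0 with rfl | ha
  · simp
  · rw [map_mul, RatFunc.inftyValuation.X_zpow, inftyValuation_eq_exp ha, ← exp_add, ← exp_zero,
      exp_le_exp]
    have := h.resolve_left ha
    omega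

theorem exists_isIntegral_mul_zpow [FiniteDimensional F⟮X⟯ K] (x : K) :
    ∃ m₀ : ℕ, ∀ m : ℤ, m₀ ≤ m →
      IsIntegral (inftyRing F) (x * algebraMap F⟮X⟯ K (RatFunc.X ^ (-m))) := by
  have hx : IsAlgebraic (inftyRing F) x :=
    (IsFractionRing.isAlgebraic_iff (inftyRing F) F⟮X⟯ K).2 (Algebra.IsAlgebraic.isAlgebraic x)
  obtain ⟨a, ha0, ha⟩ := hx.exists_integral_multiple
  have ha0' : (a : F⟮X⟯) ≠ 0 := by simpa using ha0
  refine ⟨(-(a : F⟮X⟯).intDegree).toNat, fun m hm ↦ ?_⟩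
  have h1 : RatFunc.inftyValuation F ((a : F⟮X⟯)⁻¹ * RatFunc.X ^ (-m)) ≤ 1 := by
    refine inftyValuation_mul_X_zpow_le F (Or.inr ?_)
    rw [RatFunc.intDegree_inv]
    omega
  have h2 : x * algebraMap F⟮X⟯ K (RatFunc.X ^ (-m)) =
      algebraMap F⟮X⟯ K ((a : F⟮X⟯)⁻¹ * RatFunc.X ^ (-m)) * (a • x) := by
    have : a • x = algebraMap F⟮X⟯ K a * x := Algebra.smul_def a x
    rw [this, map_mul, map_inv₀]
    have : algebraMap F⟮X⟯ K a ≠ 0 := by simpa using ha0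
    field_simp
  rw [h2]
  exact (isIntegral_algebraMap_of_inftyValuation_le F h1).mul ha

variable (K) [FunctionField F K] [IsGalois F⟮X⟯ K] [Algebra F[X] K] [IsScalarTower F[X] F⟮X⟯ K]

/-- A weak form of the Riemann inequality: an element of large degree is, up to an element integral
at infinity, integral at all finite places. -/
theorem exists_isIntegral_of_le_normDegree [Finite F] : ∃ C : ℕ, ∀ x : Kˣ,
    C ≤ (normDegree F K x).toAdd → ∃ y z : Kˣ, IsIntegral F[X] (y : K) ∧
      IsIntegral (inftyRing F) (z : K) ∧ y = x * z := by
  classical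
  have := finite_heightOneSpectrum_of_unique (inftyIntegers F K) Gal(K/F⟮X⟯)
    (eq_inftyPrime (F := F))
  have := Fintype.ofFinite (HeightOneSpectrum (inftyIntegers F K))
  have := isPrincipalIdealRing_of_unique (inftyIntegers F K) Gal(K/F⟮X⟯) (eq_inftyPrime (F := F))
  obtain ⟨s, β, hβ⟩ := FiniteDimensional.exists_is_basis_integral F[X] F⟮X⟯ K
  have hs : Module.finrank F⟮X⟯ K = Fintype.card s := Module.finrank_eq_card_basis β
  set n := Module.finrank F⟮X⟯ K
  have hn : 0 < n := Module.finrank_pos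
  choose c hc using fun i ↦ exists_isIntegral_mul_zpow F (β i)
  -- Only an upper bound for all `c i` is needed, so that every β_i · T^(-c₀) is integral at
  -- infinity.
  set c₀ := ∑ i, c i
  refine ⟨n * c₀, fun x hx ↦ ?_⟩
  obtain ⟨m, hm⟩ := exists_isIntegral_mul_zpow F (x : K)
  let r : K := x * algebraMap F⟮X⟯ K (RatFunc.X ^ (-((m + c₀ : ℕ) : ℤ)))
  have hr : IsIntegral (inftyRing F) r := hm _ (by push_cast; omega)
  -- Coefficient vectors of degree at most m: there are q^(n(m+1)) of them, and `θ` maps them to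
  -- elements integral over F[T].
  let D := s → Polynomial.degreeLT F (m + 1)
  let θ : D → K := fun a ↦ ∑ i, algebraMap F⟮X⟯ K (algebraMap F[X] F⟮X⟯ (a i)) * β i
  have hθ : ∀ a, IsIntegral (inftyRing F)
      (θ a * algebraMap F⟮X⟯ K (RatFunc.X ^ (-((m + c₀ : ℕ) : ℤ)))) := by
    intro a
    rw [Finset.sum_mul]
    refine IsIntegral.sum _ fun i _ ↦ ?_
    have h1 : algebraMap F[X] F⟮X⟯ (a i) = 0 ∨ (algebraMap F[X] F⟮X⟯ (a i)).intDegree ≤ m := by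
      rcases eq_or_ne (a i : F[X]) 0 with h | h
      · exact Or.inl (by rw [h, map_zero])
      · refine Or.inr ?_
        rw [RatFunc.intDegree_polynomial]
        have := Polynomial.mem_degreeLT.1 (a i).2
        rw [Polynomial.degree_eq_natDegree h] at this
        exact_mod_cast Nat.lt_succ_iff.1 (by exact_mod_cast this)
    have h2 : algebraMap F⟮X⟯ K (algebraMap F[X] F⟮X⟯ (a i)) * β i *
        algebraMap F⟮X⟯ K (RatFunc.X ^ (-((m + c₀ : ℕ) : ℤ))) =
        algebraMap F⟮X⟯ K (algebraMap F[X] F⟮X⟯ (a i) * RatFunc.X ^ (-(m : ℤ))) *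
          (β i * algebraMap F⟮X⟯ K (RatFunc.X ^ (-(c₀ : ℤ)))) := by
      rw [Nat.cast_add, neg_add, zpow_add₀ RatFunc.X_ne_zero, map_mul, map_mul]
      ring
    rw [h2]
    refine (isIntegral_algebraMap_of_inftyValuation_le F
      (inftyValuation_mul_X_zpow_le F h1)).mul (hc i _ ?_)
    exact_mod_cast Finset.single_le_sum (f := c) (fun _ _ ↦ Nat.zero_le _) (Finset.mem_univ i)
  let g : D → inftyIntegers F K := fun a ↦ ⟨_, hθ a⟩
  let u : Kˣ := x * varUnitIn F K ^ (-((m + c₀ : ℕ) : ℤ))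
  have hu : algebraMap (inftyIntegers F K) K ⟨r, hr⟩ = u := by
    change r = _
    rw [Units.val_mul, Units.val_zpow_eq_zpow_val]
    change _ = (x : K) * (algebraMap F⟮X⟯ K RatFunc.X) ^ _
    rw [← map_zpow₀]
  obtain ⟨M, hM1, hM2⟩ := exists_card_quotient_span_eq Gal(K/F⟮X⟯) (eq_inftyPrime (F := F)) u _ hu
  -- Here M = n(m + c₀) - deg N(x), and deg N(x) ≥ n · c₀ by hypothesis.
  have hM : M ≤ n * m := by
    have h := ordAt_normUnits (R := inftyIntegers F K) (G := Gal(K/F⟮X⟯)) (eq_inftyPrime (F := F))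
      (baseUnits_normUnits_eq F⟮X⟯ K) u
    rw [hM2, ordAt_inftyPrime, ← toAdd_normDegree, map_mul, map_zpow, toAdd_mul, toAdd_zpow,
      toAdd_normDegree_varUnitIn, smul_eq_mul] at h
    push_cast at h
    push_cast at hx
    have h' : (M : ℤ) ≤ n * m := by
      change -(_ + -((m : ℤ) + c₀) * n) = _ at h
      linarith
    exact_mod_cast h'
  -- There are at most q^(nm) residues modulo r, fewer than the q^(n(m+1)) vectors. Two vectors
  -- agree modulo r, and their difference yields y = xz.
  have hnot : ¬ Function.Injective fun a ↦
      Ideal.Quotient.mk (Ideal.span {(⟨r, hr⟩ : inftyIntegers F K)}) (g a) := by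
    intro hinj
    have hfin : Finite (inftyIntegers F K ⧸ Ideal.span {(⟨r, hr⟩ : inftyIntegers F K)}) := by
      refine Nat.finite_of_card_ne_zero ?_
      rw [hM1]
      exact pow_ne_zero _ Nat.card_pos.ne'
    have h1 := Nat.card_le_card_of_injective _ hinj
    rw [hM1, card_inftyRing_quotient, Nat.card_fun,
      Nat.card_congr (Polynomial.degreeLTEquiv F (m + 1)).toEquiv, Nat.card_fun,
      Nat.card_eq_fintype_card (α := Fin _), Fintype.card_fin, Nat.card_eq_fintype_card (α := s),
      ← hs, ← pow_mul, Nat.pow_le_pow_iff_right Finite.one_lt_card] at h1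
    have : m * n < (m + 1) * n := Nat.mul_lt_mul_of_pos_right (Nat.lt_succ_self m) hn
    rw [mul_comm n] at hM
    omega
  simp only [Function.Injective, not_forall] at hnot
  obtain ⟨a, a', haa', hne⟩ := hnot
  rw [Ideal.Quotient.eq, Ideal.mem_span_singleton] at haa'
  obtain ⟨z, hz⟩ := haa'
  have hz' : θ a - θ a' = x * z := by
    have h : θ a * algebraMap F⟮X⟯ K (RatFunc.X ^ (-((m + c₀ : ℕ) : ℤ))) -
        θ a' * algebraMap F⟮X⟯ K (RatFunc.X ^ (-((m + c₀ : ℕ) : ℤ))) = r * z :=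
      congrArg Subtype.val hz
    have hX : algebraMap F⟮X⟯ K (RatFunc.X ^ (-((m + c₀ : ℕ) : ℤ))) ≠ 0 := by
      rw [map_ne_zero]
      exact zpow_ne_zero _ RatFunc.X_ne_zero
    refine mul_right_cancel₀ hX ?_
    rw [sub_mul, h]
    simp only [r]
    ring
  have hy : IsIntegral F[X] (θ a - θ a') := by
    have h : ∀ a, IsIntegral F[X] (θ a) := by
      intro a
      refine IsIntegral.sum _ fun i _ ↦ IsIntegral.mul ?_ (hβ i)
      rw [← IsScalarTower.algebraMap_apply]
      exact isIntegral_algebraMap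
    exact (h a).sub (h a')
  have hy0 : θ a - θ a' ≠ 0 := by
    intro h
    have h1 : ∑ i, (algebraMap F[X] F⟮X⟯ (a i) - algebraMap F[X] F⟮X⟯ (a' i)) • β i = 0 := by
      rw [← h]
      simp only [θ, Algebra.smul_def, map_sub, sub_mul, Finset.sum_sub_distrib]
    refine hne (funext fun i ↦ Subtype.ext ?_)
    have h2 := Fintype.linearIndependent_iff.1 β.linearIndependent _ h1 i
    exact IsFractionRing.injective F[X] F⟮X⟯ (sub_eq_zero.1 h2)
  have hz0 : (z : K) ≠ 0 := by
    intro h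
    rw [h, mul_zero] at hz'
    exact hy0 hz'
  exact ⟨Units.mk0 _ hy0, Units.mk0 _ hz0, hy, z.2, Units.ext hz'⟩

end Pigeonhole

/-! ### A criterion for finite index. -/

section FiniteIndex

theorem index_ne_zero_of_finite_of_finite {L I J : Type*} [CommGroup L] [CommGroup I] [CommGroup J]
    {φ : L →* I} (hφ : Function.Surjective φ) {ψ : L →* J} {H : Subgroup I}
    (hH : ψ.ker.map φ ≤ H) {S : Set J} {S' : Set I} (hS : S.Finite) (hS' : S'.Finite)
    (h : ∀ x, ∃ y z, ψ y ∈ S ∧ φ z ∈ S' ∧ φ x * φ z / φ y ∈ H) : H.index ≠ 0 := by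
  -- One preimage is fixed for each value of `ψ`. Preimages of the same value differ by `ker ψ`,
  -- whose image lies in `H`, so the class depends on `ψ y` alone; off the range of `ψ` the choice
  -- is irrelevant.
  let f : J → I ⧸ H := fun a ↦ QuotientGroup.mk (φ (Function.invFun ψ a))
  have huniv : (Set.univ : Set (I ⧸ H)) ⊆
      Set.image2 (fun a b ↦ f a / QuotientGroup.mk b) S S' := by
    rintro q -
    obtain ⟨a, rfl⟩ := QuotientGroup.mk_surjective q
    obtain ⟨x, rfl⟩ := hφ a
    obtain ⟨y, z, hy, hz, hxyz⟩ := h x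
    refine ⟨_, hy, _, hz, ?_⟩
    have h1 : ψ (Function.invFun ψ (ψ y)) = ψ y := Function.invFun_eq ⟨y, rfl⟩
    have h2 : φ (y / Function.invFun ψ (ψ y)) ∈ H :=
      hH ⟨_, by rw [SetLike.mem_coe, MonoidHom.mem_ker, map_div, h1, div_self'], rfl⟩
    simp only [f]
    rw [← QuotientGroup.mk_div, QuotientGroup.eq]
    have h3 := mul_mem hxyz h2
    rw [map_div] at h3
    convert h3 using 1
    simp only [div_eq_mul_inv, mul_inv, inv_inv]
    rw [mul_comm _ (φ x), mul_comm _ (φ z), mul_assoc, mul_assoc,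
      inv_mul_cancel_left]
  have : Finite (I ⧸ H) := Set.finite_univ_iff.1 ((hS.image2 _ hS').subset huniv)
  exact Subgroup.index_ne_zero_of_finite

end FiniteIndex

/-! ### The weak unit theorem. -/

section Units

open IsDedekindDomain WithZero

variable (F : Type*) (K : Type*) [Field F] [DecidableEq F⟮X⟯] [Field K] [Algebra F⟮X⟯ K]
  [FunctionField F K] [IsGalois F⟮X⟯ K] [Algebra F[X] K] [IsScalarTower F[X] F⟮X⟯ K]

local notation "OK" => FunctionField.ringOfIntegers F K
local notation "BK" => inftyIntegers F K

variable {F K}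

theorem exists_natDegree_eq_normDegree (y : Kˣ) (b : OK) (hb : algebraMap OK K b = y) :
    ∃ p : F[X], p ≠ 0 ∧ b ∣ algebraMap F[X] OK p ∧ (normDegree F K y).toAdd = p.natDegree := by
  have h := Algebra.algebraMap_intNorm (A := F[X]) (K := F⟮X⟯) (L := K) (B := OK) b
  refine ⟨Algebra.intNorm F[X] OK b, ?_, Algebra.dvd_algebraMap_intNorm_self F[X] OK b, ?_⟩
  · rw [Algebra.intNorm_ne_zero]
    rintro rfl
    exact y.ne_zero (by rw [← hb, map_zero])
  · rw [← RatFunc.intDegree_polynomial, h, hb]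
    rfl

theorem exists_dvd_and_coe_eq_normUnits (z : Kˣ) (b : BK) (hb : algebraMap BK K b = z) :
    ∃ a : inftyRing F, b ∣ algebraMap (inftyRing F) BK a ∧
      (a : F⟮X⟯) = normUnits F⟮X⟯ K z := by
  have h := Algebra.algebraMap_intNorm (A := inftyRing F) (K := F⟮X⟯) (L := K) (B := BK) b
  refine ⟨Algebra.intNorm (inftyRing F) BK b, Algebra.dvd_algebraMap_intNorm_self _ BK b, ?_⟩
  rw [hb] at h
  exact h

/-- An integer divides its norm, and only finitely many polynomials have degree at most C; their
product is a common multiple. -/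
theorem exists_dvd_of_normDegree_le [Finite F] (C : ℕ) : ∃ a : OK, a ≠ 0 ∧
    ∀ (y : Kˣ) (b : OK), algebraMap OK K b = y → (normDegree F K y).toAdd ≤ C → b ∣ a := by
  classical
  have : Finite (Polynomial.degreeLT F (C + 1)) :=
    Finite.of_equiv _ (Polynomial.degreeLTEquiv F (C + 1)).symm.toEquiv
  have hfin : {p : F[X] | p ≠ 0 ∧ p.natDegree ≤ C}.Finite := by
    refine (Set.finite_range (Subtype.val : Polynomial.degreeLT F (C + 1) → F[X])).subset ?_
    rintro p ⟨hp0, hp⟩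
    refine ⟨⟨p, Polynomial.mem_degreeLT.2 ?_⟩, rfl⟩
    rw [Polynomial.degree_eq_natDegree hp0]
    exact_mod_cast Nat.lt_succ_of_le hp
  refine ⟨algebraMap F[X] OK (∏ p ∈ hfin.toFinset, p), ?_, fun y b hb hy ↦ ?_⟩
  · rw [map_ne_zero_iff _ (FunctionField.ringOfIntegers.algebraMap_injective F K),
      Finset.prod_ne_zero_iff]
    exact fun p hp ↦ ((Set.Finite.mem_toFinset _).1 hp).1
  · obtain ⟨p, hp0, hbp, hdeg⟩ := exists_natDegree_eq_normDegree y b hb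
    refine hbp.trans (map_dvd _ (Finset.dvd_prod_of_mem _ ((Set.Finite.mem_toFinset _).2 ?_)))
    exact ⟨hp0, by rw [hdeg] at hy; exact_mod_cast hy⟩

/-- An element integral at infinity divides its norm, and a norm of degree at least -C divides
T^(-C) there. -/
theorem exists_dvd_of_le_normDegree (C : ℕ) : ∃ a : BK, a ≠ 0 ∧
    ∀ (y : Kˣ) (b : BK), algebraMap BK K b = y → -(C : ℤ) ≤ (normDegree F K y).toAdd → b ∣ a := by
  have hX : RatFunc.inftyValuation F (RatFunc.X ^ (-(C : ℤ))) ≤ 1 := by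
    rw [RatFunc.inftyValuation.X_zpow, ← exp_zero, exp_le_exp]
    omega
  refine ⟨algebraMap (inftyRing F) BK ⟨_, hX⟩, ?_, fun y b hb hy ↦ ?_⟩
  · intro h
    have h' : algebraMap F⟮X⟯ K (RatFunc.X ^ (-(C : ℤ))) = 0 := congrArg Subtype.val h
    rw [map_eq_zero] at h'
    exact zpow_ne_zero _ RatFunc.X_ne_zero h'
  · obtain ⟨a, hba, ha⟩ := exists_dvd_and_coe_eq_normUnits y b hb
    refine hba.trans (map_dvd _ ?_)
    rw [toAdd_normDegree, ← ha] at hy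
    have ha0 : (a : F⟮X⟯) ≠ 0 := by rw [ha]; exact Units.ne_zero _
    have hc : RatFunc.inftyValuation F ((a : F⟮X⟯)⁻¹ * RatFunc.X ^ (-(C : ℤ))) ≤ 1 :=
      inftyValuation_mul_X_zpow_le F (Or.inr (by rw [RatFunc.intDegree_inv]; omega))
    exact ⟨⟨_, hc⟩, Subtype.ext (mul_inv_cancel_left₀ ha0 _).symm⟩

variable (F K) in
/-- The units of `O_K` together with `T` have finite index in the group of divisors supported at
infinity. -/
theorem index_map_ker_sup_zpowers_ne_zero [Finite F] :
    (((toPrincipalIdeal OK K).ker ⊔ Subgroup.zpowers (varUnitIn F K)).map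
      (toPrincipalIdeal BK K)).index ≠ 0 := by
  have := isPrincipalIdealRing_of_unique BK Gal(K/F⟮X⟯) (eq_inftyPrime (F := F))
  obtain ⟨C, hC⟩ := exists_isIntegral_of_le_normDegree F K
  set n := Module.finrank F⟮X⟯ K with hn
  have hn0 : 0 < n := Module.finrank_pos
  obtain ⟨a, ha0, ha⟩ := exists_dvd_of_normDegree_le (F := F) (K := K) (C + n)
  obtain ⟨a', ha0', ha'⟩ := exists_dvd_of_le_normDegree (F := F) (K := K) (C + n)
  refine index_ne_zero_of_finite_of_finite (fun I ↦ exists_toPrincipalIdeal_eq I)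
    (ψ := toPrincipalIdeal OK K) (Subgroup.map_mono le_sup_left)
    (finite_toPrincipalIdeal_of_dvd ha0) (finite_toPrincipalIdeal_of_dvd ha0') fun x ↦ ?_
  -- Dividing by T^j brings the degree into [C, C + n). The resulting y and z have degrees of
  -- opposite sign (or zero), so both are bounded and leave finitely many ideals.
  set j := ((normDegree F K x).toAdd - C) / n
  have hdeg : (normDegree F K (x * varUnitIn F K ^ (-j))).toAdd = C +
      ((normDegree F K x).toAdd - C) % n := by
    rw [map_mul, map_zpow, toAdd_mul, toAdd_zpow, toAdd_normDegree_varUnitIn, smul_eq_mul]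
    have := Int.emod_add_mul_ediv ((normDegree F K x).toAdd - C) n
    change _ + -j * (n : ℤ) = _
    linarith
  have hmod0 := Int.emod_nonneg ((normDegree F K x).toAdd - C) (b := n) (by exact_mod_cast hn0.ne')
  have hmod1 := Int.emod_lt_of_pos ((normDegree F K x).toAdd - C) (b := n) (by exact_mod_cast hn0)
  obtain ⟨y, z, hy, hz, hyz⟩ := hC (x * varUnitIn F K ^ (-j)) (by rw [hdeg]; omega)
  have hdeg' : (normDegree F K y).toAdd = (normDegree F K _).toAdd :=
    congrArg (fun x ↦ (normDegree F K x).toAdd) hyz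
  rw [map_mul, toAdd_mul, hdeg] at hdeg'
  let y' : OK := ⟨y, hy⟩
  let z' : BK := ⟨z, hz⟩
  obtain ⟨p, -, -, hp⟩ := exists_natDegree_eq_normDegree (F := F) y y' rfl
  obtain ⟨c, -, hc⟩ := exists_dvd_and_coe_eq_normUnits (F := F) z z' rfl
  have hz0 : (normDegree F K z).toAdd ≤ 0 := by
    rw [toAdd_normDegree, ← hc]
    have h := c.2
    have hc0 : (c : F⟮X⟯) ≠ 0 := by rw [hc]; exact Units.ne_zero _
    rw [Valuation.mem_valuationSubring_iff, inftyValuation_eq_exp hc0, ← exp_zero, exp_le_exp] at h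
    exact h
  refine ⟨y, z, ⟨y, rfl, y', ha y y' rfl ?_, rfl⟩, ⟨z, rfl, z', ha' z z' rfl ?_, rfl⟩, ?_⟩
  · push_cast; omega
  · push_cast; omega
  · rw [← map_mul, ← map_div]
    refine ⟨_, Subgroup.mem_sup_right ?_, rfl⟩
    refine ⟨j, ?_⟩
    change varUnitIn F K ^ j = _
    rw [hyz, mul_right_comm, ← div_div, div_self', one_div, zpow_neg, inv_inv]

end Units

/-! ### The Herbrand quotient of E. -/

section PlusUnits

open IsDedekindDomain WithZero

variable (F : Type*) (K : Type*) [Field F] [DecidableEq F⟮X⟯] [Field K] [Algebra F⟮X⟯ K]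
  [FunctionField F K] [Algebra F[X] K] [IsScalarTower F[X] F⟮X⟯ K]

local notation "OK" => FunctionField.ringOfIntegers F K
local notation "BK" => inftyIntegers F K

/-- Only finitely many elements are integral at all places. -/
theorem finite_isIntegral_isIntegral [Finite F] :
    {x : K | IsIntegral F[X] x ∧ IsIntegral (inftyRing F) x}.Finite := by
  classical
  set n := Module.finrank F⟮X⟯ K
  have : Finite (Polynomial.degreeLT F (n + 1)) :=
    Finite.of_equiv _ (Polynomial.degreeLTEquiv F (n + 1)).symm.toEquiv
  let f : F →+* K := (algebraMap F⟮X⟯ K).comp RatFunc.C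
  refine (Set.finite_iUnion fun Q : Polynomial.degreeLT F (n + 1) ↦
    ((Q : F[X]).map f).roots.toFinset.finite_toSet).subset ?_
  rintro x ⟨hx1, hx2⟩
  have h1 := minpoly.isIntegrallyClosed_eq_field_fractions' F⟮X⟯ hx1
  have h2 := minpoly.isIntegrallyClosed_eq_field_fractions' F⟮X⟯ hx2
  have hint : IsIntegral F⟮X⟯ x := hx1.tower_top
  -- Each coefficient is a polynomial in T that is also integral at infinity, hence a constant.
  have hlift : minpoly F⟮X⟯ x ∈ Polynomial.lifts (RatFunc.C : F →+* F⟮X⟯) := by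
    rw [Polynomial.lifts_iff_coeff_lifts]
    intro i
    obtain ⟨p, hp⟩ : ∃ p, algebraMap F[X] F⟮X⟯ p = (minpoly F⟮X⟯ x).coeff i :=
      ⟨_, by rw [h1, Polynomial.coeff_map]⟩
    obtain ⟨a, ha⟩ : ∃ a : inftyRing F, (a : F⟮X⟯) = (minpoly F⟮X⟯ x).coeff i :=
      ⟨_, by rw [h2, Polynomial.coeff_map]; rfl⟩
    rcases eq_or_ne p 0 with hp0 | hp0
    · exact ⟨0, by rw [← hp, hp0, map_zero, map_zero]⟩
    · have h := a.2
      rw [Valuation.mem_valuationSubring_iff, ha, ← hp, RatFunc.inftyValuation_apply,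
        RatFunc.inftyValuation.polynomial F hp0, ← exp_zero, exp_le_exp] at h
      refine ⟨p.coeff 0, ?_⟩
      rw [← hp, Polynomial.eq_C_of_natDegree_le_zero (p := p) (by exact_mod_cast h),
        RatFunc.algebraMap_C, Polynomial.coeff_C_zero]
  obtain ⟨Q, hQ, hQdeg, hQmon⟩ := Polynomial.lifts_and_natDegree_eq_and_monic hlift
    (minpoly.monic hint)
  have hQn : Q ∈ Polynomial.degreeLT F (n + 1) := by
    rw [Polynomial.mem_degreeLT, Polynomial.degree_eq_natDegree hQmon.ne_zero, hQdeg]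
    exact_mod_cast Nat.lt_succ_of_le (minpoly.natDegree_le x)
  rw [Set.mem_iUnion]
  refine ⟨⟨Q, hQn⟩, ?_⟩
  rw [SetLike.mem_coe, Multiset.mem_toFinset, Polynomial.mem_roots (hQmon.map f).ne_zero,
    Polynomial.IsRoot, ← Polynomial.map_map, hQ, Polynomial.eval_map_algebraMap, minpoly.aeval]

/-- The units of `O_K` whose norms are powers at infinity. -/
def plusUnits : Subgroup Kˣ :=
  (toPrincipalIdeal OK K).ker ⊓
    (completionPowers F (Module.finrank F⟮X⟯ K)).comap (normUnits F⟮X⟯ K)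

variable [IsGalois F⟮X⟯ K]

/-- A unit and its inverse both have polynomial norms, of nonnegative degree. -/
theorem ker_toPrincipalIdeal_le_ker_normDegree :
    (toPrincipalIdeal OK K).ker ≤ (normDegree F K).ker := by
  have h : ∀ x ∈ (toPrincipalIdeal OK K).ker, 0 ≤ (normDegree F K x).toAdd := by
    intro x hx
    obtain ⟨u, hu⟩ := (toPrincipalIdeal_eq_one_iff x).1 hx
    obtain ⟨p, -, -, hp⟩ := exists_natDegree_eq_normDegree (F := F) x u hu
    rw [hp]
    positivity
  intro x hx
  have h1 := h x hx
  have h2 := h x⁻¹ (inv_mem hx)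
  rw [map_inv, toAdd_inv] at h2
  exact Multiplicative.toAdd.injective (le_antisymm (by rw [toAdd_one]; omega) h1)

theorem ker_toPrincipalIdeal_inftyIntegers_le_ker_normDegree :
    (toPrincipalIdeal BK K).ker ≤ (normDegree F K).ker := by
  have h : ∀ x ∈ (toPrincipalIdeal BK K).ker, (normDegree F K x).toAdd ≤ 0 := by
    intro x hx
    obtain ⟨u, hu⟩ := (toPrincipalIdeal_eq_one_iff x).1 hx
    obtain ⟨c, -, hc⟩ := exists_dvd_and_coe_eq_normUnits (F := F) x u hu
    rw [toAdd_normDegree, ← hc]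
    have h := c.2
    have hc0 : (c : F⟮X⟯) ≠ 0 := by rw [hc]; exact Units.ne_zero _
    rwa [Valuation.mem_valuationSubring_iff, inftyValuation_eq_exp hc0, ← exp_zero, exp_le_exp] at h
  intro x hx
  have h1 := h x hx
  have h2 := h x⁻¹ (inv_mem hx)
  rw [map_inv, toAdd_inv] at h2
  exact Multiplicative.toAdd.injective (le_antisymm h1 (by rw [toAdd_one]; omega))

theorem normDegree_varUnitIn_ne_one : normDegree F K (varUnitIn F K) ≠ 1 := by
  intro h
  have h1 := toAdd_normDegree_varUnitIn F K
  rw [h, toAdd_one] at h1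
  exact Module.finrank_pos.ne (by exact_mod_cast h1)

theorem finite_plusUnits_sup_zpowers_inf_ker [Finite F] :
    Finite ↥((plusUnits F K ⊔ Subgroup.zpowers (varUnitIn F K)) ⊓ (toPrincipalIdeal BK K).ker) := by
  have hle : plusUnits F K ≤ (normDegree F K).ker :=
    inf_le_left.trans (ker_toPrincipalIdeal_le_ker_normDegree F K)
  refine Set.Finite.to_subtype (Set.Finite.of_finite_image (f := Units.val)
    ((finite_isIntegral_isIntegral F K).subset ?_) Units.val_injective.injOn)
  rintro _ ⟨x, ⟨hx1, hx2⟩, rfl⟩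
  have hx3 : x ∈ plusUnits F K := by
    rw [← sup_zpowers_inf_ker hle (normDegree_varUnitIn_ne_one F K)]
    exact ⟨hx1, ker_toPrincipalIdeal_inftyIntegers_le_ker_normDegree F K hx2⟩
  obtain ⟨u, hu⟩ := (toPrincipalIdeal_eq_one_iff x).1 hx3.1
  obtain ⟨v, hv⟩ := (toPrincipalIdeal_eq_one_iff x).1 hx2
  constructor
  · rw [← hu]
    exact (u : OK).2
  · rw [← hv]
    exact (v : BK).2

theorem normUnits_actionNorm (x : Kˣ) :
    normUnits F⟮X⟯ K (actionNorm (unitsAction K Gal(K/F⟮X⟯)) x) =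
      normUnits F⟮X⟯ K x ^ Module.finrank F⟮X⟯ K := by
  rw [← baseUnits_normUnits_eq, normUnits_baseUnits]

theorem normUnits_actionDiff (g : Gal(K/F⟮X⟯)) (x : Kˣ) :
    normUnits F⟮X⟯ K (actionDiff (unitsAction K Gal(K/F⟮X⟯)) g x) = 1 := by
  refine baseUnits_injective F⟮X⟯ K ?_
  rw [baseUnits_normUnits_eq, actionNorm_actionDiff, map_one]

/-- Passing from O_K^* to E costs at most the index [K^* : K^+], so the weak unit theorem survives.
-/
theorem index_map_plusUnits_sup_zpowers_ne_zero [Finite F]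
    (hidx : ((completionPowers F (Module.finrank F⟮X⟯ K)).comap (normUnits F⟮X⟯ K)).index ≠ 0) :
    ((plusUnits F K ⊔ Subgroup.zpowers (varUnitIn F K)).map (toPrincipalIdeal BK K)).index ≠ 0 := by
  set M := plusUnits F K ⊔ Subgroup.zpowers (varUnitIn F K)
  set E := (toPrincipalIdeal OK K).ker
  have h1 : M ≤ E ⊔ Subgroup.zpowers (varUnitIn F K) := sup_le_sup_right inf_le_left _
  have h2 : M.relIndex (E ⊔ Subgroup.zpowers (varUnitIn F K)) ≠ 0 := by
    have h3 : E ⊔ Subgroup.zpowers (varUnitIn F K) = E ⊔ M := by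
      have h4 : E ⊔ plusUnits F K = E := sup_eq_left.2 inf_le_left
      rw [← sup_assoc, h4]
    rw [h3, Subgroup.relIndex_sup_right]
    refine fun h0 ↦ hidx ?_
    have h4 := Subgroup.relIndex_eq_zero_of_le_left (le_sup_left : plusUnits F K ≤ M) h0
    rw [plusUnits, Subgroup.inf_relIndex_left] at h4
    have h5 := Subgroup.relIndex_dvd_index_of_normal
      ((completionPowers F (Module.finrank F⟮X⟯ K)).comap (normUnits F⟮X⟯ K)) E
    rw [h4, zero_dvd_iff] at h5
    exact h5
  rw [← Subgroup.relIndex_mul_index (Subgroup.map_mono (f := toPrincipalIdeal BK K) h1)]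
  refine mul_ne_zero (fun h ↦ h2 ?_) (index_map_ker_sup_zpowers_ne_zero F K)
  rw [← relIndex_map_mul_relIndex_inf_ker (toPrincipalIdeal BK K) h1, h, zero_mul]

/-- The Herbrand quotient of E · T^ℤ is compared with that of the divisors above infinity, whose
Tate orders are 1 and e_∞ f_∞; the contribution of T^ℤ is then removed. -/
theorem tateIndex_plusUnits [Finite F] {g : Gal(K/F⟮X⟯)} (hg : ∀ σ, σ ∈ Subgroup.zpowers g)
    (hidx : ((completionPowers F (Module.finrank F⟮X⟯ K)).comap (normUnits F⟮X⟯ K)).index ≠ 0) :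
    tateIndex (actionDiff (unitsAction K Gal(K/F⟮X⟯)) g)
        (actionNorm (unitsAction K Gal(K/F⟮X⟯))) (plusUnits F K) ≠ 0 ∧
      tateIndex (actionDiff (unitsAction K Gal(K/F⟮X⟯)) g)
        (actionNorm (unitsAction K Gal(K/F⟮X⟯))) (plusUnits F K) * inftyDegree F K =
      Module.finrank F⟮X⟯ K * tateIndex (actionNorm (unitsAction K Gal(K/F⟮X⟯)))
        (actionDiff (unitsAction K Gal(K/F⟮X⟯)) g) (plusUnits F K) := by
  set D := actionDiff (unitsAction K Gal(K/F⟮X⟯)) g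
  set N := actionNorm (unitsAction K Gal(K/F⟮X⟯))
  set n := Module.finrank F⟮X⟯ K
  have hn : n ≠ 0 := Module.finrank_pos.ne'
  have hle : plusUnits F K ≤ (normDegree F K).ker :=
    inf_le_left.trans (ker_toPrincipalIdeal_le_ker_normDegree F K)
  have hfix : ∀ σ, unitsAction K Gal(K/F⟮X⟯) σ (varUnitIn F K) = varUnitIn F K := fun σ ↦
    Units.ext (σ.commutes RatFunc.X)
  have hDt : D (varUnitIn F K) = 1 := by
    rw [actionDiff_apply, hfix, div_self']
  have hNt : N (varUnitIn F K) = varUnitIn F K ^ n := by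
    rw [actionNorm_of_forall_eq hfix, IsGalois.card_aut_eq_finrank]
  have hND : ∀ x, N (D x) = 1 := actionNorm_actionDiff _ g
  have hDN : ∀ x, D (N x) = 1 := actionDiff_actionNorm _ g
  have hDM : (plusUnits F K).map D ≤ plusUnits F K := by
    rintro _ ⟨x, hx, rfl⟩
    refine Subgroup.mem_inf.2 ⟨?_, ?_⟩
    · rw [MonoidHom.mem_ker, toPrincipalIdeal_actionDiff,
        MonoidHom.mem_ker.1 hx.1, map_one]
    · rw [Subgroup.mem_comap, normUnits_actionDiff]
      exact one_mem _
  have hNM : (plusUnits F K).map N ≤ plusUnits F K := by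
    rintro _ ⟨x, hx, rfl⟩
    refine Subgroup.mem_inf.2 ⟨?_, ?_⟩
    · rw [MonoidHom.mem_ker, toPrincipalIdeal_actionNorm,
        MonoidHom.mem_ker.1 hx.1, map_one]
    · rw [Subgroup.mem_comap, normUnits_actionNorm]
      exact pow_mem_completionPowers _
  have hδN : ∀ x, normDegree F K (N x) = normDegree F K x ^ n := by
    intro x
    refine Multiplicative.toAdd.injective ?_
    rw [toAdd_pow, toAdd_normDegree, normUnits_actionNorm, intDegree_pow, nsmul_eq_mul]
    rfl
  have e1 := tateIndex_sup_zpowers_left (N := N) hDt (normDegree_varUnitIn_ne_one F K) hn hle hδN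
  have e2 := tateIndex_sup_zpowers_right (N := N) hDt (normDegree_varUnitIn_ne_one F K) hn hle hNt
    hDN hNM
  have e3 := tateIndex_actionDiff_actionNorm (R := BK) (K := K) hg
  have e4 := tateIndex_actionNorm_actionDiff (R := BK) (K := K) (eq_inftyPrime (F := F)) hg
  have key := tateIndex_mul_tateIndex_of_finite (φ := toPrincipalIdeal BK K) (D := D) (N := N)
    (toPrincipalIdeal_actionDiff g) toPrincipalIdeal_actionNorm hND hDN
    (actionNorm_actionDiff _ g) (actionDiff_actionNorm _ g)
    (M := plusUnits F K ⊔ Subgroup.zpowers (varUnitIn F K))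
    (by
      rw [Subgroup.map_sup, MonoidHom.map_zpowers, hDt, Subgroup.zpowers_one_eq_bot, sup_bot_eq]
      exact hDM.trans le_sup_left)
    (by
      rw [Subgroup.map_sup, MonoidHom.map_zpowers, hNt]
      exact sup_le_sup hNM (by rw [Subgroup.zpowers_le]; exact Subgroup.npow_mem_zpowers _ n))
    (finite_plusUnits_sup_zpowers_inf_ker F K) (index_map_plusUnits_sup_zpowers_ne_zero F K hidx)
    (by rw [e3]; exact one_ne_zero) (by rw [e4]; exact inftyDegree_ne_zero F K)
  rw [e1, e2, e3, e4, mul_one] at key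
  exact ⟨key.1, key.2.2⟩

end PlusUnits

/-! ### Finiteness of ramification. -/

section Ramification

open IsDedekindDomain

/-- A ramified prime lies below a divisor of the different, which is nonzero by separability. The
square `H` only transports separability to the canonical fraction fields. -/
theorem finite_setOf_ramIn_ne_one (A k R K G : Type*) [CommRing A] [IsDedekindDomain A] [Field k]
    [Algebra A k] [IsFractionRing A k] [CommRing R] [IsDedekindDomain R] [Field K] [Algebra R K]
    [IsFractionRing R K] [Algebra A R] [Algebra A K] [Algebra k K] [IsScalarTower A k K]
    [IsScalarTower A R K] [Module.Finite A R] [Module.IsTorsionFree A R] [Algebra.IsSeparable k K]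
    [Group G] [Finite G] [MulSemiringAction G R] [IsGaloisGroup G A R] :
    {v : HeightOneSpectrum A | ramIn R v ≠ 1}.Finite := by
  have : FaithfulSMul A R := (Module.isTorsionFree_iff_faithfulSMul (R := A) (A := R)).1 inferInstance
  let := FractionRing.liftAlgebra A (FractionRing R)
  have H : RingHom.comp (algebraMap (FractionRing A) (FractionRing R))
      ↑(FractionRing.algEquiv A k).symm.toRingEquiv =
        RingHom.comp ↑(FractionRing.algEquiv R K).symm.toRingEquiv (algebraMap k K) := by
    apply IsLocalization.ringHom_ext A⁰
    ext
    simp only [RingHom.coe_comp, RingHom.coe_coe,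
      AlgEquiv.coe_ringEquiv, Function.comp_apply, AlgEquiv.commutes,
      ← IsScalarTower.algebraMap_apply]
    rw [IsScalarTower.algebraMap_apply A R K, AlgEquiv.commutes, ← IsScalarTower.algebraMap_apply]
  have : Algebra.IsSeparable (FractionRing A) (FractionRing R) :=
    Algebra.IsSeparable.of_equiv_equiv _ _ H
  refine ((Ideal.finite_factors (differentIdeal_ne_bot (A := A) (B := R))).image
    (HeightOneSpectrum.under A)).subset fun v hv ↦ ?_
  obtain ⟨w, rfl⟩ := exists_under_eq R v
  refine ⟨w, ?_, rfl⟩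
  by_contra h
  have := not_dvd_differentIdeal_iff.1 h
  have : w.asIdeal.LiesOver (w.under A).asIdeal := ⟨rfl⟩
  refine hv ?_
  change Ideal.ramificationIdxIn (w.under A).asIdeal R = 1
  rw [Ideal.ramificationIdxIn_eq_ramificationIdx (w.under A).asIdeal w.asIdeal G]
  exact Ideal.ramificationIdx_eq_one w.asIdeal A

theorem exists_monic_irreducible_generator {F : Type*} [Field F] (v : HeightOneSpectrum F[X]) :
    ∃ P : F[X], P.Monic ∧ Irreducible P ∧ v.asIdeal = Ideal.span {P} := by
  obtain ⟨p, hp⟩ := IsPrincipalIdealRing.principal v.asIdeal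
  have hp' : v.asIdeal = Ideal.span {p} := hp
  have hp0 : p ≠ 0 := by
    rintro rfl
    exact v.ne_bot (by simpa using hp')
  have hspan : v.asIdeal = Ideal.span {p * Polynomial.C p.leadingCoeff⁻¹} := by
    rw [hp', Ideal.span_singleton_eq_span_singleton]
    refine associated_mul_unit_right p _ (Polynomial.isUnit_C.2 ?_)
    simpa using hp0
  have hmon := Polynomial.monic_mul_leadingCoeff_inv hp0
  refine ⟨_, hmon, ((Ideal.span_singleton_prime hmon.ne_zero).1 ?_).irreducible, hspan⟩
  rw [← hspan]
  exact v.isPrime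

end Ramification

/-! ### Hilbert 90 for K^*. -/

section HilbertNinety

/-- Hilbert's theorem 90, in any universe. -/
theorem exists_actionDiff_eq_of_actionNorm_units_eq_one {k K : Type*} [Field k] [Field K]
    [Algebra k K] [FiniteDimensional k K] {g : Gal(K/k)}
    (hg : ∀ σ, σ ∈ Subgroup.zpowers g) (x : Kˣ) (hx : actionNorm (unitsAction K Gal(K/k)) x = 1) :
    ∃ y, actionDiff (unitsAction K Gal(K/k)) g y = x := by
  classical
  set n := orderOf g with hn
  have hn0 : 0 < n := orderOf_pos g
  -- Partial norms, with x · g(c_i) = c_(i+1) and c_n = 1. They are the coefficients of the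
  -- resolvent b, nonzero at some z by independence of characters, and x · g(b) = b.
  let c : ℕ → K := fun i ↦ ∏ j ∈ Finset.range i, (g ^ j) (x : K)
  have hc1 : ∀ i, x * g (c i) = c (i + 1) := fun i ↦ by
    simp only [c, map_prod]
    rw [Finset.prod_range_succ', mul_comm, pow_zero, AlgEquiv.one_apply]
    refine congrArg (· * (x : K)) (Finset.prod_congr rfl fun j _ ↦ ?_)
    rw [pow_succ', AlgEquiv.mul_apply]
  have hcn : c n = 1 := by
    have h : ∏ σ : Gal(K/k), σ (x : K) = 1 := by
      have h := congrArg Units.val hx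
      rw [actionNorm_apply, Units.coe_prod] at h
      exact h
    rw [← h, ← IsCyclic.image_range_orderOf hg, Finset.prod_image]
    intro i hi j hj hij
    exact pow_injOn_Iio_orderOf (by simpa using hi) (by simpa using hj) hij
  have hli : LinearIndependent K (fun i : Fin n ↦ ((g ^ (i : ℕ) : Gal(K/k)) : K → K)) := by
    refine LinearIndependent.comp (ι' := Fin n) (linearIndependent_monoidHom K K)
      (fun i ↦ ((g ^ (i : ℕ) : Gal(K/k)) : K →* K)) fun i j h ↦ Fin.ext ?_
    refine pow_injOn_Iio_orderOf i.2 j.2 (AlgEquiv.ext fun z ↦ ?_)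
    exact DFunLike.congr_fun h z
  obtain ⟨z, hz⟩ : ∃ z, ∑ i ∈ Finset.range n, c i * (g ^ i) z ≠ 0 := by
    by_contra! h
    have h0 := Fintype.linearIndependent_iff.1 hli (fun i ↦ c i) (by
      ext z
      rw [Finset.sum_apply]
      exact (Fin.sum_univ_eq_sum_range (fun i ↦ c i * (g ^ i) z) n).trans (h z)) ⟨0, hn0⟩
    simp [c] at h0
  set b := ∑ i ∈ Finset.range n, c i * (g ^ i) z with hb
  have hgb : x * g b = b := by
    have h : x * g b = ∑ i ∈ Finset.range n, c (i + 1) * (g ^ (i + 1)) z := by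
      rw [hb, map_sum, Finset.mul_sum]
      refine Finset.sum_congr rfl fun i _ ↦ ?_
      rw [map_mul, ← mul_assoc, hc1, pow_succ', AlgEquiv.mul_apply]
    have h2 := (Finset.sum_range_succ' (fun i ↦ c i * (g ^ i) z) n).symm.trans
      (Finset.sum_range_succ (fun i ↦ c i * (g ^ i) z) n)
    rw [hcn, pow_orderOf_eq_one] at h2
    have hc0 : c 0 = 1 := Finset.prod_range_zero _
    rw [hc0, pow_zero, AlgEquiv.one_apply] at h2
    rw [h]
    exact add_right_cancel h2
  refine ⟨(Units.mk0 b hz)⁻¹, ?_⟩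
  rw [map_inv, inv_eq_iff_eq_inv, actionDiff_apply, div_eq_iff_eq_mul, eq_inv_mul_iff_mul_eq]
  exact Units.ext hgb

end HilbertNinety

/-! ### Assembling the class number formula. -/

section Final

open IsDedekindDomain

variable (F : Type*) (K : Type*) [Field F] [Field K] [Algebra F⟮X⟯ K]
  [FunctionField F K] [Algebra F[X] K] [IsScalarTower F[X] F⟮X⟯ K] [IsGalois F⟮X⟯ K]

local notation "OK" => FunctionField.ringOfIntegers F K

theorem exists_finset_ramIndex : ∃ (S : Finset F[X]) (T : Finset (HeightOneSpectrum F[X])),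
    (∀ P : F[X], P ∈ S ↔ P.Monic ∧ Irreducible P ∧ 1 < ramIndex F K P) ∧
    (∀ v, v ∉ T → ramIn OK v = 1) ∧ ∏ v ∈ T, ramIn OK v = ∏ P ∈ S, ramIndex F K P := by
  classical
  choose f hf1 hf2 hf3 using exists_monic_irreducible_generator (F := F)
  have hfin := finite_setOf_ramIn_ne_one F[X] F⟮X⟯ OK K Gal(K/F⟮X⟯)
  have hram : ∀ v, ramIndex F K (f v) = ramIn OK v := fun v ↦ by
    rw [ramIndex, ramIn, hf3]
  have hinj : Function.Injective f := fun v w h ↦ HeightOneSpectrum.ext (by rw [hf3, hf3, h])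
  refine ⟨hfin.toFinset.image f, hfin.toFinset, fun P ↦ ?_, fun v hv ↦ ?_, ?_⟩
  · rw [Finset.mem_image]
    constructor
    · rintro ⟨v, hv, rfl⟩
      rw [Set.Finite.mem_toFinset] at hv
      refine ⟨hf1 v, hf2 v, ?_⟩
      rw [hram]
      have h0 : ramIn OK v ≠ 0 := ramIn_ne_zero Gal(K/F⟮X⟯) v
      have h1 : ramIn OK v ≠ 1 := hv
      omega
    · rintro ⟨hP1, hP2, hP3⟩
      let v : HeightOneSpectrum F[X] := ⟨Ideal.span {P},
        (Ideal.span_singleton_prime hP1.ne_zero).2 hP2.prime, by simpa using hP1.ne_zero⟩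
      have hv : f v = P := Polynomial.eq_of_monic_of_associated (hf1 v) hP1
        (Ideal.span_singleton_eq_span_singleton.1 (hf3 v).symm)
      refine ⟨v, ?_, hv⟩
      rw [Set.Finite.mem_toFinset]
      change ramIn OK v ≠ 1
      rw [← hram, hv]
      exact hP3.ne'
  · by_contra h
    exact hv ((Set.Finite.mem_toFinset _).2 h)
  · rw [Finset.prod_image hinj.injOn]
    exact Finset.prod_congr rfl fun v _ ↦ (hram v).symm

variable {F K}

theorem galIdeal_eq_idealAction (σ : Gal(K/F⟮X⟯)) (I : FracIdeals F K) :
    galIdeal F σ I = idealAction OK K Gal(K/F⟮X⟯) σ I := by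
  ext x
  rw [mem_galIdeal_iff, mem_idealAction_iff]
  rfl

theorem galClass_mk (σ : Gal(K/F⟮X⟯)) (I : FracIdeals F K) :
    galClass F σ (QuotientGroup.mk I) =
      QuotientGroup.mk (idealAction OK K Gal(K/F⟮X⟯) σ I) := by
  rw [← galIdeal_eq_idealAction]
  rfl

/-- The stabilizer of a class is a subgroup, so invariance under the generator suffices, and it says
that `D` sends the ideal into P_K^+. -/
theorem card_ambiguousClasses {g : Gal(K/F⟮X⟯)} (hg : ∀ σ, σ ∈ Subgroup.zpowers g) :
    Nat.card (ambiguousClasses F K) = (plusPrincipal F K).relIndex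
      ((plusPrincipal F K).comap (actionDiff (idealAction OK K Gal(K/F⟮X⟯)) g)) := by
  have h1 : (ambiguousClasses F K).comap (QuotientGroup.mk' (plusPrincipal F K)) =
      (plusPrincipal F K).comap (actionDiff (idealAction OK K Gal(K/F⟮X⟯)) g) := by
    ext I
    have h2 : ∀ σ : Gal(K/F⟮X⟯), galClass F σ (QuotientGroup.mk I) = QuotientGroup.mk I ↔
        idealAction OK K Gal(K/F⟮X⟯) σ I / I ∈ plusPrincipal F K := by
      intro σ
      rw [galClass_mk, eq_comm, QuotientGroup.eq, div_eq_inv_mul]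
    constructor
    · intro h
      exact (h2 g).1 (h g)
    · intro h
      let H : Subgroup Gal(K/F⟮X⟯) :=
        { carrier := {σ | galClass F σ (QuotientGroup.mk I) = QuotientGroup.mk I}
          one_mem' := by
            change galClass F (1 : Gal(K/F⟮X⟯)) _ = _
            rw [galClass_mk, map_one]
            rfl
          mul_mem' := fun {σ τ} hσ hτ ↦ by
            change galClass F (σ * τ) _ = _
            rw [galClass_mk, map_mul, MulAut.mul_apply, ← galClass_mk, ← galClass_mk]
            exact (congrArg (galClass F σ) hτ).trans hσ
          inv_mem' := fun {σ} hσ ↦ by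
            change galClass F σ⁻¹ _ = _
            have h3 : galClass F σ _ = QuotientGroup.mk I := hσ
            conv_lhs => rw [← h3]
            rw [galClass_mk, galClass_mk, ← MulAut.mul_apply, ← map_mul, inv_mul_cancel, map_one]
            rfl }
      have hH : Subgroup.zpowers g ≤ H := (Subgroup.zpowers_le).2 ((h2 g).2 h)
      exact fun σ ↦ hH (hg σ)
  have h2 := Subgroup.relIndex_ker
    ((ambiguousClasses F K).comap (QuotientGroup.mk' (plusPrincipal F K)))
    (QuotientGroup.mk' (plusPrincipal F K))
  rw [QuotientGroup.ker_mk',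
    Subgroup.map_comap_eq_self_of_surjective (QuotientGroup.mk'_surjective _)] at h2
  rw [← h1]
  exact h2.symm

variable (F K) in
/-- The constants, as elements of `K`. -/
def constUnits : Fˣ →* Kˣ :=
  (baseUnits F⟮X⟯ K).comp (Units.map (RatFunc.C : F →+* F⟮X⟯).toMonoidHom)

theorem constUnits_injective : Function.Injective (constUnits F K) :=
  (baseUnits_injective F⟮X⟯ K).comp (Units.map_injective (RatFunc.C (K := F)).injective)

theorem mem_ker_actionDiff_iff {g : Gal(K/F⟮X⟯)} (hg : ∀ σ, σ ∈ Subgroup.zpowers g) {x : Kˣ} :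
    x ∈ (actionDiff (unitsAction K Gal(K/F⟮X⟯)) g).ker ↔ ∃ y, baseUnits F⟮X⟯ K y = x := by
  rw [mem_ker_actionDiff hg]
  constructor
  · intro h
    obtain ⟨y, hy⟩ := (IsGalois.mem_range_algebraMap_iff_fixed (x : K)).2 fun σ ↦
      congrArg Units.val (h σ)
    refine ⟨Units.mk0 y ?_, Units.ext hy⟩
    rintro rfl
    exact x.ne_zero (by rw [← hy, map_zero])
  · rintro ⟨y, rfl⟩ σ
    exact Units.ext (σ.commutes (y : F⟮X⟯))

/-- F[T] is integrally closed, so y and y⁻¹ are both polynomials. -/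
theorem exists_C_eq_of_toPrincipalIdeal_eq_one {y : F⟮X⟯ˣ}
    (hy : toPrincipalIdeal OK K (baseUnits F⟮X⟯ K y) = 1) :
    ∃ c : Fˣ, Units.map (RatFunc.C : F →+* F⟮X⟯).toMonoidHom c = y := by
  obtain ⟨u, hu⟩ := (toPrincipalIdeal_eq_one_iff _).1 hy
  have key : ∀ (z : F⟮X⟯ˣ) (u : OK), algebraMap OK K u = baseUnits F⟮X⟯ K z →
      ∃ p : F[X], algebraMap F[X] F⟮X⟯ p = z := by
    intro z u hu
    have h1 : IsIntegral F[X] (algebraMap F⟮X⟯ K z) := by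
      have : algebraMap F⟮X⟯ K z = algebraMap OK K u := hu.symm
      rw [this]
      exact u.2
    rw [isIntegral_algebraMap_iff (algebraMap F⟮X⟯ K).injective] at h1
    exact IsIntegrallyClosed.isIntegral_iff.1 h1
  obtain ⟨p, hp⟩ := key y u hu
  obtain ⟨p', hp'⟩ := key y⁻¹ (u⁻¹ : (OK)ˣ) (by
    have hinv : algebraMap OK K (u⁻¹ : (OK)ˣ) = (algebraMap OK K u)⁻¹ :=
      eq_inv_of_mul_eq_one_left (by rw [← map_mul, Units.inv_mul, map_one])
    rw [hinv, hu, map_inv, Units.val_inv_eq_inv_val])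
  have hpp : p * p' = 1 := by
    refine IsFractionRing.injective F[X] F⟮X⟯ ?_
    rw [map_mul, hp, hp', map_one, Units.mul_inv]
  obtain ⟨c, hc, hcp⟩ := Polynomial.isUnit_iff.1 (IsUnit.of_mul_eq_one p' hpp)
  refine ⟨hc.unit, Units.ext ?_⟩
  rw [← hp, ← hcp, RatFunc.algebraMap_C]
  rfl

theorem toPrincipalIdeal_constUnits (c : Fˣ) : toPrincipalIdeal OK K (constUnits F K c) = 1 := by
  rw [toPrincipalIdeal_eq_one_iff]
  refine ⟨Units.map (algebraMap F[X] OK).toMonoidHom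
    (Units.map (Polynomial.C : F →+* F[X]).toMonoidHom c), ?_⟩
  change algebraMap OK K (algebraMap F[X] OK (Polynomial.C (c : F))) =
    algebraMap F⟮X⟯ K (RatFunc.C (c : F))
  rw [← IsScalarTower.algebraMap_apply, IsScalarTower.algebraMap_apply F[X] F⟮X⟯ K,
    RatFunc.algebraMap_C]

theorem ker_actionDiff_inf_ker {g : Gal(K/F⟮X⟯)} (hg : ∀ σ, σ ∈ Subgroup.zpowers g) :
    (actionDiff (unitsAction K Gal(K/F⟮X⟯)) g).ker ⊓ (toPrincipalIdeal OK K).ker =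
      (⊤ : Subgroup Fˣ).map (constUnits F K) := by
  ext x
  constructor
  · rintro ⟨hx1, hx2⟩
    obtain ⟨y, rfl⟩ := (mem_ker_actionDiff_iff hg).1 hx1
    obtain ⟨c, rfl⟩ := exists_C_eq_of_toPrincipalIdeal_eq_one hx2
    exact ⟨c, trivial, rfl⟩
  · rintro ⟨c, -, rfl⟩
    exact ⟨(mem_ker_actionDiff_iff hg).2 ⟨_, rfl⟩, toPrincipalIdeal_constUnits c⟩

/-- A constant that is the norm of an element of K^+ is an n-th power in k_∞, hence in the residue
field F. Conversely c^n is the norm of the constant c. -/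
theorem map_actionNorm_inf_ker [Finite F] [DecidableEq F⟮X⟯]
    (hn : Module.finrank F⟮X⟯ K ∣ Nat.card F - 1) :
    (((completionPowers F (Module.finrank F⟮X⟯ K)).comap (normUnits F⟮X⟯ K)).map
      (actionNorm (unitsAction K Gal(K/F⟮X⟯)))) ⊓ (toPrincipalIdeal OK K).ker =
      (powMonoidHom (Module.finrank F⟮X⟯ K) : Fˣ →* Fˣ).range.map (constUnits F K) := by
  set n := Module.finrank F⟮X⟯ K
  ext x
  constructor
  · rintro ⟨⟨y, hy, rfl⟩, hx⟩
    rw [SetLike.mem_coe, Subgroup.mem_comap] at hy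
    have hx' : toPrincipalIdeal OK K (actionNorm (unitsAction K Gal(K/F⟮X⟯)) y) = 1 := hx
    rw [← baseUnits_normUnits_eq] at hx'
    obtain ⟨c, hc⟩ := exists_C_eq_of_toPrincipalIdeal_eq_one hx'
    rw [← baseUnits_normUnits_eq, ← hc]
    rw [← hc] at hy
    obtain ⟨d, hd⟩ := (unit_mem_completionPowers_iff hn
      (Units.map (inftyConst (F := F)).toMonoidHom c)).1 hy
    obtain ⟨d, rfl⟩ := bijective_mk_inftyConst.2 d
    have hcd : (c : F) = d ^ n := by
      refine bijective_mk_inftyConst.1 ?_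
      rw [map_pow, ← hd]
      rfl
    have hd0 : d ≠ 0 := by
      rintro rfl
      rw [zero_pow Module.finrank_pos.ne'] at hcd
      exact c.ne_zero hcd
    exact ⟨c, ⟨Units.mk0 d hd0, Units.ext hcd.symm⟩, rfl⟩
  · rintro ⟨_, ⟨c, rfl⟩, rfl⟩
    refine ⟨⟨constUnits F K c, ?_, ?_⟩, toPrincipalIdeal_constUnits _⟩
    · rw [SetLike.mem_coe, Subgroup.mem_comap, constUnits, MonoidHom.comp_apply,
        normUnits_baseUnits]
      exact pow_mem_completionPowers _
    · rw [← baseUnits_normUnits_eq, constUnits, MonoidHom.comp_apply, normUnits_baseUnits,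
        powMonoidHom_apply, ← map_pow]
      rfl

theorem relIndex_map_actionNorm_inf_ker [Finite F] [DecidableEq F⟮X⟯] {g : Gal(K/F⟮X⟯)}
    (hg : ∀ σ, σ ∈ Subgroup.zpowers g) (hn : Module.finrank F⟮X⟯ K ∣ Nat.card F - 1) :
    ((((completionPowers F (Module.finrank F⟮X⟯ K)).comap (normUnits F⟮X⟯ K)).map
      (actionNorm (unitsAction K Gal(K/F⟮X⟯)))) ⊓ (toPrincipalIdeal OK K).ker).relIndex
      ((actionDiff (unitsAction K Gal(K/F⟮X⟯)) g).ker ⊓ (toPrincipalIdeal OK K).ker) =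
      Module.finrank F⟮X⟯ K := by
  rw [map_actionNorm_inf_ker hn, ker_actionDiff_inf_ker hg,
    Subgroup.relIndex_map_map_of_injective _ _ constUnits_injective, Subgroup.relIndex_top_right,
    IsCyclic.index_powMonoidHom_range, Nat.card_units]
  exact Nat.gcd_eq_right hn

theorem card_ambiguousClasses_eq [Finite F] [IsCyclic Gal(K/F⟮X⟯)]
    (hn : Module.finrank F⟮X⟯ K ∣ Nat.card F - 1) (T : Finset (HeightOneSpectrum F[X]))
    (hT : ∀ v, v ∉ T → ramIn OK v = 1) :
    Nat.card (ambiguousClasses F K) = ∏ v ∈ T, ramIn OK v := by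
  classical
  obtain ⟨g, hg⟩ := IsCyclic.exists_generator (α := Gal(K/F⟮X⟯))
  set n := Module.finrank F⟮X⟯ K with hn'
  have hn0 : 0 < n := Module.finrank_pos
  have hLp : plusElements F K = (completionPowers F n).comap (normUnits F⟮X⟯ K) := rfl
  have hidx := index_comap_completionPowers F K hg rfl hn
  have hidx0 : ((completionPowers F n).comap (normUnits F⟮X⟯ K)).index ≠ 0 := by
    intro h
    rw [h, zero_mul] at hidx
    exact (mul_pos hn0 hn0).ne hidx
  obtain ⟨h10, h1⟩ := tateIndex_plusUnits F K hg hidx0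
  have hbase := relIndex_map_toPrincipalIdeal_baseUnits (A := F[X]) (k := F⟮X⟯) (R := OK) (K := K)
    (fun I ↦ mem_ker_actionDiff (ρ := idealAction OK K Gal(K/F⟮X⟯)) hg (m := I)) T hT
  have hDker : (actionDiff (unitsAction K Gal(K/F⟮X⟯)) g).ker = (baseUnits F⟮X⟯ K).range := by
    ext x
    exact mem_ker_actionDiff_iff hg
  have key := ambiguous_relIndex_formula (φ := toPrincipalIdeal OK K)
    (D := actionDiff (unitsAction K Gal(K/F⟮X⟯)) g) (N := actionNorm (unitsAction K Gal(K/F⟮X⟯)))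
    (toPrincipalIdeal_actionDiff g) toPrincipalIdeal_actionNorm
    (actionNorm_actionDiff _ g) (actionDiff_actionNorm _ g) (actionNorm_actionDiff _ g)
    (exists_actionDiff_eq_of_actionNorm_units_eq_one hg)
    (fun I hI ↦ exists_actionDiff_eq_of_actionNorm_eq_one hg hI)
    (Lp := (completionPowers F n).comap (normUnits F⟮X⟯ K))
    (by
      rw [hDker]
      rintro _ ⟨y, rfl⟩
      rw [Subgroup.mem_comap, normUnits_baseUnits]
      exact pow_mem_completionPowers y)
    (fun x ↦ by
      rw [Subgroup.mem_comap, normUnits_actionDiff]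
      exact one_mem _)
  rw [relIndex_map_actionNorm_inf_ker hg hn, hDker, hbase] at key
  rw [card_ambiguousClasses hg, plusPrincipal, hLp]
  change _ * tateIndex _ _ (plusUnits F K) * n = _ * _ * tateIndex _ _ (plusUnits F K) at key
  set c := ((Subgroup.comap (normUnits F⟮X⟯ K) (completionPowers F n)).map
    (toPrincipalIdeal OK K)).relIndex _
  set h₁ := tateIndex (actionDiff (unitsAction K Gal(K/F⟮X⟯)) g)
    (actionNorm (unitsAction K Gal(K/F⟮X⟯))) (plusUnits F K)
  set h₀ := tateIndex (actionNorm (unitsAction K Gal(K/F⟮X⟯)))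
    (actionDiff (unitsAction K Gal(K/F⟮X⟯)) g) (plusUnits F K)
  set e := ∏ v ∈ T, ramIn OK v
  set m := ((completionPowers F n).comap (normUnits F⟮X⟯ K)).index
  have hd0 := inftyDegree_ne_zero F K
  -- The extra factor e_∞ f_∞ is what allows both identities at infinity to be substituted without
  -- division.
  refine mul_right_cancel₀ (b := h₁ * n * inftyDegree F K)
    (mul_ne_zero (mul_ne_zero h10 hn0.ne') hd0) ?_
  calc c * (h₁ * n * inftyDegree F K) = (c * h₁ * n) * inftyDegree F K := by ring
    _ = e * h₀ * (m * inftyDegree F K) := by rw [key]; ring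
    _ = e * n * (n * h₀) := by rw [hidx]; ring
    _ = e * (h₁ * n * inftyDegree F K) := by rw [← h1]; ring

theorem exists_finset_card_ambiguousClasses_eq [Finite F] [IsCyclic Gal(K/F⟮X⟯)]
    (hn : Module.finrank F⟮X⟯ K ∣ Nat.card F - 1) : ∃ S : Finset F[X],
      (∀ P : F[X], P ∈ S ↔ P.Monic ∧ Irreducible P ∧ 1 < ramIndex F K P) ∧
      Nat.card (ambiguousClasses F K) = ∏ P ∈ S, ramIndex F K P := by
  obtain ⟨S, T, hS, hT, hST⟩ := exists_finset_ramIndex F K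
  exact ⟨S, hS, by rw [card_ambiguousClasses_eq hn T hT, hST]⟩

end Final

end

end AmbiguousClasses

theorem theorem4p4 {Fq K : Type*} [Field Fq] [Finite Fq] [Field K]
    [Algebra Fq[X] K] [Algebra Fq⟮X⟯ K] [IsScalarTower Fq[X] Fq⟮X⟯ K]
    [FunctionField Fq K] [IsGalois Fq⟮X⟯ K] [IsCyclic (K ≃ₐ[Fq⟮X⟯] K)]
    (n : ℕ) (hdeg : Module.finrank Fq⟮X⟯ K = n) (hn : n ∣ Nat.card Fq - 1) :
    ∃ S : Finset Fq[X],
      (∀ P : Fq[X], P ∈ S ↔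
        P.Monic ∧ Irreducible P ∧ 1 < AmbiguousClasses.ramIndex Fq K P) ∧
      Nat.card (AmbiguousClasses.ambiguousClasses Fq K) =
        ∏ P ∈ S, AmbiguousClasses.ramIndex Fq K P := by
  exact (by subst hdeg; exact AmbiguousClasses.exists_finset_card_ambiguousClasses_eq hn)
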